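/- A non-adaptive group testing strategy for $n$ items with $t$ tests is a sequence of $t$ pools (subsets of the $n$ items) fixed in advance; a test answers "yes" if its pool contains a defective. The strategy finds up to $d$ defectives if the answers determine every set of at most $d$ defectives. For such a strategy $\mathcal A$ let $\tilde y_{\mathcal A}(d,n,t)$ be the maximum number of "yes" answers over all sets of at most $d$ defectives. The underlying family consists, for each item, of the set of tests whose pool contains it; to construct it means to output a listing of the elements of its $n$ members. Running times are numbers of steps of a random access machine whose words are numbers below $(n+t)^{e}$ for an absolute constant $e$ (i.e. words of $O(\log(n+t))$ bits), with input $n,d,t$. Then there are an absolute constant $C_0>0$ and two fixed programs such that the following holds for all positive integers $n,d,t$ with $n\ge 2$, $n\geq d\geq 1$ and $t\ge C_0\,d^2\ln n$. (1) If in addition $t\le K d^2\ln n$ for a constant $K$, then there is a non-adaptive strategy $\mathcal A$ with $t$ tests that finds up to $d$ defectives and for which $$\tilde y_{\mathcal A}(d,n,t)\ \ge\ \frac{(t+1)d}{2(d+1)},\qquad \tilde y_{\mathcal A}(d,n,t)=\Theta(d^2\ln n),$$ and the first program constructs the underlying family in time $\Theta(dn\ln n)$. The constants hidden in the asymptotic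 notation depend only on $K$. (2) If in addition $t\le n^{Ad}$ for a positive integer constant $A$, then there is a non-adaptive strategy $\mathcal A$ with $t$ tests that finds up to $d$ defectives and for which $\tilde y_{\mathcal A}(d,n,t)<\frac{(t+1)d}{2(d+1)}$, $$\tilde y_{\mathcal A}(d,n,t)=\Theta\!\left(\frac{d^2\ln n}{\ln\left(t/\tilde y_{\mathcal A}(d,n,t)\right)}\right)\quad\text{and}\quad \tilde y_{\mathcal A}(d,n,t)=O\!\left(\frac{d^2\ln n}{\ln\left(t/(d^2\ln n)\right)}\right),$$ and the second program constructs the underlying family in time $$\Theta\!\left(\frac{dn\ln n}{\ln\left(t/\tilde y_{\mathcal A}(d,n,t)\right)}\right),\quad\text{which is}\quad O\!\left(\frac{dn\ln n}{\ln\left(t/(d^2\ln n)\right)}\right).$$ Moreover there are a finite field $\mathbb F_q$, integers $m$ and $k$, a linear code $\mathcal C\subseteq\mathbb F_q^m$ of dimension $k$ in which distinct codewords have Hamming distance at least $\frac{d}{d+1}m$, distinct codewords $c_1,\dots,c_n\in\mathcal C$, and an injection $f$ from $[m]\times\mathbb F_q$ to the set of tests, such that the $j$-th member of the underlying family is $\{f(i,c_j(i))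 : i\in[m]\}$. The constants hidden in the asymptotic notation depend only on $A$. -/

import Mathlib

namespace GroupTesting

/-! ## Non-adaptive group testing -/

/-- A non-adaptive strategy with `t` tests on the items `Fin n` is a list of pools, all fixed in
advance. -/
abbrev Strategy (n t : ℕ) : Type := Fin t → Finset (Fin n)

/-- The set of tests that answer "yes" when `D` is the set of defectives. -/
def response {n t : ℕ} (T : Strategy n t) (D : Finset (Fin n)) : Finset (Fin t) :=
  Finset.univ.filter fun i => (T i ∩ D).Nonempty

/-- The strategy finds every set of at most `d` defectives: the responses determine the set. -/
def Finds {n t : ℕ} (d : ℕ) (T : Strategy n t) : Prop :=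
  Set.InjOn (response T) {D : Finset (Fin n) | D.card ≤ d}

/-- The maximum number of "yes" responses over all sets of at most `d` defectives. -/
def maxYes {n t : ℕ} (d : ℕ) (T : Strategy n t) : ℕ :=
  (Finset.univ.filter fun D : Finset (Fin n) => D.card ≤ d).sup fun D => (response T D).card

/-- The underlying family: the `j`-th member is the set of the tests whose pool contains `j`. -/
def family {n t : ℕ} (T : Strategy n t) (j : Fin n) : Finset (Fin t) :=
  Finset.univ.filter fun i => j ∈ T i

/-! ## Families built from linear codes -/

/-- `C` is an `[m, k, δ m]` linear code over the finite field `K`: it has dimension `k`, and any two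
distinct codewords have Hamming distance at least `δ m`. -/
def IsLinearCode {K : Type} [Field K] [DecidableEq K] {m : ℕ}
    (C : Submodule K (Fin m → K)) (k : ℕ) (δ : ℝ) : Prop :=
  Module.finrank K C = k ∧
    ∀ x ∈ C, ∀ y ∈ C, x ≠ y → δ * (m : ℝ) ≤ (hammingDist x y : ℝ)

/-- The members of `F` are the sets `{f (i, c i) : i}`, for pairwise distinct codewords `c` of some
linear code of relative distance `δ` over some finite field `K`, where `f` is an injection of
`[m] × K` into the ground set. -/
def BuiltFromLinearCode {n t : ℕ} (F : Fin n → Finset (Fin t)) (δ : ℝ) : Prop :=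
  ∃ (m k : ℕ) (K : Type) (_ : Field K) (_ : Fintype K) (_ : DecidableEq K)
    (C : Submodule K (Fin m → K)) (f : Fin m × K ↪ Fin t) (c : Fin n ↪ C),
    IsLinearCode C k δ ∧
      ∀ j : Fin n, F j = Finset.univ.image fun i : Fin m => f (i, (c j : Fin m → K) i)

/-! ## A word random access machine with a step count -/

/-- The arithmetic of the machine (subtraction is truncated at `0`; `x / 0 = 0`, `x % 0 = x`). -/
inductive Op : Type
  | add | sub | mul | div | mod

/-- The value of an arithmetic operation. -/
def Op.eval : Op → ℕ → ℕ → ℕ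
  | .add, a, b => a + b
  | .sub, a, b => a - b
  | .mul, a, b => a * b
  | .div, a, b => a / b
  | .mod, a, b => a % b

/-- Programs. A program mentions finitely many registers (named by natural numbers); in addition
there is a memory of cells addressed by the contents of registers, and a write-only output. -/
inductive Prog : Type
  /-- `x := a` for a fixed number `a` -/
  | const (x a : ℕ) : Prog
  /-- `x := y o z` -/
  | op (o : Op) (x y z : ℕ) : Prog
  /-- `x := mem[y]` -/
  | load (x y : ℕ) : Prog
  /-- `mem[x] := y` -/
  | store (x y : ℕ) : Prog
  /-- append the contents of `x` to the output -/
  | write (x : ℕ) : Prog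
  /-- run one program, then the other -/
  | seq (p₁ p₂ : Prog) : Prog
  /-- run `p₁` if the contents of `x` are nonzero, and `p₂` otherwise -/
  | branch (x : ℕ) (p₁ p₂ : Prog) : Prog
  /-- repeat `p` as long as the contents of `x` are nonzero -/
  | loop (x : ℕ) (p : Prog) : Prog

/-- A state of the machine. -/
structure State : Type where
  /-- contents of the registers -/
  reg : ℕ → ℕ
  /-- contents of the memory -/
  mem : ℕ → ℕ
  /-- the output so far -/
  out : List ℕ

/-- `Exec W p s s' τ`: started in state `s`, the program `p` halts in state `s'` after exactly `τ`
steps. Every instruction and every test of a branch or a loop is one step. All numbers that are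
produced must be machine words, i.e. smaller than `W`; a program that exceeds this bound has no
execution. -/
inductive Exec (W : ℕ) : Prog → State → State → ℕ → Prop
  | const {x a : ℕ} {s : State} (h : a < W) :
      Exec W (.const x a) s { s with reg := Function.update s.reg x a } 1
  | op {o : Op} {x y z : ℕ} {s : State} (h : o.eval (s.reg y) (s.reg z) < W) :
      Exec W (.op o x y z) s
        { s with reg := Function.update s.reg x (o.eval (s.reg y) (s.reg z)) } 1
  | load {x y : ℕ} {s : State} :
      Exec W (.load x y) s { s with reg := Function.update s.reg x (s.mem (s.reg y)) } 1
  | store {x y : ℕ} {s : State} :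
      Exec W (.store x y) s { s with mem := Function.update s.mem (s.reg x) (s.reg y) } 1
  | write {x : ℕ} {s : State} :
      Exec W (.write x) s { s with out := s.out ++ [s.reg x] } 1
  | seq {p₁ p₂ : Prog} {s₁ s₂ s₃ : State} {τ₁ τ₂ : ℕ}
      (h₁ : Exec W p₁ s₁ s₂ τ₁) (h₂ : Exec W p₂ s₂ s₃ τ₂) :
      Exec W (.seq p₁ p₂) s₁ s₃ (τ₁ + τ₂)
  | branchTrue {x : ℕ} {p₁ p₂ : Prog} {s s' : State} {τ : ℕ}
      (hx : s.reg x ≠ 0) (h : Exec W p₁ s s' τ) :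
      Exec W (.branch x p₁ p₂) s s' (τ + 1)
  | branchFalse {x : ℕ} {p₁ p₂ : Prog} {s s' : State} {τ : ℕ}
      (hx : s.reg x = 0) (h : Exec W p₂ s s' τ) :
      Exec W (.branch x p₁ p₂) s s' (τ + 1)
  | loopTrue {x : ℕ} {p : Prog} {s₁ s₂ s₃ : State} {τ₁ τ₂ : ℕ}
      (hx : s₁.reg x ≠ 0) (h₁ : Exec W p s₁ s₂ τ₁) (h₂ : Exec W (.loop x p) s₂ s₃ τ₂) :
      Exec W (.loop x p) s₁ s₃ (τ₁ + τ₂ + 1)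
  | loopFalse {x : ℕ} {p : Prog} {s : State} (hx : s.reg x = 0) :
      Exec W (.loop x p) s s 1

/-- The initial state: `n`, `d`, `t` in the registers `0`, `1`, `2`, and everything else zero. -/
def initial (n d t : ℕ) : State where
  reg := fun x => if x = 0 then n else if x = 1 then d else if x = 2 then t else 0
  mem := fun _ => 0
  out := []

/-- `out` lists the family `F` member by member: for each member its cardinality, followed by its
elements, in any order and without repetition. -/
def Lists {n t : ℕ} (out : List ℕ) (F : Fin n → Finset (Fin t)) : Prop :=
  ∃ l : Fin n → List ℕ,
    (∀ j, (l j).Nodup ∧ ∀ a : ℕ, a ∈ l j ↔ ∃ i ∈ F j, (i : ℕ) = a) ∧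
      out = (List.ofFn l).flatMap fun r => r.length :: r

/-- On input `n`, `d`, `t`, and with words below `W`, the program `P` halts after exactly `τ` steps,
and its output is a listing of the family that underlies the strategy `T`. -/
def Constructs (W : ℕ) (P : Prog) {n t : ℕ} (d : ℕ) (T : Strategy n t) (τ : ℕ) : Prop :=
  ∃ s : State, Exec W P (initial n d t) s τ ∧ Lists s.out (family T)

end GroupTesting

namespace GroupTesting

-- Everything rests on a linear code in which distinct words agree in few places. A test is a pair
-- (i, v) of a position and a symbol, and an item belongs to the m tests (i, c(i)) given by its
-- codeword c. If distinct codewords agree in at most m/(d+1) positions, then d items cover at most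
-- dm/(d+1) < m of the tests of any other item, so the responses determine the defectives
-- (`finds_tableStrategy`), and the union of d members has between dm/2 and dm elements
-- (`le_maxYes_code`, `maxYes_code_le`).
--
-- The code is a derandomized Gilbert–Varshamov code whose generators are chosen one at a time. Each
-- of the k words so far gets the weight a^(number of agreements with the new generator). Taking as
-- each entry the symbol of least total weight multiplies the total weight by at most the average
-- factor (q + a - 1)/q (`pow_mul_sum_weights_le`). After m = (d+1)z entries, with q ≥ (d+1)a, the
-- total is at most k 4^z, because (1 + 1/(d+1))^(d+1) < 4. So if n 4^z < a^(z+1), no word agrees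
-- with the generator in more than z places (`card_agree_newRow_le`), and linearity turns this into
-- a bound on the zeros of all nonzero words (`exists_submodule`). The table of words grows
-- geometrically from level to level, so the whole computation takes O(nm) steps (`buildTable_wp`).
-- The output has at least nm entries and each costs a step, which gives the matching lower bound
-- (`Exec.length_out_le`).
--
-- For the parameters, a = 2^h, z is about log₂ n / (h - 2), and q is a prime between (d+1)a and
-- 2(d+1)a. Then mq is O(d² log n · a²) and m log a is of order d log n. The prime is found by trial
-- division in O((d+1)²a²) steps, which is affordable if (d+1)a² < n. Otherwise the alphabet has n
-- symbols and the same greedy procedure yields the repetition code.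
--
-- For many positive answers, h = 3; the code occupies at most a quarter of the tests, and the
-- others become private tests of the first d items, which all answer "yes" when these items are
-- defective (`le_maxYes_private`). For few positive answers and t < n^4, the power a² is chosen of
-- the order of t/(d² log n), so that log a is of the order of log(t/Y), where Y is the maximal
-- number of positive answers. For t ≥ n^4 the repetition code of length ⌊d/s⌋ + 1 with s = ⌊log_n
-- t⌋ is used; here t ≤ n^(Ad) keeps ms of order d. In both cases m log(t/(dm)) is of order d log n,
-- and `asymptotic_bounds` translates this into the claims.

infixr:60 " ;; " => Prog.seq

/-! ## Total correctness with a time bound -/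

/-- Started in `s`, the program `p` halts within `T` steps in a state that satisfies `Q`. -/
def Wp (W : ℕ) (p : Prog) (T : ℕ) (s : State) (Q : State → Prop) : Prop :=
  ∃ s' τ, Exec W p s s' τ ∧ τ ≤ T ∧ Q s'

/-- The state `s` with the contents of the register `x` replaced by `a`. -/
abbrev State.set (s : State) (x a : ℕ) : State := { s with reg := Function.update s.reg x a }

/-- The state `s` with the contents of the memory cell `x` replaced by `a`. -/
abbrev State.put (s : State) (x a : ℕ) : State := { s with mem := Function.update s.mem x a }

/-- The state `s` with `a` appended to the output. -/
abbrev State.emit (s : State) (a : ℕ) : State := { s with out := s.out ++ [a] }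

/-- The first `R` registers have the same contents in `s` and `s'`. -/
def Agree (R : ℕ) (s s' : State) : Prop := ∀ x < R, s'.reg x = s.reg x

section

variable {W T T' T₁ T₂ : ℕ} {s : State} {Q Q' : State → Prop} {p p₁ p₂ : Prog} {o : Op}
  {x y z a : ℕ}

theorem Wp.mono (h : Wp W p T s Q) (hT : T ≤ T') (hQ : ∀ s', Q s' → Q' s') : Wp W p T' s Q' := by
  obtain ⟨s', τ, h₁, h₂, h₃⟩ := h
  exact ⟨s', τ, h₁, h₂.trans hT, hQ _ h₃⟩

theorem Wp.le (h : Wp W p T s Q) (hT : T ≤ T') : Wp W p T' s Q := h.mono hT fun _ h => h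

theorem Wp.const (h : a < W) (hQ : Q (s.set x a)) : Wp W (.const x a) 1 s Q :=
  ⟨_, _, Exec.const h, le_rfl, hQ⟩

theorem Wp.op (h : o.eval (s.reg y) (s.reg z) < W)
    (hQ : Q (s.set x (o.eval (s.reg y) (s.reg z)))) : Wp W (.op o x y z) 1 s Q :=
  ⟨_, _, Exec.op h, le_rfl, hQ⟩

theorem Wp.load (hQ : Q (s.set x (s.mem (s.reg y)))) : Wp W (.load x y) 1 s Q :=
  ⟨_, _, Exec.load, le_rfl, hQ⟩

theorem Wp.store (hQ : Q (s.put (s.reg x) (s.reg y))) : Wp W (.store x y) 1 s Q :=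
  ⟨_, _, Exec.store, le_rfl, hQ⟩

theorem Wp.write (hQ : Q (s.emit (s.reg x))) : Wp W (.write x) 1 s Q :=
  ⟨_, _, Exec.write, le_rfl, hQ⟩

theorem Wp.seq (h₁ : Wp W p₁ T₁ s Q') (h₂ : ∀ s', Q' s' → Wp W p₂ T₂ s' Q) :
    Wp W (p₁ ;; p₂) (T₁ + T₂) s Q := by
  obtain ⟨s', τ, h, hτ, hs⟩ := h₁
  obtain ⟨s'', τ', h', hτ', hs'⟩ := h₂ s' hs
  exact ⟨s'', τ + τ', Exec.seq h h', by omega, hs'⟩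

theorem Wp.const_seq (h : a < W) (hQ : Wp W p T (s.set x a) Q) :
    Wp W (.const x a ;; p) (T + 1) s Q :=
  ((Wp.const (Q := fun s' => s' = s.set x a) h rfl).seq (by rintro _ rfl; exact hQ)).le
    (by omega)

theorem Wp.op_seq (h : o.eval (s.reg y) (s.reg z) < W)
    (hQ : Wp W p T (s.set x (o.eval (s.reg y) (s.reg z))) Q) :
    Wp W (.op o x y z ;; p) (T + 1) s Q :=
  ((Wp.op (Q := fun s' => s' = s.set x (o.eval (s.reg y) (s.reg z))) h rfl).seq
    (by rintro _ rfl; exact hQ)).le (by omega)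

theorem Wp.load_seq (hQ : Wp W p T (s.set x (s.mem (s.reg y))) Q) :
    Wp W (.load x y ;; p) (T + 1) s Q :=
  ((Wp.load (Q := fun s' => s' = s.set x (s.mem (s.reg y))) rfl).seq
    (by rintro _ rfl; exact hQ)).le (by omega)

theorem Wp.branch (h₁ : s.reg x ≠ 0 → Wp W p₁ T s Q) (h₂ : s.reg x = 0 → Wp W p₂ T s Q) :
    Wp W (.branch x p₁ p₂) (T + 1) s Q := by
  by_cases hx : s.reg x = 0
  · obtain ⟨s', τ, h, hτ, hs⟩ := h₂ hx
    exact ⟨s', τ + 1, Exec.branchFalse hx h, by omega, hs⟩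
  · obtain ⟨s', τ, h, hτ, hs⟩ := h₁ hx
    exact ⟨s', τ + 1, Exec.branchTrue hx h, by omega, hs⟩

/-- A loop that is run exactly `N` times, where `I k` holds after `k` rounds. -/
theorem Wp.loop (I : ℕ → State → Prop) (N : ℕ) (c : ℕ → ℕ)
    (hbody : ∀ k < N, ∀ s, I k s → s.reg x ≠ 0 ∧ Wp W p (c k) s (I (k + 1)))
    (hend : ∀ s, I N s → s.reg x = 0 ∧ Q s) (h0 : I 0 s) :
    Wp W (.loop x p) (∑ k ∈ Finset.range N, (c k + 1) + 1) s Q := by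
  suffices H : ∀ r k s, k + r = N → I k s →
      Wp W (.loop x p) (∑ j ∈ Finset.range r, (c (k + j) + 1) + 1) s Q by
    simpa using H N 0 s (by omega) h0
  intro r
  induction r with
  | zero =>
    rintro k s rfl hI
    exact ⟨s, 1, Exec.loopFalse (hend s hI).1, by simp, (hend s hI).2⟩
  | succ r ih =>
    intro k s hk hI
    obtain ⟨hx, s', τ, he, hτ, hs'⟩ := hbody k (by omega) s hI
    obtain ⟨s'', τ', he', hτ', hs''⟩ := ih (k + 1) s' (by omega) hs'
    refine ⟨s'', τ + τ' + 1, Exec.loopTrue hx he he', ?_, hs''⟩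
    rw [Finset.sum_range_succ']
    have : ∀ j, k + 1 + j = k + (j + 1) := by intro j; omega
    simp only [this] at hτ'
    simp only [add_zero]
    omega

/-- Run `body` while the counter `i` is below the contents of `N`; `f` is a scratch register and
the register `one` contains `1`. -/
def forLoop (i f N one : ℕ) (body : Prog) : Prog :=
  .op .sub f N i ;; .loop f (body ;; .op .add i i one ;; .op .sub f N i)

theorem Agree.rfl {R : ℕ} : Agree R s s := fun _ _ => Eq.refl _

theorem Agree.trans {R : ℕ} {s₁ s₂ s₃ : State} (h : Agree R s₁ s₂) (h' : Agree R s₂ s₃) :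
    Agree R s₁ s₃ := fun x hx => (h' x hx).trans (h x hx)

theorem Agree.mono {R R' : ℕ} {s₁ s₂ : State} (h : Agree R s₁ s₂) (hR : R' ≤ R) :
    Agree R' s₁ s₂ := fun x hx => h x (hx.trans_le hR)

theorem Agree.set {R : ℕ} {s₁ s₂ : State} (h : Agree R s₁ s₂) (hx : R ≤ x) :
    Agree R s₁ (s₂.set x a) := fun y hy => by
  simpa [Function.update_apply, show y ≠ x by omega] using h y hy

/-- A round costs the body plus three steps: the increment, the new difference and the loop test.
The two further steps are the first difference and the failing test. The registers below `R` are
those that the body must preserve. By `hJ` the invariant is insensitive to the counter and the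
scratch register, so the bookkeeping cannot destroy it. -/
theorem Wp.for {i f N one : ℕ} {body : Prog} (R : ℕ) (J : ℕ → State → Prop) (k₀ k₁ c : ℕ)
    (hRi : R ≤ i) (hRf : R ≤ f) (hif : i ≠ f) (hN : N < R) (hone : one < R)
    (hk : k₀ ≤ k₁) (hW : k₁ < W)
    (hi : s.reg i = k₀) (hsN : s.reg N = k₁) (hsone : s.reg one = 1)
    (hJ : ∀ k s r, J k s → (∀ x, x ≠ i → x ≠ f → r x = s.reg x) → J k { s with reg := r })
    (hbody : ∀ k s', k₀ ≤ k → k < k₁ → J k s' → s'.reg i = k → Agree R s s' →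
      Wp W body c s' fun s'' => J (k + 1) s'' ∧ s''.reg i = k ∧ Agree R s s'')
    (h0 : J k₀ s) (hQ : ∀ s', J k₁ s' → s'.reg i = k₁ → Agree R s s' → Q s')
    (hT : (k₁ - k₀) * (c + 3) + 2 ≤ T) : Wp W (forLoop i f N one body) T s Q := by
  have hWp := Wp.loop (W := W) (x := f) (p := body ;; .op .add i i one ;; .op .sub f N i)
    (Q := Q) (s := s.set f (k₁ - k₀))
    (fun k s' => J (k₀ + k) s' ∧ s'.reg i = k₀ + k ∧ s'.reg f = k₁ - (k₀ + k) ∧ Agree R s s')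
    (k₁ - k₀) (fun _ => c + 2) ?_ ?_ ?_
  · refine (Wp.op_seq (o := .sub) (by simp [Op.eval, hi, hsN]; omega) (?_)).le
      hT
    simpa [Op.eval, hi, hsN] using hWp
  · rintro k hk s' ⟨h1, h2, h3, h4⟩
    refine ⟨by rw [h3]; omega, ?_⟩
    refine (hbody (k₀ + k) s' (by omega) (by omega) h1 h2 h4).seq ?_
    rintro s'' ⟨g1, g2, g3⟩
    have e1 : s''.reg one = 1 := (g3 _ hone).trans hsone
    have eN : s''.reg N = k₁ := (g3 _ hN).trans hsN
    refine Wp.op_seq (T := 1) (by simp [Op.eval, g2, e1]; omega) ?_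
    refine Wp.op (by simp [Op.eval, eN, show N ≠ i by omega]; omega) ?_
    have hifs : f ≠ i := Ne.symm hif
    refine ⟨?_, ?_, ?_, ?_⟩
    · rw [← add_assoc]
      refine hJ _ s'' _ g1 fun x hxi hxf => ?_
      simp [Function.update_apply, hxi, hxf]
    · simp [Op.eval, Function.update_apply, hif, g2, e1]; omega
    · simp [Op.eval, show N ≠ i by omega, g2, e1, eN]; omega
    · exact (g3.set hRi).set hRf
  · rintro s' ⟨h1, h2, h3, h4⟩
    rw [show k₀ + (k₁ - k₀) = k₁ by omega] at h1 h2 h3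
    exact ⟨by omega, hQ s' h1 h2 h4⟩
  · refine ⟨?_, ?_, ?_, ?_⟩
    · refine hJ _ s _ h0 fun x hxi hxf => ?_
      simp [hxf]
    · simp [hif, hi]
    · simp
    · exact Agree.rfl.set hRf

end

/-- Only `write` lengthens the output, by one entry in one step. All lower bounds for running times
come from this. -/
theorem Exec.length_out_le {W : ℕ} {p : Prog} {s s' : State} {τ : ℕ} (h : Exec W p s s' τ) :
    s'.out.length ≤ s.out.length + τ := by
  induction h <;> (try simp only [List.length_append, List.length_singleton]) <;> omega

/-! ## The greedy code -/

/-- The least `v < q` that minimizes `b`. -/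
def argMin (b : ℕ → ℕ) : ℕ → ℕ
  | 0 => 0
  | v + 1 => if b v < b (argMin b v) then v else argMin b v

theorem argMin_lt (b : ℕ → ℕ) {q : ℕ} (hq : 0 < q) : argMin b q < q := by
  induction q with
  | zero => omega
  | succ q ih =>
    rw [argMin]
    split_ifs
    · omega
    · rcases Nat.eq_zero_or_pos q with rfl | h
      · simp [argMin]
      · exact (ih h).trans (Nat.lt_succ_self q)

theorem apply_argMin_le (b : ℕ → ℕ) {q v : ℕ} (hv : v < q) : b (argMin b q) ≤ b v := by
  induction q with
  | zero => omega
  | succ q ih =>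
    rw [argMin]
    rcases Nat.lt_succ_iff_lt_or_eq.1 hv with h | rfl
    · have := ih h
      split_ifs <;> omega
    · split_ifs <;> omega

/-- The total weight of the words `c j`, `j < k`, whose `i`-th entry is `v`. -/
def bucket (c : ℕ → ℕ → ℕ) (w : ℕ → ℕ) (k i v : ℕ) : ℕ :=
  ∑ j ∈ Finset.range k, if c j i = v then w j else 0

/-- The weights of the words `c j`, `j < k`, after the first entries of the new row are chosen:
the weight is multiplied by `a` at every agreement with the new row. -/
def weights (q a k : ℕ) (c : ℕ → ℕ → ℕ) : ℕ → ℕ → ℕ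
  | 0, _ => 1
  | i + 1, j =>
    if c j i = argMin (bucket c (weights q a k c i) k i) q then weights q a k c i j * a
    else weights q a k c i j

/-- The new row: each entry is the one where the words `c j`, `j < k`, have the least weight. -/
def newRow (q a k : ℕ) (c : ℕ → ℕ → ℕ) (i : ℕ) : ℕ :=
  argMin (bucket c (weights q a k c i) k i) q

/-- The entry `i` of the codeword `j < q ^ l` of the code with the generators number `0, …, l - 1`;
all arithmetic is modulo `q`. -/
def code (q a : ℕ) : ℕ → ℕ → ℕ → ℕ
  | 0, _, _ => 0
  | l + 1, j, i => (code q a l (j % q ^ l) i + j / q ^ l * newRow q a (q ^ l) (code q a l) i) % q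

section

variable {q a : ℕ}

theorem weights_succ (k : ℕ) (c : ℕ → ℕ → ℕ) (i j : ℕ) : weights q a k c (i + 1) j =
    if c j i = newRow q a k c i then weights q a k c i j * a else weights q a k c i j := rfl

theorem newRow_lt (hq : 0 < q) (k : ℕ) (c : ℕ → ℕ → ℕ) (i : ℕ) : newRow q a k c i < q :=
  argMin_lt _ hq

theorem code_lt (hq : 0 < q) (l j i : ℕ) : code q a l j i < q := by
  cases l with
  | zero => exact hq
  | succ l => exact Nat.mod_lt _ hq

theorem code_succ_of_lt (hq : 0 < q) {l j : ℕ} (hj : j < q ^ l) (i : ℕ) :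
    code q a (l + 1) j i = code q a l j i := by
  rw [code, Nat.mod_eq_of_lt hj, Nat.div_eq_of_lt hj, zero_mul, add_zero,
    Nat.mod_eq_of_lt (code_lt hq ..)]

theorem code_zero_index (hq : 0 < q) (l i : ℕ) : code q a l 0 i = 0 := by
  induction l with
  | zero => rfl
  | succ l ih => rw [code_succ_of_lt hq (by positivity), ih]

theorem code_succ_pow (hq : 0 < q) (l i : ℕ) :
    code q a (l + 1) (q ^ l) i = newRow q a (q ^ l) (code q a l) i := by
  rw [code, Nat.mod_self, Nat.div_self (by positivity), one_mul, code_zero_index hq, zero_add,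
    Nat.mod_eq_of_lt (newRow_lt hq ..)]

/-- Subtracting `q ^ l` keeps the remainder of `j` and lowers the quotient by one. Hence each later
word is an earlier word plus the new generator, which is the recurrence by which the table is
extended. -/
theorem code_succ_of_le (hq : 0 < q) {l j : ℕ} (hj : q ^ l ≤ j) (i : ℕ) :
    code q a (l + 1) j i =
      (code q a (l + 1) (j - q ^ l) i + newRow q a (q ^ l) (code q a l) i) % q := by
  obtain ⟨j, rfl⟩ := Nat.exists_eq_add_of_le hj
  rw [Nat.add_sub_cancel_left, code, code, Nat.add_mod_left,
    Nat.add_div_left _ (by positivity), Nat.succ_mul, ← add_assoc, Nat.mod_add_mod]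

/-- When only the symbol 0 carries weight, 1 is the first empty bucket. Applied to the zero code,
this makes the first generator constantly 1, whether or not `q` is prime. -/
theorem argMin_eq_one (b : ℕ → ℕ) {q : ℕ} (hq : 2 ≤ q) (h0 : 0 < b 0)
    (h : ∀ v, 0 < v → b v = 0) : argMin b q = 1 := by
  induction q, hq using Nat.le_induction with
  | base => simp [argMin, h 1, h0]
  | succ v hv ih => rw [argMin, ih, h 1 one_pos, if_neg (Nat.not_lt_zero _)]

/-- The code with one generator is the repetition code. -/
theorem code_one (hq : 2 ≤ q) (ha : 0 < a) {j : ℕ} (hj : j < q) (i : ℕ) : code q a 1 j i = j := by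
  have hw : ∀ i, 0 < weights q a 1 (code q a 0) i 0 := by
    intro i
    induction i with
    | zero => simp [weights]
    | succ i ih => rw [weights]; split_ifs <;> positivity
  rw [code, pow_zero, newRow, argMin_eq_one _ hq]
  · simp [code, Nat.mod_eq_of_lt hj]
  · simpa [bucket, code] using hw i
  · intro v hv
    simp [bucket, code, hv.ne]

theorem sum_bucket {c : ℕ → ℕ → ℕ} {w : ℕ → ℕ} {k i : ℕ} (hc : ∀ j < k, c j i < q) :
    ∑ v ∈ Finset.range q, bucket c w k i v = ∑ j ∈ Finset.range k, w j := by
  unfold bucket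
  rw [Finset.sum_comm]
  refine Finset.sum_congr rfl fun j hj => ?_
  rw [Finset.sum_ite_eq, if_pos]
  exact Finset.mem_range.2 (hc j (Finset.mem_range.1 hj))

/-- Only the weights in the chosen bucket are multiplied by `a`. The additive form avoids the factor
`a - 1` in the natural numbers. -/
theorem sum_weights_succ_add {c : ℕ → ℕ → ℕ} {k i : ℕ} :
    ∑ j ∈ Finset.range k, weights q a k c (i + 1) j +
        bucket c (weights q a k c i) k i (newRow q a k c i) =
      ∑ j ∈ Finset.range k, weights q a k c i j +
        a * bucket c (weights q a k c i) k i (newRow q a k c i) := by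
  simp only [weights_succ]
  generalize newRow q a k c i = v
  generalize weights q a k c i = w
  rw [bucket, Finset.mul_sum, ← Finset.sum_add_distrib, ← Finset.sum_add_distrib]
  refine Finset.sum_congr rfl fun j _ => ?_
  split_ifs <;> ring

/-- This is the method of conditional expectations: the least bucket holds at most the fraction 1/q
of the total weight, so that each entry multiplies the total by at most (q + a - 1)/q. -/
theorem pow_mul_sum_weights_le {c : ℕ → ℕ → ℕ} {k m : ℕ} (ha : 0 < a)
    (hc : ∀ j < k, ∀ i < m, c j i < q) {i : ℕ} (hi : i ≤ m) :
    q ^ i * ∑ j ∈ Finset.range k, weights q a k c i j ≤ k * (q + (a - 1)) ^ i := by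
  induction i with
  | zero => simp [weights]
  | succ i ih =>
    have h1 := ih (by omega)
    have h2 := sum_weights_succ_add (q := q) (a := a) (c := c) (k := k) (i := i)
    have h3 : q * bucket c (weights q a k c i) k i (newRow q a k c i) ≤
        ∑ j ∈ Finset.range k, weights q a k c i j := by
      rw [← sum_bucket (q := q) fun j hj => hc j hj i (by omega)]
      have := Finset.card_nsmul_le_sum (Finset.range q) (bucket c (weights q a k c i) k i)
        (bucket c (weights q a k c i) k i (newRow q a k c i))
        fun v hv => apply_argMin_le _ (Finset.mem_range.1 hv)
      simpa using this
    obtain ⟨b, rfl⟩ : ∃ b, a = b + 1 := ⟨a - 1, by omega⟩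
    set S := ∑ j ∈ Finset.range k, weights q (b + 1) k c i j
    set S' := ∑ j ∈ Finset.range k, weights q (b + 1) k c (i + 1) j
    set B := bucket c (weights q (b + 1) k c i) k i (newRow q (b + 1) k c i)
    have h4 : S' = S + b * B := by linarith
    rw [Nat.add_sub_cancel] at h1 ⊢
    calc q ^ (i + 1) * S' = q ^ i * (q * S + b * (q * B)) := by rw [h4]; ring
      _ ≤ q ^ i * (q * S + b * S) := by gcongr
      _ = (q ^ i * S) * (q + b) := by ring
      _ ≤ (k * (q + b) ^ i) * (q + b) := by gcongr
      _ = k * (q + b) ^ (i + 1) := by ring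

theorem weights_eq_pow {c : ℕ → ℕ → ℕ} {k : ℕ} (i j : ℕ) :
    weights q a k c i j =
      a ^ ((Finset.range i).filter fun x => c j x = newRow q a k c x).card := by
  induction i with
  | zero => simp [weights]
  | succ i ih =>
    rw [weights_succ, Finset.range_add_one, Finset.filter_insert, ih]
    by_cases h : c j i = newRow q a k c i
    · rw [if_pos h, if_pos h, Finset.card_insert_of_notMem (by simp), pow_succ]
    · rw [if_neg h, if_neg h]

/-- No word agrees with the new row in more than `z` of the first `m` entries. -/
theorem card_agree_newRow_le {c : ℕ → ℕ → ℕ} {k m z : ℕ} (ha : 0 < a)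
    (hc : ∀ j < k, ∀ i < m, c j i < q)
    (hz : k * (q + (a - 1)) ^ m < q ^ m * a ^ (z + 1)) {j : ℕ} (hj : j < k) :
    ((Finset.range m).filter fun x => c j x = newRow q a k c x).card ≤ z := by
  -- A single word with z + 1 agreements would by itself have weight at least `a ^ (z + 1)`, more
  -- than the bound for the total.
  by_contra! h
  have h1 := pow_mul_sum_weights_le (q := q) ha hc le_rfl
  have h2 : weights q a k c m j ≤ ∑ j ∈ Finset.range k, weights q a k c m j :=
    Finset.single_le_sum (f := fun j => weights q a k c m j) (fun _ _ => Nat.zero_le _)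
      (Finset.mem_range.2 hj)
  rw [weights_eq_pow] at h2
  have h3 : a ^ (z + 1) ≤ a ^ ((Finset.range m).filter fun x => c j x = newRow q a k c x).card :=
    Nat.pow_le_pow_right ha h
  have := Nat.mul_le_mul_left (q ^ m) (h3.trans h2)
  omega

end

/-! ## The program that computes the code

The contents of the registers `0`, …, `9` are `n`, `d`, `t`, `m`, `q`, `a`, `u`, `1`, `n + q`, `0`.
The weights are kept in the cells from `0` on, the buckets in the cells from `n` on, and the
codewords, of `m` entries each, in the cells from `n + q` on. Register `10` contains the number of
codewords so far. -/

/-- The contents of the registers that are fixed while the code is computed. -/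
structure Regs (n d m q a u : ℕ) (s : State) : Prop where
  r0 : s.reg 0 = n
  r1 : s.reg 1 = d
  r3 : s.reg 3 = m
  r4 : s.reg 4 = q
  r5 : s.reg 5 = a
  r6 : s.reg 6 = u
  r7 : s.reg 7 = 1
  r8 : s.reg 8 = n + q
  r9 : s.reg 9 = 0

section

variable {W n d m q a u k : ℕ} {s s' : State}

theorem Regs.agree (h : Regs n d m q a u s) {R : ℕ} (hs : Agree R s s') (hR : 10 ≤ R) :
    Regs n d m q a u s' where
  r0 := (hs 0 (by omega)).trans h.r0
  r1 := (hs 1 (by omega)).trans h.r1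
  r3 := (hs 3 (by omega)).trans h.r3
  r4 := (hs 4 (by omega)).trans h.r4
  r5 := (hs 5 (by omega)).trans h.r5
  r6 := (hs 6 (by omega)).trans h.r6
  r7 := (hs 7 (by omega)).trans h.r7
  r8 := (hs 8 (by omega)).trans h.r8
  r9 := (hs 9 (by omega)).trans h.r9

/-- Set all weights to `1`. -/
def initWeights : Prog := .const 14 0 ;; forLoop 14 15 10 7 (.store 14 7)

theorem initWeights_wp (h : Regs n d m q a u s) (h10 : s.reg 10 = k) (hk : k < W) :
    Wp W initWeights (k * 4 + 3) s fun s' => (∀ j < k, s'.mem j = 1) ∧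
      (∀ x, k ≤ x → s'.mem x = s.mem x) ∧ s'.out = s.out ∧ Agree 14 s s' := by
  refine Wp.const_seq (T := k * 4 + 2) (by omega) ?_
  refine Wp.for 14 (fun i s' => (∀ j < i, s'.mem j = 1) ∧
    (∀ x, k ≤ x → s'.mem x = s.mem x) ∧ s'.out = s.out) 0 k 1 le_rfl (by norm_num) (by norm_num)
    (by norm_num) (by norm_num) (Nat.zero_le _) hk (by simp) (by simpa) (by simpa using h.r7)
    (fun _ _ _ h _ => h) ?_ ⟨by simp, by simp, rfl⟩ ?_ (by omega)
  · rintro i s' - hi ⟨h1, h2, h3⟩ h14 hs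
    have hr := h.agree (hs := (Agree.rfl.set le_rfl).trans hs) (by norm_num)
    refine Wp.store ⟨⟨?_, ?_, h3⟩, h14, hs⟩
    · intro j hj
      rcases Nat.lt_succ_iff_lt_or_eq.1 hj with hj | rfl
      · simpa [h14, hj.ne] using h1 j hj
      · simp [h14, hr.r7]
    · intro x hx
      simpa [h14, show x ≠ i by omega] using h2 x hx
  · rintro s' ⟨h1, h2, h3⟩ - hs
    exact ⟨h1, h2, h3, (Agree.rfl.set le_rfl).trans hs⟩

/-- Set all buckets to `0`. -/
def clearBuckets : Prog :=
  .const 17 0 ;; forLoop 17 18 4 7 (.op .add 19 0 17 ;; .store 19 9)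

theorem clearBuckets_wp (h : Regs n d m q a u s) (hW : n + q < W) :
    Wp W clearBuckets (q * 5 + 3) s fun s' => (∀ v < q, s'.mem (n + v) = 0) ∧
      (∀ x, x < n ∨ n + q ≤ x → s'.mem x = s.mem x) ∧ s'.out = s.out ∧ Agree 17 s s' := by
  refine Wp.const_seq (T := q * 5 + 2) (by omega) ?_
  refine Wp.for 17 (fun i s' => (∀ v < i, s'.mem (n + v) = 0) ∧
    (∀ x, x < n ∨ n + q ≤ x → s'.mem x = s.mem x) ∧ s'.out = s.out) 0 q 2 le_rfl (by norm_num)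
    (by norm_num) (by norm_num) (by norm_num) (Nat.zero_le _) (by omega) (by simp)
    (by simpa using h.r4) (by simpa using h.r7)
    (fun _ _ _ h _ => h) ?_ ⟨by simp, by simp, rfl⟩ ?_ (by omega)
  · rintro i s' - hi ⟨h1, h2, h3⟩ h17 hs
    have hr := h.agree (hs := (Agree.rfl.set le_rfl).trans hs) (by norm_num)
    refine Wp.op_seq (T := 1) (by simp [Op.eval, hr.r0, h17]; omega) ?_
    refine Wp.store ⟨⟨?_, ?_, h3⟩, by simpa using h17, hs.set (by norm_num)⟩
    · intro v hv
      rcases Nat.lt_succ_iff_lt_or_eq.1 hv with hv | rfl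
      · simpa [Op.eval, h17, hr.r0, hv.ne] using h1 v hv
      · simp [Op.eval, h17, hr.r0, hr.r9]
    · intro x hx
      simpa [Op.eval, h17, hr.r0, show x ≠ n + i by omega] using h2 x hx
  · rintro s' ⟨h1, h2, h3⟩ - hs
    exact ⟨h1, h2, h3, (Agree.rfl.set le_rfl).trans hs⟩

theorem row_add_lt {i j k m : ℕ} (hj : j < k) (hi : i < m) : j * m + i < k * m := by
  have := Nat.mul_le_mul_right m (Nat.succ_le_of_lt hj)
  rw [Nat.succ_mul] at this
  omega

/-- Add the weights of the codewords to the buckets of their entries number `reg 14`. -/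
def fillBuckets : Prog :=
  .const 17 0 ;; forLoop 17 18 10 7
    (.op .mul 19 17 3 ;; .op .add 19 19 8 ;; .op .add 19 19 14 ;; .load 19 19 ;;
      .op .add 19 0 19 ;; .load 20 19 ;; .load 21 17 ;; .op .add 20 20 21 ;; .store 19 20)

theorem fillBuckets_wp {c : ℕ → ℕ → ℕ} {w : ℕ → ℕ} {i : ℕ} (h : Regs n d m q a u s)
    (h10 : s.reg 10 = k) (h14 : s.reg 14 = i) (hi : i < m) (hk : k ≤ n)
    (hW : n + q + n * m < W) (hw : ∑ j ∈ Finset.range k, w j < W)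
    (hc : ∀ j < k, c j i < q) (hmw : ∀ j < k, s.mem j = w j)
    (hmc : ∀ j < k, s.mem (n + q + (j * m + i)) = c j i) (hmb : ∀ v < q, s.mem (n + v) = 0) :
    Wp W fillBuckets (k * 12 + 3) s fun s' => (∀ v < q, s'.mem (n + v) = bucket c w k i v) ∧
      (∀ x, x < n ∨ n + q ≤ x → s'.mem x = s.mem x) ∧ s'.out = s.out ∧ Agree 17 s s' := by
  refine Wp.const_seq (T := k * 12 + 2) (by omega) ?_
  refine Wp.for 17 (fun k s' => (∀ v < q, s'.mem (n + v) = bucket c w k i v) ∧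
    (∀ x, x < n ∨ n + q ≤ x → s'.mem x = s.mem x) ∧ s'.out = s.out) 0 k 9 le_rfl (by norm_num)
    (by norm_num) (by norm_num) (by norm_num) (Nat.zero_le _) (by omega) (by simp)
    (by simpa using h10) (by simpa using h.r7)
    (fun _ _ _ h _ => h) ?_ ⟨fun v hv => by simpa [bucket] using hmb v hv, by simp, rfl⟩ ?_ (by omega)
  · rintro j s' - hj ⟨h1, h2, h3⟩ h17 hs
    have hs' := (Agree.rfl.set (x := 17) (a := 0) le_rfl).trans hs
    have hr := h.agree hs' (by norm_num)
    have g14 : s'.reg 14 = i := (hs' 14 (by norm_num)).trans h14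
    have hlt := row_add_lt (hj.trans_le hk) hi
    have hcj := hc j hj
    have e1 : s'.mem (j * m + (n + q) + i) = c j i := by
      rw [h2 _ (by omega), ← hmc j hj]
      congr 1
      omega
    have e2 : s'.mem (n + c j i) = bucket c w j i (c j i) := h1 _ hcj
    have e3 : s'.mem j = w j := by rw [h2 _ (by omega), hmw j hj]
    have e4 : bucket c w (j + 1) i (c j i) = bucket c w j i (c j i) + w j := by
      rw [bucket, Finset.sum_range_succ, if_pos rfl, bucket]
    -- Every partial bucket is at most the total weight; this keeps the additions within a machine
    -- word.
    have e5 : bucket c w (j + 1) i (c j i) ≤ ∑ j ∈ Finset.range k, w j := by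
      refine (Finset.sum_le_sum fun x _ => ?_).trans
        (Finset.sum_le_sum_of_subset (Finset.range_subset_range.2 hj))
      split_ifs <;> simp
    refine Wp.op_seq (T := 8) (by simp [Op.eval, hr.r3, h17]; omega) ?_
    refine Wp.op_seq (by simp [Op.eval, hr.r3, h17, hr.r8]; omega) ?_
    refine Wp.op_seq (by simp [Op.eval, hr.r3, h17, hr.r8, g14]; omega) ?_
    refine Wp.load_seq ?_
    refine Wp.op_seq (by simp [Op.eval, hr.r0, hr.r3, h17, hr.r8, g14, e1]; omega) ?_
    refine Wp.load_seq (Wp.load_seq ?_)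
    refine Wp.op_seq
      (by simp [Op.eval, hr.r0, hr.r3, h17, hr.r8, g14, e1, e2, e3]; omega) ?_
    refine Wp.store ⟨⟨?_, ?_, h3⟩, by simpa using h17, ?_⟩
    · intro v hv
      by_cases hvc : v = c j i
      · subst hvc
        simp [Op.eval, hr.r0, hr.r3, h17, hr.r8, g14, e1, e2, e3, e4]
      · have : bucket c w (j + 1) i v = bucket c w j i v := by
          rw [bucket, Finset.sum_range_succ, if_neg (Ne.symm hvc), add_zero, bucket]
        simpa [Op.eval, hr.r0, hr.r3, h17, hr.r8, g14, e1, e2, e3, hvc, this] using h1 v hv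
    · intro x hx
      simpa [Op.eval, hr.r0, hr.r3, h17, hr.r8, g14, e1, e2, e3,
        show x ≠ n + c j i by omega] using h2 x hx
    · intro x hx
      simpa [Function.update_apply, show x ≠ 19 by omega, show x ≠ 20 by omega,
        show x ≠ 21 by omega] using hs x hx
  · rintro s' ⟨h1, h2, h3⟩ - hs
    exact ⟨h1, h2, h3, (Agree.rfl.set le_rfl).trans hs⟩

/-- Find the bucket with the least weight. -/
def findMin : Prog :=
  .const 16 0 ;; .const 17 0 ;; forLoop 17 18 4 7
    (.op .add 19 0 17 ;; .load 20 19 ;; .op .add 19 0 16 ;; .load 19 19 ;; .op .sub 19 19 20 ;;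
      .branch 19 (.op .add 16 17 9) (.op .add 16 16 9))

theorem findMin_wp {b : ℕ → ℕ} (h : Regs n d m q a u s) (hW : n + q < W)
    (hbW : ∀ v < q, b v < W) (hb : ∀ v < q, s.mem (n + v) = b v) :
    Wp W findMin (q * 10 + 4) s fun s' => s'.reg 16 = argMin b q ∧ s'.mem = s.mem ∧
      s'.out = s.out ∧ Agree 16 s s' := by
  refine Wp.const_seq (T := q * 10 + 3) (by omega) ?_
  refine Wp.const_seq (T := q * 10 + 2) (by omega) ?_
  refine Wp.for 16 (fun v s' => s'.reg 16 = argMin b v ∧ s'.mem = s.mem ∧ s'.out = s.out)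
    0 q 7 (by norm_num) (by norm_num)
    (by norm_num) (by norm_num) (by norm_num) (Nat.zero_le _) (by omega) (by simp)
    (by simpa using h.r4) (by simpa using h.r7) ?_ ?_ ⟨by simp [argMin], rfl, rfl⟩ ?_ (by omega)
  · rintro _ s' r ⟨h1, h2, h3⟩ hr
    exact ⟨by rw [← h1]; exact hr 16 (by norm_num) (by norm_num), h2, h3⟩
  · rintro v s' - hv ⟨h1, h2, h3⟩ h17 hs
    have hs' := ((Agree.rfl.set (x := 16) (a := 0) le_rfl).set (x := 17) (a := 0)
      (by norm_num)).trans hs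
    have hr := h.agree hs' (by norm_num)
    -- For v = 0 the minimizer is the default value 0, so the first round compares bucket 0 with
    -- itself.
    have hlt : argMin b v < q := by
      rcases Nat.eq_zero_or_pos v with rfl | h
      · simpa [argMin]
      · exact (argMin_lt b h).trans hv
    have e1 : s'.mem (n + v) = b v := by rw [h2]; exact hb v hv
    have e2 : s'.mem (n + argMin b v) = b (argMin b v) := by rw [h2]; exact hb _ hlt
    have hbv := hbW _ hlt
    have hbv' := hbW _ hv
    refine Wp.op_seq (T := 6) (by simp [Op.eval, hr.r0, h17]; omega) ?_
    refine Wp.load_seq ?_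
    refine Wp.op_seq (by simp [Op.eval, hr.r0, h1]; omega) ?_
    refine Wp.load_seq ?_
    refine Wp.op_seq (by simp [Op.eval, hr.r0, h1, h17, e1, e2]; omega) ?_
    have hsub : ∀ c, ∀ s'' : State, (∀ x, x ≠ 16 → x ≠ 19 → x ≠ 20 → s''.reg x = s'.reg x) →
        s''.mem = s'.mem → s''.out = s'.out → s''.reg 16 = c → c = argMin b (v + 1) →
        (s''.reg 16 = argMin b (v + 1) ∧ s''.mem = s.mem ∧ s''.out = s.out) ∧
          s''.reg 17 = v ∧ Agree 16 ((s.set 16 0).set 17 0) s'' := by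
      intro c s'' k1 k2 k3 k4 k5
      refine ⟨⟨k4.trans k5, k2.trans h2, k3.trans h3⟩, ?_, ?_⟩
      · rw [k1 17 (by norm_num) (by norm_num) (by norm_num), h17]
      · intro x hx
        rw [k1 x (by omega) (by omega) (by omega)]
        exact hs x hx
    -- Register `19` holds the truncated difference of the best bucket so far and bucket v, which is
    -- nonzero exactly if v is strictly better. Adding register `9`, which contains 0, serves to
    -- copy.
    refine Wp.branch (T := 1) ?_ ?_
    · intro hne
      refine Wp.op ?_ (hsub v _ ?_ rfl rfl ?_ ?_)
      · simp [Op.eval, h17, hr.r9]; omega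
      · intro x h16 h19 h20
        simp [h16, h19, h20]
      · simp [Op.eval, h17, hr.r9]
      · rw [argMin, if_pos]
        simp [Op.eval, hr.r0, h1, h17, e1, e2] at hne
        omega
    · intro heq
      refine Wp.op ?_ (hsub (argMin b v) _ ?_ rfl rfl ?_ ?_)
      · simp [Op.eval, h1, hr.r9]; omega
      · intro x h16 h19 h20
        simp [h16, h19, h20]
      · simp [Op.eval, h1, hr.r9]
      · rw [argMin, if_neg]
        simp [Op.eval, hr.r0, h1, h17, e1, e2] at heq
        omega
  · rintro s' ⟨h1, h2, h3⟩ - hs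
    exact ⟨h1, h2, h3, ((Agree.rfl.set le_rfl).set (by norm_num)).trans hs⟩

/-- Multiply by `a` the weights of the codewords whose entry number `reg 14` is `reg 16`. -/
def updateWeights : Prog :=
  .const 17 0 ;; forLoop 17 18 10 7
    (.op .mul 19 17 3 ;; .op .add 19 19 8 ;; .op .add 19 19 14 ;; .load 19 19 ;;
      .op .sub 20 19 16 ;; .op .sub 21 16 19 ;; .op .add 20 20 21 ;; .load 21 17 ;;
      .branch 20 (.store 17 21) (.op .mul 21 21 5 ;; .store 17 21))

theorem updateWeights_wp {c : ℕ → ℕ → ℕ} {w w' : ℕ → ℕ} {i v : ℕ} (h : Regs n d m q a u s)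
    (h10 : s.reg 10 = k) (h14 : s.reg 14 = i) (h16 : s.reg 16 = v) (hi : i < m) (hk : k ≤ n)
    (hW : n + q + n * m < W)
    (hc : ∀ j < k, c j i < q) (hv : v < q) (hmw : ∀ j < k, s.mem j = w j)
    (hmc : ∀ j < k, s.mem (n + q + (j * m + i)) = c j i)
    (hw' : ∀ j < k, w' j = if c j i = v then w j * a else w j) (hwW : ∀ j < k, w' j < W) :
    Wp W updateWeights (k * 14 + 3) s fun s' => (∀ j < k, s'.mem j = w' j) ∧
      (∀ x, n ≤ x → s'.mem x = s.mem x) ∧ s'.out = s.out ∧ Agree 17 s s' := by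
  refine Wp.const_seq (T := k * 14 + 2) (by omega) ?_
  refine Wp.for 17 (fun l s' => (∀ j < k, s'.mem j = if j < l then w' j else w j) ∧
    (∀ x, n ≤ x → s'.mem x = s.mem x) ∧ s'.out = s.out) 0 k 11 le_rfl (by norm_num)
    (by norm_num) (by norm_num) (by norm_num) (Nat.zero_le _) (by omega) (by simp)
    (by simpa using h10) (by simpa using h.r7)
    (fun _ _ _ h _ => h) ?_ ⟨fun v hv => by simpa using hmw v hv, by simp, rfl⟩ ?_ (by omega)
  · rintro j s' - hj ⟨h1, h2, h3⟩ h17 hs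
    have hs' := (Agree.rfl.set (x := 17) (a := 0) le_rfl).trans hs
    have hr := h.agree hs' (by norm_num)
    have g14 : s'.reg 14 = i := (hs' 14 (by norm_num)).trans h14
    have g16 : s'.reg 16 = v := (hs' 16 (by norm_num)).trans h16
    have hlt := row_add_lt (hj.trans_le hk) hi
    have hcj := hc j hj
    have e1 : s'.mem (j * m + (n + q) + i) = c j i := by
      rw [h2 _ (by omega), ← hmc j hj]
      congr 1
      omega
    have e3 : s'.mem j = w j := by rw [h1 j hj, if_neg (lt_irrefl _)]
    have hjW := hwW j hj
    have hj' := hw' j hj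
    refine Wp.op_seq (T := 10) (by simp [Op.eval, hr.r3, h17]; omega) ?_
    refine Wp.op_seq (by simp [Op.eval, hr.r3, h17, hr.r8]; omega) ?_
    refine Wp.op_seq (by simp [Op.eval, hr.r3, h17, hr.r8, g14]; omega) ?_
    refine Wp.load_seq ?_
    refine Wp.op_seq (by simp [Op.eval, hr.r3, h17, hr.r8, g14, g16, e1]; omega) ?_
    refine Wp.op_seq (by simp [Op.eval, hr.r3, h17, hr.r8, g14, g16, e1]; omega) ?_
    refine Wp.op_seq (by simp [Op.eval, hr.r3, h17, hr.r8, g14, g16, e1]; omega) ?_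
    refine Wp.load_seq ?_
    have hsub : ∀ s'' : State, (∀ x, x ≠ 19 → x ≠ 20 → x ≠ 21 → s''.reg x = s'.reg x) →
        s''.mem = Function.update s'.mem j (w' j) → s''.out = s'.out →
        ((∀ y < k, s''.mem y = if y < j + 1 then w' y else w y) ∧
          (∀ x, n ≤ x → s''.mem x = s.mem x) ∧ s''.out = s.out) ∧
          s''.reg 17 = j ∧ Agree 17 (s.set 17 0) s'' := by
      intro s'' k1 k2 k3
      refine ⟨⟨?_, ?_, k3.trans h3⟩, ?_, ?_⟩
      · intro y hy
        rw [k2, Function.update_apply]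
        by_cases hyj : y = j
        · simp [hyj]
        · rw [if_neg hyj, h1 y hy]
          simp [show y < j + 1 ↔ y < j by omega]
      · intro x hx
        rw [k2, Function.update_of_ne (by omega), h2 x hx]
      · rw [k1 17 (by norm_num) (by norm_num) (by norm_num), h17]
      · intro x hx
        rw [k1 x (by omega) (by omega) (by omega)]
        exact hs x hx
    -- Register `20` holds the sum of the two truncated differences, which vanishes exactly if the
    -- entry equals that of the new row.
    refine Wp.branch (T := 2) ?_ ?_
    · intro hne
      refine Wp.le (T := 1) (Wp.store ?_) (by norm_num)
      refine hsub _ ?_ ?_ rfl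
      · intro x h19 h20 h21
        simp [h19, h20, h21]
      · simp [Op.eval, hr.r3, h17, hr.r8, g14, g16, e1] at hne
        rw [if_neg (by omega)] at hj'
        simp [h17, e3, hj']
    · intro heq
      simp [Op.eval, hr.r3, h17, hr.r8, g14, g16, e1] at heq
      rw [if_pos (by omega)] at hj'
      refine Wp.op_seq (T := 1) ?_ (Wp.store (hsub _ ?_ ?_ rfl))
      · simpa [Op.eval, hr.r5, h17, e3, ← hj'] using hjW
      · intro x h19 h20 h21
        simp [h19, h20, h21]
      · simp [Op.eval, hr.r5, h17, e3, hj']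
  · rintro s' ⟨h1, h2, h3⟩ - hs
    refine ⟨fun j hj => by rw [h1 j hj, if_pos hj], h2, h3, (Agree.rfl.set le_rfl).trans hs⟩

end

/-! ### Adding a generator and extending the table -/

section

variable {W n d m q a u k : ℕ} {s s' : State}

/-- The memory between two choices of entries of a new row, `i` of which have been chosen. -/
structure RowMem (n m q a k : ℕ) (c : ℕ → ℕ → ℕ) (i : ℕ) (s : State) : Prop where
  weight : ∀ j < k, s.mem j = weights q a k c i j
  word : ∀ j < k, ∀ x < m, s.mem (n + q + (j * m + x)) = c j x
  row : ∀ x < i, s.mem (n + q + (k * m + x)) = newRow q a k c x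

/-- Choose the entry number `reg 14` of the new row. -/
def chooseEntry : Prog :=
  clearBuckets ;; fillBuckets ;; findMin ;;
    (.op .mul 19 10 3 ;; .op .add 19 19 8 ;; .op .add 19 19 14 ;; .store 19 16) ;; updateWeights

theorem chooseEntry_wp {c : ℕ → ℕ → ℕ} {i : ℕ} (h : Regs n d m q a u s)
    (h10 : s.reg 10 = k) (h14 : s.reg 14 = i) (hi : i < m) (hk : k < n) (hq : 0 < q)
    (hW : n + q + n * m < W) (hc : ∀ j < k, ∀ i, c j i < q)
    (hw : ∀ i ≤ m, ∑ j ∈ Finset.range k, weights q a k c i j < W)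
    (hm : RowMem n m q a k c i s) :
    Wp W chooseEntry (15 * q + 26 * k + 17) s fun s' => RowMem n m q a k c (i + 1) s' ∧
      s'.out = s.out ∧ Agree 16 s s' := by
  have hkm := row_add_lt hk hi
  have hlt : ∀ j x, j < k → x < m → j * m + x < k * m := fun j x hj hx => row_add_lt hj hx
  refine Wp.le (T := (q * 5 + 3) + ((k * 12 + 3) + ((q * 10 + 4) + (4 + (k * 14 + 3)))))
    ?_ (by omega)
  refine (clearBuckets_wp h (by omega)).seq ?_
  rintro s₁ ⟨b1, m1, o1, A1⟩
  have e1 : s₁.reg 10 = k := (A1 10 (by norm_num)).trans h10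
  have e1' : s₁.reg 14 = i := (A1 14 (by norm_num)).trans h14
  refine (fillBuckets_wp (c := c) (w := weights q a k c i) (h.agree A1 (by norm_num)) e1 e1' hi
    hk.le hW (hw i hi.le) (fun j hj => hc j hj i)
    (fun j hj => by rw [m1 _ (by omega), hm.weight j hj])
    (fun j hj => by rw [m1 _ (by omega), hm.word j hj i hi]) b1).seq ?_
  rintro s₂ ⟨b2, m2, o2, A2⟩
  have A2' := (A1.trans A2).mono (R' := 16) (by norm_num)
  refine (findMin_wp (b := bucket c (weights q a k c i) k i) (h.agree A2' (by norm_num))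
    (by omega) (fun v hv => ?_) b2).seq ?_
  · refine lt_of_le_of_lt ?_ (hw i hi.le)
    refine Finset.sum_le_sum fun x _ => ?_
    split_ifs <;> simp
  rintro s₃ ⟨r3, m3, o3, A3⟩
  change s₃.reg 16 = newRow q a k c i at r3
  have A3' := A2'.trans A3
  have R3 := h.agree A3' (by norm_num)
  have e3 : s₃.reg 10 = k := (A3' 10 (by norm_num)).trans h10
  have e3' : s₃.reg 14 = i := (A3' 14 (by norm_num)).trans h14
  have hlow : ∀ x, x < n ∨ n + q ≤ x → s₃.mem x = s.mem x := fun x hx => by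
    rw [m3, m2 x hx, m1 x hx]
  refine Wp.seq (Q' := fun s' =>
    s'.mem = Function.update s₃.mem (n + q + (k * m + i)) (newRow q a k c i) ∧
      s'.out = s₃.out ∧ s'.reg 16 = newRow q a k c i ∧ Agree 16 s₃ s') ?_ ?_
  · refine Wp.op_seq (T := 3) (by simp [Op.eval, R3.r3, e3]; omega) ?_
    refine Wp.op_seq (by simp [Op.eval, R3.r3, e3, R3.r8]; omega) ?_
    refine Wp.op_seq (by simp [Op.eval, R3.r3, e3, R3.r8, e3']; omega) ?_
    refine Wp.store ⟨?_, rfl, by simpa using r3,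
      ((Agree.rfl.set (by norm_num)).set (by norm_num)).set (by norm_num)⟩
    simp [Op.eval, R3.r3, e3, R3.r8, e3', r3,
      show k * m + (n + q) + i = n + q + (k * m + i) by omega]
  rintro s₄ ⟨m4, o4, r4, A4⟩
  have A4' := A3'.trans A4
  have e4 : s₄.reg 10 = k := (A4' 10 (by norm_num)).trans h10
  have e4' : s₄.reg 14 = i := (A4' 14 (by norm_num)).trans h14
  refine (updateWeights_wp (c := c) (w := weights q a k c i) (w' := weights q a k c (i + 1))
    (h.agree A4' (by norm_num)) e4 e4' r4 hi hk.le hW (fun j hj => hc j hj i)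
    (newRow_lt hq ..) ?_ ?_ (fun _ _ => rfl) ?_).mono le_rfl ?_
  · intro j hj
    rw [m4, Function.update_of_ne (by omega), hlow _ (by omega), hm.weight j hj]
  · intro j hj
    have := hlt j i hj hi
    rw [m4, Function.update_of_ne (by omega), hlow _ (by omega), hm.word j hj i hi]
  · intro j hj
    exact (Finset.single_le_sum (f := fun j => weights q a k c (i + 1) j)
      (fun _ _ => Nat.zero_le _) (Finset.mem_range.2 hj)).trans_lt (hw (i + 1) hi)
  rintro s₅ ⟨w5, m5, o5, A5⟩
  refine ⟨⟨w5, ?_, ?_⟩, by rw [o5, o4, o3, o2, o1], A4'.trans (A5.mono (by norm_num))⟩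
  · intro j hj x hx
    have := hlt j x hj hx
    rw [m5 _ (by omega), m4, Function.update_of_ne (by omega), hlow _ (by omega),
      hm.word j hj x hx]
  · intro x hx
    rw [m5 _ (by omega), m4]
    rcases Nat.lt_succ_iff_lt_or_eq.1 hx with hx | rfl
    · rw [Function.update_of_ne (by omega), hlow _ (by omega), hm.row x hx]
    · rw [Function.update_self]

/-- Choose a new row. -/
def chooseRow : Prog := .const 14 0 ;; forLoop 14 15 3 7 chooseEntry

theorem chooseRow_wp {c : ℕ → ℕ → ℕ} (h : Regs n d m q a u s)
    (h10 : s.reg 10 = k) (hk : k < n) (hq : 0 < q) (hmW : m < W)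
    (hW : n + q + n * m < W) (hc : ∀ j < k, ∀ i, c j i < q)
    (hw : ∀ i ≤ m, ∑ j ∈ Finset.range k, weights q a k c i j < W)
    (hm : RowMem n m q a k c 0 s) :
    Wp W chooseRow (m * (15 * q + 26 * k + 20) + 3) s fun s' => RowMem n m q a k c m s' ∧
      s'.out = s.out ∧ Agree 14 s s' := by
  refine Wp.const_seq (T := m * (15 * q + 26 * k + 20) + 2) (by omega) ?_
  refine Wp.for 14 (fun i s' => RowMem n m q a k c i s' ∧ s'.out = s.out) 0 m
    (15 * q + 26 * k + 17) le_rfl (by norm_num)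
    (by norm_num) (by norm_num) (by norm_num) (Nat.zero_le _) (by omega) (by simp)
    (by simpa using h.r3) (by simpa using h.r7)
    (fun _ _ _ h _ => ⟨⟨h.1.1, h.1.2, h.1.3⟩, h.2⟩) ?_ ⟨⟨hm.1, hm.2, hm.3⟩, rfl⟩ ?_
    (le_of_eq (by rw [Nat.sub_zero]))
  · rintro i s' - hi ⟨h1, h2⟩ h14 hs
    have hs' := (Agree.rfl.set (x := 14) (a := 0) le_rfl).trans hs
    refine (chooseEntry_wp (h.agree hs' (by norm_num)) ((hs' 10 (by norm_num)).trans h10) h14 hi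
      hk hq hW hc hw h1).mono le_rfl ?_
    rintro s'' ⟨g1, g2, g3⟩
    exact ⟨⟨g1, g2.trans h2⟩, (g3 14 (by norm_num)).trans h14,
      hs.trans (g3.mono (by norm_num))⟩
  · rintro s' ⟨h1, h2⟩ - hs
    exact ⟨h1, h2, (Agree.rfl.set le_rfl).trans hs⟩

/-- Extend the table of the codewords, the last of which is a new generator. -/
def extendTable : Prog :=
  (.op .mul 12 10 4 ;; .op .sub 12 0 12 ;; .op .sub 12 0 12 ;; .op .mul 12 12 3 ;;
    .op .mul 13 10 3 ;; .op .add 14 13 3) ;; forLoop 14 15 12 7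
      (.op .sub 16 14 13 ;; .op .add 16 16 8 ;; .load 16 16 ;; .op .mod 17 14 3 ;;
        .op .add 17 17 13 ;; .op .add 17 17 8 ;; .load 17 17 ;; .op .add 16 16 17 ;;
        .op .mod 16 16 4 ;; .op .add 17 14 8 ;; .store 17 16)

/-- The table is filled linearly in x = j m + i. The loop starts at k m + m because row k, the new
generator, is already in place; each entry is the sum of the one k rows above and the entry of the
generator in the same column. -/
theorem extendTable_wp {c : ℕ → ℕ → ℕ} (h : Regs n d m q a u s)
    (h10 : s.reg 10 = k) (hk0 : 0 < k) (hk : k < n) (hq : 2 ≤ q) (hm0 : 0 < m)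
    (hW : n + q + n * m < W) (hnq : n * q < W) (hqW : 2 * q ≤ W) (hc : ∀ j i, c j i < q)
    (hrec : ∀ j i, k ≤ j → c j i = (c (j - k) i + c k i) % q)
    (hmem : ∀ j ≤ k, ∀ i < m, s.mem (n + q + (j * m + i)) = c j i) :
    Wp W extendTable (14 * (min (k * q) n * m) + 8) s fun s' =>
      (∀ j < min (k * q) n, ∀ i < m, s'.mem (n + q + (j * m + i)) = c j i) ∧
      s'.out = s.out ∧ Agree 12 s s' := by
  have hkq : k * q < n * q := Nat.mul_lt_mul_of_pos_right hk (by omega)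
  have hkq' : k < k * q := by nlinarith
  -- Two truncated subtractions compute the minimum without a branch.
  have hE : n - (n - k * q) = min (k * q) n := by omega
  have hEn : min (k * q) n * m ≤ n * m := Nat.mul_le_mul_right _ (by omega)
  have hkE : k * m + m ≤ min (k * q) n * m := by
    rw [← Nat.succ_mul]
    exact Nat.mul_le_mul_right _ (by omega)
  have hkm : 0 < k * m := Nat.mul_pos hk0 hm0
  generalize min (k * q) n = E at *
  refine Wp.le (T := 6 + (14 * (E * m) + 2)) (Wp.seq (Q' := fun s₁ => Agree 12 s s₁ ∧
    s₁.reg 12 = E * m ∧ s₁.reg 13 = k * m ∧ s₁.reg 14 = k * m + m ∧ s₁.mem = s.mem ∧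
    s₁.out = s.out) ?_ ?_) (by omega)
  · refine Wp.op_seq (T := 5) (by simp [Op.eval, h10, h.r4]; omega) ?_
    refine Wp.op_seq (by simp [Op.eval, h10, h.r4, h.r0]; omega) ?_
    refine Wp.op_seq (by simp [Op.eval, h10, h.r4, h.r0]; omega) ?_
    refine Wp.op_seq (by simp [Op.eval, h10, h.r4, h.r0, h.r3, hE]; omega) ?_
    refine Wp.op_seq (by simp [Op.eval, h10, h.r3]; omega) ?_
    refine Wp.op (by simp [Op.eval, h10, h.r3]; omega) ⟨?_, ?_, ?_, ?_, rfl, rfl⟩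
    · intro x hx
      simp [show x ≠ 12 by omega, show x ≠ 13 by omega,
        show x ≠ 14 by omega]
    · simp [Op.eval, h10, h.r4, h.r0, h.r3, hE]
    · simp [Op.eval, h10, h.r3]
    · simp [Op.eval, h10, h.r3]
  rintro s₁ ⟨A, e12, e13, e14, em, eo⟩
  have hR := h.agree A (by norm_num)
  refine Wp.for 14 (fun x s' => (∀ j i, i < m → j * m + i < x →
      s'.mem (n + q + (j * m + i)) = c j i) ∧ s'.out = s.out) (k * m + m) (E * m) 11 le_rfl
    (by norm_num) (by norm_num) (by norm_num) (by norm_num) hkE (by omega) e14 e12 hR.r7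
    (fun _ _ _ h _ => h) ?_ ⟨?_, eo⟩ ?_ (by omega)
  · rintro x s' hx hx' ⟨h1, h2⟩ h14 hs
    have g13 : s'.reg 13 = k * m := (hs 13 (by norm_num)).trans e13
    have hr := hR.agree hs (by norm_num)
    have hmod : x % m < m := Nat.mod_lt _ hm0
    have hdm : x / m * m + x % m = x := by rw [mul_comm]; exact Nat.div_add_mod x m
    have hkx : k ≤ x / m := by
      rw [Nat.le_div_iff_mul_le hm0]; omega
    have hsub : (x / m - k) * m + x % m = x - k * m := by
      rw [Nat.sub_mul]
      have := Nat.mul_le_mul_right m hkx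
      omega
    have f1 : s'.mem (x - k * m + (n + q)) = c (x / m - k) (x % m) := by
      rw [← h1 _ _ hmod (by omega), hsub, add_comm]
    have f2 : s'.mem (x % m + k * m + (n + q)) = c k (x % m) := by
      rw [← h1 _ _ hmod (by omega)]
      congr 1
      omega
    have l1 := hc (x / m - k) (x % m)
    have l2 := hc k (x % m)
    have l3 := hc (x / m) (x % m)
    have f3 := hrec (x / m) (x % m) hkx
    rw [f3] at l3
    refine Wp.op_seq (T := 10) (by simp [Op.eval, h14, g13]; omega) ?_
    refine Wp.op_seq (by simp [Op.eval, h14, g13, hr.r8]; omega) ?_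
    refine Wp.load_seq ?_
    refine Wp.op_seq (by simp [Op.eval, h14, g13, hr.r3]; omega) ?_
    refine Wp.op_seq (by simp [Op.eval, h14, g13, hr.r3]; omega) ?_
    refine Wp.op_seq (by simp [Op.eval, h14, g13, hr.r3, hr.r8]; omega) ?_
    refine Wp.load_seq ?_
    refine Wp.op_seq (by simp [Op.eval, h14, g13, hr.r3, hr.r8, f1, f2]; omega) ?_
    refine Wp.op_seq (by simp [Op.eval, h14, g13, hr.r3, hr.r8, hr.r4, f1, f2]; omega) ?_
    refine Wp.op_seq (by simp [Op.eval, h14, hr.r8]; omega) ?_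
    refine Wp.store ⟨⟨?_, h2⟩, by simpa using h14, ?_⟩
    · intro j i hi hji
      simp only [Op.eval]
      simp [h14, g13, hr.r3, hr.r8, hr.r4, f1, f2]
      rw [Function.update_apply]
      split_ifs with heq
      · have hjx : j * m + i = x := by omega
        have hj : x / m = j := by
          rw [← hjx, mul_comm, Nat.mul_add_div hm0, Nat.div_eq_of_lt hi, add_zero]
        have hi' : x % m = i := by
          rw [← hjx, mul_comm, Nat.mul_add_mod, Nat.mod_eq_of_lt hi]
        rw [← f3, hj, hi']
      · exact h1 j i hi (by omega)
    · intro y hy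
      simpa [Function.update_apply, show y ≠ 16 by omega, show y ≠ 17 by omega] using hs y hy
  · intro j i hi hji
    rw [em]
    refine hmem j ?_ i hi
    by_contra! hj
    have := Nat.mul_le_mul_right m hj
    rw [Nat.succ_mul] at this
    omega
  · rintro s' ⟨h1, h2⟩ - hs
    refine ⟨fun j hj i hi => h1 j i hi (row_add_lt hj hi), h2, A.trans (hs.mono (by norm_num))⟩

/-- Multiply the number of codewords by `q`. -/
def addGenerator : Prog :=
  initWeights ;; chooseRow ;; extendTable ;; .op .mul 10 10 4 ;; .op .sub 11 0 10

theorem addGenerator_wp {l : ℕ} (h : Regs n d m q a u s) (h10 : s.reg 10 = q ^ l)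
    (hk : q ^ l < n) (hq : 2 ≤ q) (hm0 : 0 < m) (hW : n + q + n * m < W) (hnq : n * q < W)
    (hqW : 2 * q ≤ W)
    (hw : ∀ i ≤ m, ∑ j ∈ Finset.range (q ^ l), weights q a (q ^ l) (code q a l) i j < W)
    (hmem : ∀ j < q ^ l, ∀ i < m, s.mem (n + q + (j * m + i)) = code q a l j i) :
    Wp W addGenerator (40 * m * (q ^ l + q + min (q ^ (l + 1)) n)) s fun s' =>
      s'.reg 10 = q ^ (l + 1) ∧ s'.reg 11 = n - q ^ (l + 1) ∧
      (∀ j < min (q ^ (l + 1)) n, ∀ i < m,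
        s'.mem (n + q + (j * m + i)) = code q a (l + 1) j i) ∧
      s'.out = s.out ∧ Agree 10 s s' := by
  have hk0 : 0 < q ^ l := by positivity
  have hq0 : 0 < q := by omega
  have hmn : m ≤ n * m := Nat.le_mul_of_pos_left _ (by omega)
  have hkq : q ^ l * q < n * q := Nat.mul_lt_mul_of_pos_right hk (by omega)
  have hc : ∀ j i, code q a l j i < q := code_lt hq0 l
  refine Wp.le (T := (q ^ l * 4 + 3) + ((m * (15 * q + 26 * q ^ l + 20) + 3) +
    ((14 * (min (q ^ l * q) n * m) + 8) + 2))) ?_ ?_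
  · refine (initWeights_wp h h10 (by omega)).seq ?_
    rintro s₁ ⟨w1, m1, o1, A1⟩
    refine (chooseRow_wp (c := code q a l) (h.agree A1 (by norm_num))
      ((A1 10 (by norm_num)).trans h10) hk hq0 (by omega) hW (fun j _ i => hc j i) hw
      ⟨fun j hj => by rw [w1 j hj, weights], fun j hj x hx => by
        rw [m1 _ (by omega), hmem j hj x hx], by simp⟩).seq ?_
    rintro s₂ ⟨R2, o2, A2⟩
    have A2' := A1.trans A2
    refine (extendTable_wp (c := code q a (l + 1)) (h.agree A2' (by norm_num))
      ((A2' 10 (by norm_num)).trans h10) hk0 hk hq hm0 hW hnq hqW (code_lt hq0 _) ?_ ?_).seq ?_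
    · intro j i hj
      rw [code_succ_pow hq0, code_succ_of_le hq0 hj]
    · intro j hj i hi
      rcases hj.lt_or_eq with hj | rfl
      · rw [R2.word j hj i hi, code_succ_of_lt hq0 hj]
      · rw [R2.row i hi, code_succ_pow hq0]
    rintro s₃ ⟨m3, o3, A3⟩
    have A3' := A2'.mono (R' := 12) (by norm_num) |>.trans A3
    have e3 : s₃.reg 10 = q ^ l := (A3' 10 (by norm_num)).trans h10
    have R3 := h.agree A3' (by norm_num)
    refine Wp.op_seq (T := 1) (by simp [Op.eval, e3, R3.r4]; omega) ?_
    refine Wp.op (by simp [Op.eval, e3, R3.r4, R3.r0]; omega) ⟨?_, ?_, ?_, ?_, ?_⟩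
    · simp [Op.eval, e3, R3.r4, pow_succ]
    · simp [Op.eval, e3, R3.r4, R3.r0, pow_succ]
    · simpa [pow_succ] using m3
    · simp [o3, o2, o1]
    · exact ((A3'.mono (by norm_num)).set le_rfl).set (by norm_num)
  · rw [pow_succ]
    set k := q ^ l
    have hE : 2 ≤ min (k * q) n := by
      have : 2 ≤ k * q := by nlinarith
      omega
    generalize min (k * q) n = E at *
    obtain ⟨m, rfl⟩ : ∃ m', m = m' + 1 := ⟨m - 1, by omega⟩
    nlinarith [Nat.zero_le (m * k), Nat.zero_le (m * q), Nat.mul_le_mul_left m hE,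
      Nat.mul_le_mul_left m hq, Nat.mul_le_mul_left m hk0]

/-- The number of words at least doubles from level to level, so the costs are dominated by a
geometric series. -/
theorem sum_level_cost_le {L : ℕ} (hq : 2 ≤ q) :
    ∑ k ∈ Finset.range L, (q ^ k + q + min (q ^ (k + 1)) n) ≤ 6 * q ^ L := by
  induction L with
  | zero => simp
  | succ L ih =>
    rw [Finset.sum_range_succ]
    rcases Nat.eq_zero_or_pos L with rfl | hL
    · have := min_le_left (q ^ (0 + 1)) n
      simp at this ⊢
      omega
    · have h1 : q ≤ q ^ L := Nat.le_self_pow (by omega) q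
      have h2 : 2 * q ^ L ≤ q ^ (L + 1) := by rw [pow_succ, mul_comm]; gcongr
      have := min_le_left (q ^ (L + 1)) n
      omega

/-- Compute the table of `n` codewords. -/
def buildTable : Prog := .const 10 1 ;; .op .sub 11 0 10 ;; .loop 11 addGenerator

theorem buildTable_wp (h : Regs n d m q a u s) (hn : 2 ≤ n) (hq : 2 ≤ q) (hqn : q ≤ n)
    (hm0 : 0 < m) (hW : n + q + n * m < W) (hnq : n * q < W)
    (hw : ∀ l, q ^ l < n → ∀ i ≤ m,
      ∑ j ∈ Finset.range (q ^ l), weights q a (q ^ l) (code q a l) i j < W)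
    (hmem : ∀ x, s.mem x = 0) :
    Wp W buildTable (400 * n * m) s fun s' =>
      (∀ j < n, ∀ i < m, s'.mem (n + q + (j * m + i)) = code q a (Nat.clog q n) j i) ∧
      s'.out = s.out ∧ Agree 10 s s' := by
  have hpow : ∀ l, l < Nat.clog q n ↔ q ^ l < n := fun l => Nat.lt_clog_iff_pow_lt (by omega)
  refine Wp.le (T := (∑ k ∈ Finset.range (Nat.clog q n),
    (40 * m * (q ^ k + q + min (q ^ (k + 1)) n) + 1) + 1) + 1 + 1) ?_ ?_
  · refine Wp.const_seq (by omega) (Wp.op_seq (by simp [Op.eval, h.r0]; omega) ?_)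
    refine Wp.loop (fun l s' => s'.reg 10 = q ^ l ∧ s'.reg 11 = n - q ^ l ∧
      (∀ j < min (q ^ l) n, ∀ i < m, s'.mem (n + q + (j * m + i)) = code q a l j i) ∧
      s'.out = s.out ∧ Agree 10 s s') (Nat.clog q n) _ ?_ ?_ ?_
    · rintro l hl s' ⟨h1, h2, h3, h4, h5⟩
      have hl' := (hpow l).1 hl
      refine ⟨by omega, ?_⟩
      refine (addGenerator_wp (h.agree h5 le_rfl) h1 hl' hq hm0 hW hnq (by nlinarith) (hw l hl')
        (by rwa [min_eq_left hl'.le] at h3)).mono le_rfl ?_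
      rintro s'' ⟨g1, g2, g3, g4, g5⟩
      exact ⟨g1, g2, g3, g4.trans h4, h5.trans g5⟩
    · rintro s' ⟨h1, h2, h3, h4, h5⟩
      have hle := Nat.le_pow_clog (b := q) (by omega) n
      rw [min_eq_right hle] at h3
      exact ⟨by omega, h3, h4, h5⟩
    · refine ⟨by simp, by simp [Op.eval, h.r0], ?_, rfl,
        (Agree.rfl.set le_rfl).set (by norm_num)⟩
      intro j _ i _
      simp [code, hmem]
  · have hc0 : 0 < Nat.clog q n := (hpow 0).2 (by simpa using by omega)
    obtain ⟨L, hL⟩ : ∃ L, Nat.clog q n = L + 1 := ⟨Nat.clog q n - 1, by omega⟩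
    have hLn : q ^ L < n := (hpow L).1 (by omega)
    -- The levels before the last cost at most `6 * q ^ L`, hence less than 6n. The last one costs
    -- at most 3n only because the table is cut off at n words; `q ^ (L + 1)` itself may be far
    -- larger than n.
    have hsum : ∑ k ∈ Finset.range (L + 1), (q ^ k + q + min (q ^ (k + 1)) n) ≤ 9 * n := by
      rw [Finset.sum_range_succ]
      have := sum_level_cost_le (n := n) (L := L) hq
      have := min_le_right (q ^ (L + 1)) n
      omega
    have hlen : L + 1 ≤ n := by
      have := Nat.lt_two_pow_self (n := L)
      have := Nat.pow_le_pow_left hq L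
      omega
    rw [hL, Finset.sum_add_distrib, ← Finset.mul_sum]
    simp only [Finset.sum_const, Finset.card_range, smul_eq_mul, mul_one]
    have h1 := Nat.mul_le_mul_left (40 * m) hsum
    have h2 : n ≤ n * m := Nat.le_mul_of_pos_right _ hm0
    have h3 : 40 * m * (9 * n) = 360 * (n * m) := by ring
    have h4 : 400 * n * m = 400 * (n * m) := by ring
    omega

end

/-! ## The output -/

/-- The number of the private tests of the item `j`, where the tests from `m q` on are distributed
among the first `d` items. -/
def privateCount (d m q u j : ℕ) : ℕ := if j < d then (u - (m * q + j) + d - 1) / d else 0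

/-- The tests of the item `j`: one for each entry of the codeword, and the private ones. -/
def testList (c : ℕ → ℕ → ℕ) (d m q u j : ℕ) : List ℕ :=
  (List.range m).map (fun i => c j i + i * q) ++
    (List.range (privateCount d m q u j)).map fun k => k * d + (m * q + j)

theorem length_testList (c : ℕ → ℕ → ℕ) (d m q u j : ℕ) :
    (testList c d m q u j).length = m + privateCount d m q u j := by
  simp [testList]

section

variable {W n d m q a u k : ℕ} {s s' : State}

theorem private_lt {j : ℕ} (hd : 0 < d) (hk : k < privateCount d m q u j) :
    j < d ∧ k * d + (m * q + j) < u := by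
  unfold privateCount at hk
  split_ifs at hk with hj
  · refine ⟨hj, ?_⟩
    have := (Nat.le_div_iff_mul_le hd).1 (Nat.succ_le_of_lt hk)
    rw [Nat.succ_mul] at this
    omega
  · omega

/-- The tests from m q on are dealt out cyclically: the remainder modulo d of the offset is the
owner, the quotient is the position in the list of the owner. So none of these tests is left over.
-/
theorem lt_privateCount {x : ℕ} (hd : 0 < d) (hx : m * q ≤ x) (hxu : x < u) :
    (x - m * q) / d < privateCount d m q u ((x - m * q) % d) := by
  have hr := Nat.mod_lt (x - m * q) hd
  have hdm := Nat.div_add_mod (x - m * q) d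
  rw [privateCount, if_pos hr, Nat.lt_iff_add_one_le, Nat.le_div_iff_mul_le hd, Nat.add_mul,
    mul_comm _ d]
  omega

theorem privateCount_le (hd : 0 < d) (j : ℕ) :
    privateCount d m q u j ≤ (u - m * q) / d + 1 := by
  unfold privateCount
  split_ifs with hj
  · rw [← Nat.add_div_right _ hd]
    exact Nat.div_le_div_right (by omega)
  · exact Nat.zero_le _

/-- Compute the number of private tests of the item `reg 10`, and write the number of its tests. -/
def printCount : Prog :=
  .op .mul 12 3 4 ;; .op .add 12 12 10 ;; .op .sub 13 1 10 ;;
    .branch 13 (.op .sub 13 6 12 ;; .op .add 13 13 1 ;; .op .sub 13 13 7 ;; .op .div 13 13 1)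
      (.const 13 0) ;;
    .op .add 14 3 13 ;; .write 14

theorem printCount_wp {j : ℕ} (h : Regs n d m q a u s) (h10 : s.reg 10 = j) (hj : j < n)
    (hW : n + m * q < W) (huW : u + d + m < W) (hd : 0 < d) :
    Wp W printCount 10 s fun s' => s'.reg 12 = m * q + j ∧
      s'.reg 13 = privateCount d m q u j ∧ s'.mem = s.mem ∧
      s'.out = s.out ++ [m + privateCount d m q u j] ∧ Agree 12 s s' := by
  have hcu : privateCount d m q u j ≤ u + d := by
    refine (privateCount_le hd j).trans ?_
    have := Nat.div_le_self (u - m * q) d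
    omega
  refine Wp.op_seq (T := 9) (by simp [Op.eval, h.r3, h.r4]; omega) ?_
  refine Wp.op_seq (by simp [Op.eval, h.r3, h.r4, h10]; omega) ?_
  refine Wp.op_seq (by simp [Op.eval, h.r1, h10]; omega) ?_
  refine Wp.le (T := 5 + 2) (Wp.seq (Q' := fun s' => s'.reg 12 = m * q + j ∧
      s'.reg 13 = privateCount d m q u j ∧ s'.mem = s.mem ∧ s'.out = s.out ∧ Agree 12 s s') ?_ ?_)
      le_rfl
  · refine Wp.branch (T := 4) ?_ ?_
    · intro hne
      simp [Op.eval, h.r1, h10] at hne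
      have hc : privateCount d m q u j = (u - (m * q + j) + d - 1) / d := if_pos (by omega)
      refine Wp.op_seq (T := 3) (by simp [Op.eval, h.r3, h.r4, h.r6, h10]; omega) ?_
      refine Wp.op_seq (by simp [Op.eval, h.r3, h.r4, h.r6, h10, h.r1]; omega) ?_
      refine Wp.op_seq (by simp [Op.eval, h.r3, h.r4, h.r6, h10, h.r1, h.r7]; omega) ?_
      refine Wp.op ?_ ⟨?_, ?_, rfl, rfl, ?_⟩
      · simp [Op.eval, h.r3, h.r4, h.r6, h10, h.r1, h.r7, ← hc]; omega
      · simp [Op.eval, h.r3, h.r4, h10]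
      · simp [Op.eval, h.r3, h.r4, h.r6, h10, h.r1, h.r7, ← hc]
      · intro x hx
        simp [show x ≠ 12 by omega, show x ≠ 13 by omega]
    · intro heq
      simp [Op.eval, h.r1, h10] at heq
      refine Wp.le (T := 1) (Wp.const (by omega) ⟨?_, ?_, rfl, rfl, ?_⟩) (by norm_num)
      · simp [Op.eval, h.r3, h.r4, h10]
      · simp [privateCount, show ¬ j < d by omega]
      · intro x hx
        simp [show x ≠ 12 by omega, show x ≠ 13 by omega]
  · rintro s₁ ⟨h1, h2, h3, h4, h5⟩
    have hR := h.agree h5 (by norm_num)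
    refine Wp.op_seq (T := 1) (by simp [Op.eval, hR.r3, h2]; omega) ?_
    refine Wp.write ⟨by simpa using h1, by simpa using h2, h3, ?_, h5.set (by norm_num)⟩
    simp [Op.eval, hR.r3, h2, h4]

/-- Write the tests of the item `reg 10` that belong to its codeword. -/
def printWord : Prog :=
  .const 14 0 ;; forLoop 14 15 3 7
    (.op .mul 16 10 3 ;; .op .add 16 16 8 ;; .op .add 16 16 14 ;; .load 16 16 ;;
      .op .mul 17 14 4 ;; .op .add 16 16 17 ;; .write 16)

theorem printWord_wp {c : ℕ → ℕ → ℕ} {j : ℕ} (h : Regs n d m q a u s) (h10 : s.reg 10 = j)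
    (hj : j < n) (hW : n + q + n * m < W) (hmq : m * q + m < W) (hc : ∀ j i, c j i < q)
    (hmem : ∀ j < n, ∀ i < m, s.mem (n + q + (j * m + i)) = c j i) :
    Wp W printWord (10 * m + 3) s fun s' => s'.mem = s.mem ∧
      s'.out = s.out ++ (List.range m).map (fun i => c j i + i * q) ∧ Agree 14 s s' := by
  refine Wp.const_seq (T := 10 * m + 2) (by omega) ?_
  refine Wp.for 14 (fun i s' => s'.mem = s.mem ∧
    s'.out = s.out ++ (List.range i).map (fun i => c j i + i * q)) 0 m 7 le_rfl (by norm_num)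
    (by norm_num) (by norm_num) (by norm_num) (Nat.zero_le _) (by omega) (by simp)
    (by simpa using h.r3) (by simpa using h.r7)
    (fun _ _ _ h _ => h) ?_ ⟨rfl, by simp⟩ ?_ (by omega)
  · rintro i s' - hi ⟨h1, h2⟩ h14 hs
    have hs' := (Agree.rfl.set (x := 14) (a := 0) le_rfl).trans hs
    have hr := h.agree hs' (by norm_num)
    have g10 : s'.reg 10 = j := (hs' 10 (by norm_num)).trans h10
    have hlt := row_add_lt hj hi
    have hcj := hc j i
    have hiq := row_add_lt hi hcj
    have e1 : s'.mem (j * m + (n + q) + i) = c j i := by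
      rw [h1, ← hmem j hj i hi]
      congr 1
      omega
    refine Wp.op_seq (T := 6) (by simp [Op.eval, hr.r3, g10]; omega) ?_
    refine Wp.op_seq (by simp [Op.eval, hr.r3, g10, hr.r8]; omega) ?_
    refine Wp.op_seq (by simp [Op.eval, hr.r3, g10, hr.r8, h14]; omega) ?_
    refine Wp.load_seq ?_
    refine Wp.op_seq (by simp [Op.eval, h14, hr.r4]; omega) ?_
    refine Wp.op_seq (by simp [Op.eval, hr.r3, g10, hr.r8, h14, e1, hr.r4]; omega) ?_
    refine Wp.write ⟨⟨h1, ?_⟩, by simpa using h14, ?_⟩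
    · simp [Op.eval, hr.r3, g10, hr.r8, h14, e1, hr.r4, h2, List.range_succ]
    · intro x hx
      simpa [Function.update_apply, show x ≠ 16 by omega, show x ≠ 17 by omega] using hs x hx
  · rintro s' ⟨h1, h2⟩ - hs
    exact ⟨h1, h2, (Agree.rfl.set le_rfl).trans hs⟩

/-- Write the private tests of the item `reg 10`. -/
def printPrivate : Prog :=
  .const 14 0 ;; forLoop 14 15 13 7 (.op .mul 16 14 1 ;; .op .add 16 16 12 ;; .write 16)

theorem printPrivate_wp {j : ℕ} (h : Regs n d m q a u s) (h12 : s.reg 12 = m * q + j)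
    (h13 : s.reg 13 = privateCount d m q u j) (huW : u + d < W) (hd : 0 < d) :
    Wp W printPrivate (6 * privateCount d m q u j + 3) s fun s' => s'.mem = s.mem ∧
      s'.out = s.out ++
        (List.range (privateCount d m q u j)).map (fun k => k * d + (m * q + j)) ∧
      Agree 14 s s' := by
  have hcu : privateCount d m q u j ≤ u + d := by
    refine (privateCount_le hd j).trans ?_
    have := Nat.div_le_self (u - m * q) d
    omega
  refine Wp.const_seq (T := 6 * privateCount d m q u j + 2) (by omega) ?_
  refine Wp.for 14 (fun i s' => s'.mem = s.mem ∧
    s'.out = s.out ++ (List.range i).map (fun k => k * d + (m * q + j))) 0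
      (privateCount d m q u j) 3 le_rfl (by norm_num)
    (by norm_num) (by norm_num) (by norm_num) (Nat.zero_le _) (by omega) (by simp)
    (by simpa using h13) (by simpa using h.r7)
    (fun _ _ _ h _ => h) ?_ ⟨rfl, by simp⟩ ?_ (by omega)
  · rintro i s' - hi ⟨h1, h2⟩ h14 hs
    have hs' := (Agree.rfl.set (x := 14) (a := 0) le_rfl).trans hs
    have hr := h.agree hs' (by norm_num)
    have g12 : s'.reg 12 = m * q + j := (hs' 12 (by norm_num)).trans h12
    have hlt := (private_lt hd hi).2
    refine Wp.op_seq (T := 2) (by simp [Op.eval, hr.r1, h14]; omega) ?_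
    refine Wp.op_seq (by simp [Op.eval, hr.r1, h14, g12]; omega) ?_
    refine Wp.write ⟨⟨h1, ?_⟩, by simpa using h14, ?_⟩
    · simp [Op.eval, hr.r1, h14, g12, h2, List.range_succ]
    · intro x hx
      simpa [Function.update_apply, show x ≠ 16 by omega] using hs x hx
  · rintro s' ⟨h1, h2⟩ - hs
    exact ⟨h1, h2, (Agree.rfl.set le_rfl).trans hs⟩

/-- Write the listing of the family. -/
def printAll : Prog :=
  .const 10 0 ;; forLoop 10 11 0 7 (printCount ;; printWord ;; printPrivate)

theorem printAll_wp {c : ℕ → ℕ → ℕ} (h : Regs n d m q a u s) (hW : n + q + n * m < W)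
    (hmq : n + m * q + m < W) (huW : u + d + m < W) (hd : 0 < d) (hc : ∀ j i, c j i < q)
    (hmem : ∀ j < n, ∀ i < m, s.mem (n + q + (j * m + i)) = c j i) :
    Wp W printAll (n * (10 * m + 6 * ((u - m * q) / d) + 25) + 3) s fun s' =>
      s'.out = s.out ++ (List.range n).flatMap fun j =>
        (testList c d m q u j).length :: testList c d m q u j := by
  refine Wp.const_seq (T := n * (10 * m + 6 * ((u - m * q) / d) + 25) + 2) (by omega) ?_
  refine Wp.for 10 (fun j s' => s'.mem = s.mem ∧ s'.out = s.out ++ (List.range j).flatMap fun j =>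
      (testList c d m q u j).length :: testList c d m q u j) 0 n
    (10 * m + 6 * ((u - m * q) / d) + 22) le_rfl (by norm_num)
    (by norm_num) (by norm_num) (by norm_num) (Nat.zero_le _) (by omega) (by simp)
    (by simpa using h.r0) (by simpa using h.r7)
    (fun _ _ _ h _ => h) ?_ ⟨rfl, by simp⟩ ?_ (le_of_eq (by rw [Nat.sub_zero]))
  · rintro j s' - hj ⟨h1, h2⟩ h10 hs
    have hs' := (Agree.rfl.set (x := 10) (a := 0) le_rfl).trans hs
    have hr := h.agree hs' le_rfl
    have hcnt := privateCount_le (m := m) (q := q) (u := u) hd j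
    refine Wp.le (T := 10 + ((10 * m + 3) + (6 * privateCount d m q u j + 3))) ?_ (by omega)
    refine (printCount_wp hr h10 hj (by omega) huW hd).seq ?_
    rintro s₁ ⟨r12, r13, m1, o1, A1⟩
    refine (printWord_wp (c := c) (hr.agree A1 (by norm_num))
      ((A1 10 (by norm_num)).trans h10) hj hW (by omega) hc
      (fun j hj i hi => by rw [m1, h1, hmem j hj i hi])).seq ?_
    rintro s₂ ⟨m2, o2, A2⟩
    have A2' := A1.trans (A2.mono (by norm_num))
    refine (printPrivate_wp (hr.agree A2' (by norm_num)) ((A2 12 (by norm_num)).trans r12)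
      ((A2 13 (by norm_num)).trans r13) (by omega) hd).mono le_rfl ?_
    rintro s₃ ⟨m3, o3, A3⟩
    have A3' := A2'.trans (A3.mono (by norm_num))
    refine ⟨⟨by rw [m3, m2, m1, h1], ?_⟩, (A3' 10 (by norm_num)).trans h10,
      hs.trans (A3'.mono (by norm_num))⟩
    rw [o3, o2, o1, h2, List.range_succ, List.flatMap_append]
    simp [testList]
  · rintro s' ⟨-, h2⟩ - -
    exact h2

end

/-! ## The programs that compute the parameters -/

/-- The input is in place, the register `7` contains `1`, and the register `9`, the memory and the
output are still empty. -/
structure Ready (n d t : ℕ) (s : State) : Prop where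
  r0 : s.reg 0 = n
  r1 : s.reg 1 = d
  r2 : s.reg 2 = t
  r7 : s.reg 7 = 1
  r9 : s.reg 9 = 0
  mem : ∀ x, s.mem x = 0
  out : s.out = []

section

variable {W n d t m q a u k : ℕ} {s s' : State}

theorem Ready.of_eq (h : Ready n d t s)
    (hs : ∀ x, x < 3 ∨ x = 7 ∨ x = 9 → s'.reg x = s.reg x) (hm : s'.mem = s.mem)
    (ho : s'.out = s.out) : Ready n d t s' where
  r0 := (hs 0 (by omega)).trans h.r0
  r1 := (hs 1 (by omega)).trans h.r1
  r2 := (hs 2 (by omega)).trans h.r2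
  r7 := (hs 7 (by omega)).trans h.r7
  r9 := (hs 9 (by omega)).trans h.r9
  mem := by rw [hm]; exact h.mem
  out := ho.trans h.out

/-- Put the logarithm `k` of register `x` to the base register `b` into register `20`, and `2 ^ k`
into register `22`. -/
def logProg (b x : ℕ) : Prog :=
  .const 20 0 ;; .const 21 1 ;; .const 22 1 ;; .op .mul 24 21 b ;; .op .add 23 x 7 ;;
    .op .sub 23 23 24 ;;
    .loop 23 (.op .add 20 20 7 ;; .op .mul 21 21 b ;; .op .add 22 22 22 ;; .op .mul 24 21 b ;;
      .op .add 23 x 7 ;; .op .sub 23 23 24)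

/-- The loop is controlled by the truncated difference X + 1 - B^(k+1), which is nonzero exactly as
long as B^(k+1) ≤ X. The program computes one power ahead, and that power is at most X B; hence the
condition on the word size. -/
theorem logProg_wp {b x B X : ℕ} (hb : b < 20) (hx : x < 20) (h7 : s.reg 7 = 1)
    (hsb : s.reg b = B) (hsx : s.reg x = X) (hB : 2 ≤ B) (hX : X ≠ 0) (hW : X * B + 1 < W) :
    Wp W (logProg b x) (7 * Nat.log B X + 7) s fun s' => s'.reg 20 = Nat.log B X ∧
      s'.reg 22 = 2 ^ Nat.log B X ∧ s'.mem = s.mem ∧ s'.out = s.out ∧ Agree 20 s s' := by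
  have hXB : X * 2 ≤ X * B := Nat.mul_le_mul_left _ hB
  have hb' : ∀ y, 20 ≤ y → b ≠ y := fun y hy => by omega
  have hx' : ∀ y, 20 ≤ y → x ≠ y := fun y hy => by omega
  have hpow : ∀ k, B ^ (k + 1) ≤ X ↔ k < Nat.log B X := fun k =>
    (Nat.le_log_iff_pow_le (by omega) hX).symm
  have hBX : B ≤ X * B := Nat.le_mul_of_pos_left _ (by omega)
  refine Wp.const_seq (T := 7 * Nat.log B X + 6) (by omega) ?_
  refine Wp.const_seq (by omega) (Wp.const_seq (by omega) ?_)
  refine Wp.op_seq (by simp [Op.eval, hb' _, hsb]; omega) ?_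
  refine Wp.op_seq (by simp [Op.eval, hx' _, hsx, h7]; omega) ?_
  refine Wp.op_seq (by simp [Op.eval, hx' _, hsx, h7]; omega) ?_
  refine Wp.le (Wp.loop (fun k s' => s'.reg 20 = k ∧ s'.reg 21 = B ^ k ∧ s'.reg 22 = 2 ^ k ∧
    s'.reg 23 = X + 1 - B ^ (k + 1) ∧ s'.mem = s.mem ∧ s'.out = s.out ∧ Agree 20 s s')
    (Nat.log B X) (fun _ => 6) ?_ ?_ ?_) (by simp; omega)
  · rintro k hk s' ⟨h20, h21, h22, h23, hm, ho, hs⟩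
    have hk' := (hpow k).2 hk
    refine ⟨by omega, ?_⟩
    have e7 : s'.reg 7 = 1 := (hs 7 (by norm_num)).trans h7
    have eb : s'.reg b = B := (hs b hb).trans hsb
    have ex : s'.reg x = X := (hs x hx).trans hsx
    have h2 : 2 ^ (k + 1) ≤ B ^ (k + 1) := Nat.pow_le_pow_left hB _
    have hB2 : B ^ (k + 1) * B ≤ X * B := Nat.mul_le_mul_right _ hk'
    have hkk : k + 1 < 2 ^ (k + 1) := Nat.lt_two_pow_self
    rw [pow_succ] at hB2 h2 hk'
    rw [pow_succ] at h2 hkk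
    refine Wp.op_seq (T := 5) (by simp [Op.eval, h20, e7]; omega) ?_
    refine Wp.op_seq (by simp [Op.eval, h21, hb' _, eb]; omega) ?_
    refine Wp.op_seq (by simp [Op.eval, h22]; omega) ?_
    refine Wp.op_seq (by simp [Op.eval, h21, hb' _, eb]; omega) ?_
    refine Wp.op_seq (by simp [Op.eval, hx' _, ex, e7]; omega) ?_
    refine Wp.op (by simp [Op.eval, hx' _, ex, e7]; omega) ⟨?_, ?_, ?_, ?_, hm, ho, ?_⟩
    · simp [Op.eval, h20, e7]
    · simp [Op.eval, h21, hb' _, eb, pow_succ]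
    · simp [Op.eval, h22, pow_succ]; omega
    · simp [Op.eval, h21, hb' _, hx' _, eb, ex, e7, pow_succ]
    · intro y hy
      rw [← hs y hy]
      simp [Function.update_apply, show y ≠ 20 by omega, show y ≠ 21 by omega,
        show y ≠ 22 by omega, show y ≠ 23 by omega, show y ≠ 24 by omega]
  · rintro s' ⟨h20, h21, h22, h23, hm, ho, hs⟩
    refine ⟨?_, h20, h22, hm, ho, hs⟩
    have := mt (hpow (Nat.log B X)).1 (lt_irrefl _)
    omega
  · refine ⟨by simp [Function.update_apply], by simp [Function.update_apply],
      by simp [Function.update_apply], ?_, rfl, rfl, ?_⟩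
    · simp [Op.eval, hb' _, hx' _, hsb, hsx, h7]
    · intro y hy
      simp [Function.update_apply, show y ≠ 20 by omega, show y ≠ 21 by omega,
        show y ≠ 22 by omega, show y ≠ 23 by omega, show y ≠ 24 by omega]

/-! ### The next prime by trial division -/

theorem exists_first_prime {p₀ : ℕ} (h : p₀ ≠ 0) :
    ∃ N, 0 < N ∧ N ≤ p₀ ∧ (p₀ + N).Prime ∧ ∀ k, 0 < k → k < N → ¬ (p₀ + k).Prime := by
  classical
  have hex : ∃ N, 0 < N ∧ (p₀ + N).Prime := by
    obtain ⟨p, hp, h1, h2⟩ := Nat.exists_prime_lt_and_le_two_mul p₀ h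
    exact ⟨p - p₀, by omega, by rwa [Nat.add_sub_cancel' h1.le]⟩
  refine ⟨Nat.find hex, (Nat.find_spec hex).1, ?_, (Nat.find_spec hex).2,
    fun k h0 hk hp => Nat.find_min hex hk ⟨h0, hp⟩⟩
  obtain ⟨p, hp, h1, h2⟩ := Nat.exists_prime_lt_and_le_two_mul p₀ h
  have := Nat.find_le (h := hex) (n := p - p₀) ⟨by omega, by rwa [Nat.add_sub_cancel' h1.le]⟩
  omega

theorem card_divisors_eq_zero_iff {p : ℕ} (hp : 2 ≤ p) :
    ((Finset.Ico 2 p).filter (· ∣ p)).card = 0 ↔ p.Prime := by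
  rw [Finset.card_eq_zero, Finset.filter_eq_empty_iff, Nat.prime_def_lt']
  simp only [Finset.mem_Ico, and_imp, hp, true_and]

/-- Count the proper divisors of the register `4`, from `2` on. -/
def countDivisors : Prog :=
  .const 20 0 ;; .const 21 2 ;;
    forLoop 21 22 4 7 (.op .mod 23 4 21 ;; .op .sub 23 7 23 ;; .op .add 20 20 23)

theorem countDivisors_wp {p : ℕ} (h7 : s.reg 7 = 1) (h4 : s.reg 4 = p) (hp : 2 ≤ p)
    (hW : p + 1 < W) :
    Wp W countDivisors (6 * p) s fun s' =>
      s'.reg 20 = ((Finset.Ico 2 p).filter (· ∣ p)).card ∧ s'.mem = s.mem ∧ s'.out = s.out ∧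
        Agree 20 s s' := by
  refine Wp.le (T := ((p - 2) * 6 + 2) + 1 + 1) ?_ (by omega)
  refine Wp.const_seq (by omega) (Wp.const_seq (by omega) ?_)
  refine Wp.for 20 (fun i s' => s'.reg 20 = ((Finset.Ico 2 i).filter (· ∣ p)).card ∧
    s'.mem = s.mem ∧ s'.out = s.out) 2 p 3 (by norm_num) (by norm_num)
    (by norm_num) (by norm_num) (by norm_num) hp (by omega) (by simp)
    (by simpa using h4) (by simpa using h7)
    ?_ ?_ ⟨by simp, rfl, rfl⟩ ?_ le_rfl
  · rintro i s' r ⟨h1, h2, h3⟩ hr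
    exact ⟨(hr 20 (by norm_num) (by norm_num)).trans h1, h2, h3⟩
  · rintro i s' hi2 hi ⟨h1, h2, h3⟩ h21 hs
    have g4 : s'.reg 4 = p := (hs 4 (by norm_num)).trans (by simpa using h4)
    have g7 : s'.reg 7 = 1 := (hs 7 (by norm_num)).trans (by simpa using h7)
    have hmod : p % i < i := Nat.mod_lt _ (by omega)
    have hle : ((Finset.Ico 2 i).filter (· ∣ p)).card ≤ i := by
      refine (Finset.card_filter_le _ _).trans ?_
      simp
    -- The truncated difference `1 - p % i` is the indicator of divisibility.
    have hcard : ((Finset.Ico 2 (i + 1)).filter (· ∣ p)).card =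
        ((Finset.Ico 2 i).filter (· ∣ p)).card + (1 - p % i) := by
      rw [← Finset.insert_Ico_right_eq_Ico_add_one hi2, Finset.filter_insert]
      split_ifs with hd
      · rw [Finset.card_insert_of_notMem (by simp), Nat.mod_eq_zero_of_dvd hd]
      · have : p % i ≠ 0 := fun h => hd (Nat.dvd_of_mod_eq_zero h)
        omega
    refine Wp.op_seq (T := 2) (by simp [Op.eval, g4, h21]; omega) ?_
    refine Wp.op_seq (by simp [Op.eval, g4, h21, g7]; omega) ?_
    refine Wp.op (by simp [Op.eval, g4, h21, g7, h1]; omega) ⟨⟨?_, h2, h3⟩, ?_, ?_⟩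
    · simp [Op.eval, g4, h21, g7, h1, hcard]
    · simpa using h21
    · intro y hy
      rw [← hs y hy]
      simp [show y ≠ 20 by omega, show y ≠ 23 by omega]
  · rintro s' ⟨h1, h2, h3⟩ - hs
    exact ⟨h1, h2, h3, ((Agree.rfl.set le_rfl).set (by norm_num)).trans hs⟩

/-- Replace the contents of the register `4` by the next prime. -/
def findPrime : Prog := .const 20 1 ;; .loop 20 (.op .add 4 4 7 ;; countDivisors)

theorem findPrime_wp {p₀ : ℕ} (h : Ready n d t s) (h4 : s.reg 4 = p₀) (hp : p₀ ≠ 0)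
    (hW : 2 * p₀ + 1 < W) :
    Wp W findPrime (16 * p₀ * p₀) s fun s' => (s'.reg 4).Prime ∧ p₀ < s'.reg 4 ∧
      s'.reg 4 ≤ 2 * p₀ ∧ s'.reg 3 = s.reg 3 ∧ s'.reg 5 = s.reg 5 ∧ Ready n d t s' := by
  obtain ⟨N, hN0, hN, hprime, hmin⟩ := exists_first_prime hp
  -- By Bertrand's postulate there are at most p₀ candidates. Each is at most 2p₀, so that its trial
  -- division takes at most 12p₀ steps.
  refine Wp.le (T := (∑ k ∈ Finset.range N, (12 * p₀ + 1 + 1) + 1) + 1) ?_ ?_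
  -- The initial 1 in register `20` forces a first round, so p₀ itself is skipped even if it is
  -- prime.
  · refine Wp.const_seq (by omega) ?_
    refine Wp.loop (fun k s' => s'.reg 4 = p₀ + k ∧ (s'.reg 20 = 0 ↔ k = N) ∧
      s'.mem = s.mem ∧ s'.out = s.out ∧ ∀ x, x < 20 → x ≠ 4 → s'.reg x = s.reg x)
      N (fun _ => 12 * p₀ + 1) ?_ ?_ ?_
    · rintro k hk s' ⟨h1, h2, h3, h4', h5⟩
      refine ⟨fun h => hk.ne (h2.1 h), ?_⟩
      have e7 : s'.reg 7 = 1 := (h5 7 (by norm_num) (by norm_num)).trans h.r7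
      refine Wp.op_seq (by simp [Op.eval, h1, e7]; omega) ?_
      refine (countDivisors_wp (p := p₀ + k + 1) (by simpa using e7)
        (by simp [Op.eval, h1, e7]) (by omega) (by omega)).mono (by omega) ?_
      rintro s'' ⟨g1, g2, g3, g4⟩
      refine ⟨?_, ?_, g2.trans h3, g3.trans h4', ?_⟩
      · rw [g4 4 (by norm_num)]
        simp [Op.eval, h1, e7, add_assoc]
      · rw [g1, card_divisors_eq_zero_iff (by omega), add_assoc]
        refine ⟨fun hpr => ?_, fun h => h ▸ hprime⟩
        by_contra hne
        exact hmin (k + 1) (by omega) (by omega) hpr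
      · intro x hx hx4
        rw [g4 x hx]
        simpa [hx4] using h5 x hx hx4
    · rintro s' ⟨h1, h2, h3, h4', h5⟩
      rw [h1]
      exact ⟨h2.2 rfl, hprime, by omega, by omega, h5 3 (by norm_num) (by norm_num),
        h5 5 (by norm_num) (by norm_num),
        h.of_eq (fun x hx => h5 x (by omega) (by omega)) h3 h4'⟩
    · refine ⟨by simpa using h4, by simp; omega, rfl, rfl, fun x hx _ => ?_⟩
      simp [show x ≠ 20 by omega]
  · simp only [Finset.sum_const, Finset.card_range, smul_eq_mul]
    have h1 := Nat.mul_le_mul_right (12 * p₀ + 1 + 1) hN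
    nlinarith [Nat.pos_of_ne_zero hp]

/-- From `g`, `h` and `a` in the registers `17`, `18` and `5`, compute the length `m` and the size
`q` of the alphabet. -/
def paramProg : Prog :=
  .const 19 2 ;; .op .sub 18 18 19 ;; .op .add 17 17 7 ;; .op .div 17 17 18 ;;
    .op .add 17 17 7 ;; .op .add 18 1 7 ;; .op .mul 3 18 17 ;; .op .mul 4 18 5 ;;
    .op .mul 19 4 5 ;; .op .add 19 19 7 ;; .op .sub 19 19 0 ;;
    .branch 19 (.op .add 4 0 9) findPrime

/-- The prime is searched for only if (d+1)a² < n. The quadratic cost 16((d+1)a)² is then below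
16(d+1)n, no more than the order of the listing. -/
theorem paramProg_wp {g h z : ℕ} (hs : Ready n d t s) (h17 : s.reg 17 = g) (h18 : s.reg 18 = h)
    (h5 : s.reg 5 = a) (hz : (g + 1) / (h - 2) + 1 = z) (ha : 2 ≤ a)
    (hn : 0 < n) (hW : (d + 1) * z + 2 * ((d + 1) * a * a) + g + h + n + 5 < W) :
    Wp W paramProg (16 * ((d + 1) * n) + 13) s fun s' => s'.reg 3 = (d + 1) * z ∧
      (n ≤ (d + 1) * a * a ∧ s'.reg 4 = n ∨ (d + 1) * a * a < n ∧ (s'.reg 4).Prime ∧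
        (d + 1) * a < s'.reg 4 ∧ s'.reg 4 ≤ 2 * ((d + 1) * a)) ∧
      s'.reg 5 = a ∧ Ready n d t s' := by
  have hda : (d + 1) * a ≤ (d + 1) * a * a := Nat.le_mul_of_pos_right _ (by omega)
  have hd1 : (d + 1) * 2 ≤ (d + 1) * a := Nat.mul_le_mul_left _ ha
  have hz1 : z ≤ (d + 1) * z := Nat.le_mul_of_pos_left _ (by omega)
  have hdiv : (g + 1) / (h - 2) ≤ g + 1 := Nat.div_le_self _ _
  refine Wp.le (T := ((16 * ((d + 1) * n)) + 1) + 11) ?_ (by omega)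
  refine Wp.const_seq (by omega) ?_
  refine Wp.op_seq (by simp [Op.eval, h18]; omega) ?_
  refine Wp.op_seq (by simp [Op.eval, h17, hs.r7]; omega) ?_
  refine Wp.op_seq (by simp [Op.eval, h17, h18, hs.r7]; omega) ?_
  refine Wp.op_seq (by simp [Op.eval, h17, h18, hs.r7]; omega) ?_
  refine Wp.op_seq (by simp [Op.eval, hs.r1, hs.r7]; omega) ?_
  refine Wp.op_seq (by simp [Op.eval, h17, h18, hs.r1, hs.r7, hz]; omega) ?_
  refine Wp.op_seq (by simp [Op.eval, hs.r1, hs.r7, h5]; omega) ?_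
  refine Wp.op_seq (by simp [Op.eval, hs.r1, hs.r7, h5]; omega) ?_
  refine Wp.op_seq (by simp [Op.eval, hs.r1, hs.r7, h5]; omega) ?_
  refine Wp.op_seq (by simp [Op.eval, hs.r0, hs.r1, hs.r7, h5]; omega) ?_
  -- Register `19` holds the truncated difference (d+1)a² + 1 - n, which is nonzero exactly if n ≤
  -- (d+1)a².
  refine Wp.branch ?_ ?_
  · intro hne
    simp [Op.eval, hs.r0, hs.r1, hs.r7, h5] at hne
    have hpos : 0 < (d + 1) * n := Nat.mul_pos (by omega) hn
    refine Wp.le (T := 1) (Wp.op ?_ ⟨?_, ?_, ?_, ?_⟩) (by omega)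
    · simp [Op.eval, hs.r0, hs.r9]; omega
    · simp [Op.eval, h17, h18, hs.r1, hs.r7, hz]
    · left
      simp [Op.eval, hs.r0, hs.r9]
      omega
    · simpa using h5
    · refine hs.of_eq (fun x hx => ?_) rfl rfl
      simp [show x ≠ 3 by omega, show x ≠ 4 by omega, show x ≠ 17 by omega,
        show x ≠ 18 by omega, show x ≠ 19 by omega]
  · intro heq
    simp [Op.eval, hs.r0, hs.r1, hs.r7, h5] at heq
    refine (findPrime_wp (n := n) (d := d) (t := t) (p₀ := (d + 1) * a) ?_ ?_ ?_ (by omega)).mono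
      ?_ ?_
    · refine hs.of_eq (fun x hx => ?_) rfl rfl
      simp [show x ≠ 3 by omega, show x ≠ 4 by omega, show x ≠ 17 by omega,
        show x ≠ 18 by omega, show x ≠ 19 by omega]
    · simp [Op.eval, hs.r1, hs.r7, h5]
    · positivity
    · have : (d + 1) * ((d + 1) * a * a) ≤ (d + 1) * n := Nat.mul_le_mul_left _ (by omega)
      nlinarith
    · rintro s' ⟨g1, g2, g3, g4, g5, g6⟩
      refine ⟨?_, Or.inr ⟨by omega, g1, g2, g3⟩, ?_, g6⟩
      · rw [g4]
        simp [Op.eval, h17, h18, hs.r1, hs.r7, hz]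
      · rw [g5]
        simpa using h5

end

/-! ## The strategy given by a table of codewords -/

section Family

variable {n t d m q u : ℕ} {c : ℕ → ℕ → ℕ}

/-- The strategy in which the tests of the item `j` are those in `testList c d m q u j`. -/
def tableStrategy (n t : ℕ) (c : ℕ → ℕ → ℕ) (d m q u : ℕ) : Strategy n t := fun x =>
  Finset.univ.filter fun j : Fin n => (x : ℕ) ∈ testList c d m q u j

theorem mem_family_tableStrategy {j : Fin n} {x : Fin t} :
    x ∈ family (tableStrategy n t c d m q u) j ↔ (x : ℕ) ∈ testList c d m q u j := by
  simp [family, tableStrategy]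

theorem mem_response {T : Strategy n t} {D : Finset (Fin n)} {x : Fin t} :
    x ∈ response T D ↔ ∃ j ∈ D, x ∈ family T j := by
  simp [response, family, Finset.Nonempty, and_comm]

theorem response_eq_biUnion (T : Strategy n t) (D : Finset (Fin n)) :
    response T D = D.biUnion (family T) := by
  ext x
  simp [mem_response]

theorem response_card_le_maxYes (T : Strategy n t) {D : Finset (Fin n)} (hD : D.card ≤ d) :
    (response T D).card ≤ maxYes d T :=
  Finset.le_sup (f := fun D => (response T D).card) (by simpa using hD)

theorem maxYes_le_tests (T : Strategy n t) : maxYes d T ≤ t :=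
  Finset.sup_le fun D _ => (Finset.card_le_univ _).trans_eq (by simp)

/-- If no member of the family is covered by `d` others, then the strategy finds up to `d`
defectives. -/
theorem finds_of_not_covered {T : Strategy n t}
    (h : ∀ (D : Finset (Fin n)) (j : Fin n), D.card ≤ d → j ∉ D →
      ∃ x ∈ family T j, ∀ l ∈ D, x ∉ family T l) : Finds d T := by
  have key : ∀ D D' : Finset (Fin n), D'.card ≤ d → response T D = response T D' → D ⊆ D' := by
    intro D D' hD' he j hj
    by_contra hj'
    obtain ⟨x, hx, hx'⟩ := h D' j hD' hj'
    have : x ∈ response T D' := he ▸ mem_response.2 ⟨j, hj, hx⟩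
    obtain ⟨l, hl, hxl⟩ := mem_response.1 this
    exact hx' l hl hxl
  intro D hD D' hD' he
  exact (key D D' hD' he).antisymm (key D' D hD he.symm)

/-- A lower bound for the size of a union of sets with small pairwise intersections. -/
theorem card_biUnion_ge {ι α : Type*} [DecidableEq ι] [DecidableEq α] {F : ι → Finset α}
    (hF : ∀ j, (F j).card = m)
    (hsep : ∀ j l, j ≠ l → (d + 1) * (F j ∩ F l).card ≤ m) (D : Finset ι) :
    2 * (d + 1) * D.card * m ≤
      2 * (d + 1) * (D.biUnion F).card + D.card * (D.card - 1) * m := by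
  induction D using Finset.induction_on with
  | empty => simp
  | insert j D hj ih =>
    rw [Finset.card_insert_of_notMem hj, Finset.biUnion_insert, Nat.add_sub_cancel]
    have h1 := Finset.card_union_add_card_inter (F j) (D.biUnion F)
    -- The set that is added loses at most m/(d+1) elements to each of the earlier ones.
    have h2 : (d + 1) * (F j ∩ D.biUnion F).card ≤ D.card * m := by
      rw [Finset.inter_biUnion]
      calc (d + 1) * (D.biUnion fun l => F j ∩ F l).card
          ≤ (d + 1) * ∑ l ∈ D, (F j ∩ F l).card := by gcongr; exact Finset.card_biUnion_le
        _ = ∑ l ∈ D, (d + 1) * (F j ∩ F l).card := by rw [Finset.mul_sum]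
        _ ≤ ∑ l ∈ D, m := Finset.sum_le_sum fun l hl => hsep j l (by rintro rfl; exact hj hl)
        _ = D.card * m := by simp
    rw [hF] at h1
    have h3 : D.card * (D.card - 1) * m + D.card * m = D.card * D.card * m := by
      rcases Nat.eq_zero_or_pos D.card with h | h
      · simp [h]
      · obtain ⟨e, he⟩ : ∃ e, D.card = e + 1 := ⟨D.card - 1, by omega⟩
        rw [he, Nat.add_sub_cancel]
        ring
    nlinarith

theorem mem_testList {j x : ℕ} : x ∈ testList c d m q u j ↔
    (∃ i < m, c j i + i * q = x) ∨
      ∃ k < privateCount d m q u j, k * d + (m * q + j) = x := by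
  simp [testList]

theorem digits_inj {i i' v v' : ℕ} (hv : v < q) (hv' : v' < q)
    (h : v + i * q = v' + i' * q) : i = i' ∧ v = v' := by
  have hi : i = i' := by
    have h1 : (v + i * q) / q = i := by
      rw [Nat.add_mul_div_right _ _ (by omega), Nat.div_eq_of_lt hv, zero_add]
    have h2 : (v' + i' * q) / q = i' := by
      rw [Nat.add_mul_div_right _ _ (by omega), Nat.div_eq_of_lt hv', zero_add]
    rw [← h1, h, h2]
  subst hi
  exact ⟨rfl, by omega⟩

theorem entry_lt {i v : ℕ} (hi : i < m) (hv : v < q) : v + i * q < m * q := by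
  have := row_add_lt hi hv
  omega

theorem testList_lt (hd : 0 < d) (hc : ∀ j i, c j i < q) (hmq : m * q ≤ t) (hu : u ≤ t)
    {j x : ℕ} (hx : x ∈ testList c d m q u j) : x < t := by
  rcases mem_testList.1 hx with ⟨i, hi, rfl⟩ | ⟨k, hk, rfl⟩
  · exact (entry_lt hi (hc j i)).trans_le hmq
  · exact (private_lt hd hk).2.trans_le hu

theorem testList_nodup (hd : 0 < d) (hc : ∀ j i, c j i < q) (j : ℕ) :
    (testList c d m q u j).Nodup := by
  refine List.Nodup.append ?_ ?_ ?_
  · refine List.Nodup.map_on (fun i _ i' _ h => (digits_inj (hc j i) (hc j i') h).1)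
      List.nodup_range
  · refine List.Nodup.map_on (fun k _ k' _ h => ?_) List.nodup_range
    exact Nat.eq_of_mul_eq_mul_right hd (by omega)
  · intro x hx hx'
    simp only [List.mem_map, List.mem_range] at hx hx'
    obtain ⟨i, hi, rfl⟩ := hx
    obtain ⟨k, -, hk⟩ := hx'
    have := entry_lt hi (hc j i)
    omega

theorem lists_tableStrategy (hd : 0 < d) (hc : ∀ j i, c j i < q) (hmq : m * q ≤ t)
    (hu : u ≤ t) :
    Lists ((List.range n).flatMap fun j =>
        (testList c d m q u j).length :: testList c d m q u j)
      (family (tableStrategy n t c d m q u)) := by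
  refine ⟨fun j => testList c d m q u j, fun j => ⟨testList_nodup hd hc j, fun x => ?_⟩, ?_⟩
  · constructor
    · intro hx
      exact ⟨⟨x, testList_lt hd hc hmq hu hx⟩, mem_family_tableStrategy.2 hx, rfl⟩
    · rintro ⟨i, hi, rfl⟩
      exact mem_family_tableStrategy.1 hi
  · rw [List.ofFn_eq_map, List.flatMap_map, ← List.map_coe_finRange_eq_range, List.flatMap_map]

/-- Distinct words agree in at most the fraction `1 / (d + 1)` of their entries. -/
def Separated (n d m : ℕ) (c : ℕ → ℕ → ℕ) : Prop :=
  ∀ j < n, ∀ l < n, j ≠ l →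
    (d + 1) * ((Finset.range m).filter fun i => c j i = c l i).card ≤ m

/-- At most d other words agree with a given word in at most dm/(d+1) < m positions altogether, so
some position separates it from all of them. The corresponding test has a number below m q, where
private tests do not interfere. -/
theorem finds_tableStrategy (hm0 : 0 < m) (hc : ∀ j i, c j i < q) (hmq : m * q ≤ t)
    (hsep : Separated n d m c) : Finds d (tableStrategy n t c d m q u) := by
  refine finds_of_not_covered fun D j hD hj => ?_
  obtain ⟨i, hi, hi'⟩ : ∃ i < m, ∀ l ∈ D, c j i ≠ c l i := by
    by_contra! hcon
    have hsub : Finset.range m ⊆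
        D.biUnion fun l => (Finset.range m).filter fun i => c j i = c l i := by
      intro i hi
      obtain ⟨l, hl, he⟩ := hcon i (Finset.mem_range.1 hi)
      exact Finset.mem_biUnion.2 ⟨l, hl, Finset.mem_filter.2 ⟨hi, he⟩⟩
    have h1 := (Finset.card_le_card hsub).trans Finset.card_biUnion_le
    rw [Finset.card_range] at h1
    have h2 : (d + 1) * ∑ l ∈ D, ((Finset.range m).filter fun i => c j i = c l i).card ≤
        D.card * m := by
      rw [Finset.mul_sum]
      calc _ ≤ ∑ l ∈ D, m := Finset.sum_le_sum fun l hl =>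
            hsep j j.2 l l.2 fun h => hj (by rwa [Fin.ext h])
        _ = D.card * m := by simp
    have h3 := Nat.mul_le_mul_left (d + 1) h1
    have h4 := Nat.mul_le_mul_right m hD
    rw [Nat.succ_mul] at h3
    omega
  have hlt := entry_lt hi (hc j i)
  refine ⟨⟨c j i + i * q, by omega⟩,
    mem_family_tableStrategy.2 (mem_testList.2 (Or.inl ⟨i, hi, rfl⟩)), fun l hl hx => ?_⟩
  rcases mem_testList.1 (mem_family_tableStrategy.1 hx) with ⟨i', hi'', he⟩ | ⟨k, hk, he⟩
  · obtain ⟨rfl, he⟩ := digits_inj (hc l i') (hc j i) he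
    exact hi' l hl he.symm
  · simp only at he
    omega

theorem card_family_tableStrategy (hd : 0 < d) (hc : ∀ j i, c j i < q) (hmq : m * q ≤ t)
    (hu : u ≤ t) (j : Fin n) :
    (family (tableStrategy n t c d m q u) j).card = m + privateCount d m q u j := by
  rw [← length_testList c, ← List.toFinset_card_of_nodup (testList_nodup hd hc j)]
  refine Finset.card_nbij (fun x => (x : ℕ)) (fun x hx => ?_) (fun x _ y _ h => Fin.ext h)
    fun x hx => ?_
  · simpa using mem_family_tableStrategy.1 hx
  · have hx' : x ∈ testList c d m q u j := by simpa using hx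
    exact ⟨⟨x, testList_lt hd hc hmq hu hx'⟩, mem_family_tableStrategy.2 hx', rfl⟩

theorem privateCount_mul_self (hd : 0 < d) (j : ℕ) : privateCount d m q (m * q) j = 0 := by
  by_contra h
  have := (private_lt hd (Nat.pos_of_ne_zero h)).2
  omega

theorem mem_family_code (hd : 0 < d) {j : Fin n} {x : Fin t} :
    x ∈ family (tableStrategy n t c d m q (m * q)) j ↔ ∃ i < m, c j i + i * q = x := by
  rw [mem_family_tableStrategy, mem_testList, privateCount_mul_self hd]
  simp

/-- The quotient of a test by q is its position, so common tests inject into the positions where the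
two words agree. -/
theorem card_inter_family_code (hd : 0 < d) (hc : ∀ j i, c j i < q)
    (hsep : Separated n d m c) {j l : Fin n} (hjl : j ≠ l) :
    (d + 1) * (family (tableStrategy n t c d m q (m * q)) j ∩
      family (tableStrategy n t c d m q (m * q)) l).card ≤ m := by
  refine (Nat.mul_le_mul_left _ ?_).trans (hsep j j.2 l l.2 fun h => hjl (Fin.ext h))
  refine Finset.card_le_card_of_injOn (fun x => (x : ℕ) / q) ?_ ?_
  · intro x hx
    rw [Finset.mem_coe, Finset.mem_inter, mem_family_code hd, mem_family_code hd] at hx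
    obtain ⟨⟨i, hi, he⟩, ⟨i', hi', he'⟩⟩ := hx
    obtain ⟨rfl, he''⟩ := digits_inj (hc j i) (hc l i') (he.trans he'.symm)
    have h1 := hc j i
    have : (x : ℕ) / q = i := by
      rw [← he, Nat.add_mul_div_right _ _ (by omega), Nat.div_eq_of_lt h1, zero_add]
    simp only [this]
    simpa using ⟨hi, he''⟩
  · intro x hx y hy hxy
    rw [Finset.mem_coe, Finset.mem_inter, mem_family_code hd] at hx hy
    obtain ⟨⟨i, hi, he⟩, -⟩ := hx
    obtain ⟨⟨i', hi', he'⟩, -⟩ := hy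
    have h1 := hc j i
    have h2 := hc j i'
    simp only [← he, ← he'] at hxy
    rw [Nat.add_mul_div_right _ _ (by omega), Nat.div_eq_of_lt h1, zero_add,
      Nat.add_mul_div_right _ _ (by omega), Nat.div_eq_of_lt h2, zero_add] at hxy
    subst hxy
    exact Fin.ext (he.symm.trans he')

theorem maxYes_code_le (hd : 0 < d) (hc : ∀ j i, c j i < q) (hmq : m * q ≤ t) :
    maxYes d (tableStrategy n t c d m q (m * q)) ≤ d * m := by
  refine Finset.sup_le fun D hD => ?_
  rw [response_eq_biUnion]
  refine Finset.card_biUnion_le.trans ?_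
  refine (Finset.sum_le_sum (g := fun _ => m) fun j _ => ?_).trans ?_
  · rw [card_family_tableStrategy hd hc hmq hmq, privateCount_mul_self hd, add_zero]
  · simpa using Nat.mul_le_mul_right m (by simpa using hD)

/-- For d members, `card_biUnion_ge` bounds the size of the union from below by dm(d+3)/(2(d+1)),
which is at least dm/2. -/
theorem le_maxYes_code (hd : 0 < d) (hdn : d ≤ n) (hc : ∀ j i, c j i < q) (hmq : m * q ≤ t)
    (hsep : Separated n d m c) :
    d * m ≤ 2 * maxYes d (tableStrategy n t c d m q (m * q)) := by
  obtain ⟨D, hD⟩ : ∃ D : Finset (Fin n), D.card = d := by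
    obtain ⟨D, -, hD⟩ := Finset.exists_subset_card_eq (s := (Finset.univ : Finset (Fin n)))
      (n := d) (by simpa using hdn)
    exact ⟨D, hD⟩
  have h1 := card_biUnion_ge (m := m) (d := d)
    (F := family (tableStrategy n t c d m q (m * q)))
    (fun j => by rw [card_family_tableStrategy hd hc hmq hmq, privateCount_mul_self hd, add_zero])
    (fun j l h => card_inter_family_code hd hc hsep h) D
  rw [← response_eq_biUnion, hD] at h1
  have h2 := response_card_le_maxYes (tableStrategy n t c d m q (m * q)) hD.le
  obtain ⟨e, rfl⟩ : ∃ e, d = e + 1 := ⟨d - 1, by omega⟩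
  rw [Nat.add_sub_cancel] at h1
  by_contra! hcon
  have h3 : (e + 1 + 1) * (2 * (response (tableStrategy n t c (e + 1) m q (m * q)) D).card) <
      (e + 1 + 1) * ((e + 1) * m) := Nat.mul_lt_mul_of_pos_left (by omega) (by omega)
  nlinarith [Nat.zero_le (e * m), Nat.zero_le (e * e * m)]

/-- With private tests from `m q` on, all of these answer "yes" for the first `d` items. -/
theorem le_maxYes_private (hd : 0 < d) (hdn : d ≤ n) :
    t - m * q ≤ maxYes d (tableStrategy n t c d m q t) := by
  have hD : ((Finset.univ : Finset (Fin d)).image (Fin.castLE hdn)).card ≤ d :=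
    Finset.card_image_le.trans (by simp)
  refine le_trans ?_ (response_card_le_maxYes _ hD)
  rw [← Nat.card_Ico (m * q) t]
  refine Finset.card_le_card_of_surjOn (fun x => (x : ℕ)) fun x hx => ?_
  rw [Finset.coe_Ico, Set.mem_Ico] at hx
  have hlt := lt_privateCount hd hx.1 hx.2
  have hdm := Nat.div_add_mod (x - m * q) d
  refine ⟨⟨x, hx.2⟩, ?_, rfl⟩
  rw [Finset.mem_coe, mem_response]
  refine ⟨Fin.castLE hdn ⟨(x - m * q) % d, Nat.mod_lt _ hd⟩,
    Finset.mem_image_of_mem _ (Finset.mem_univ _), ?_⟩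
  rw [mem_family_tableStrategy, mem_testList]
  refine Or.inr ⟨_, hlt, ?_⟩
  rw [mul_comm]
  simp only [Fin.val_castLE]
  omega

end Family

/-! ## The parameters for which the code is good -/

/-- Parameters for which the code has relative distance `d / (d + 1)`: either there is only one
generator, or the alphabet is a prime field and the length is large enough. -/
structure Params (n d m q a z : ℕ) : Prop where
  d_pos : 0 < d
  m_pos : 0 < m
  two_le : 2 ≤ q
  le_n : q ≤ n
  a_pos : 0 < a
  cases : q = n ∨ q.Prime ∧ m = (d + 1) * z ∧ (d + 1) * a ≤ q ∧ n * 4 ^ z < a ^ (z + 1)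

section

variable {n d m q a z : ℕ}

theorem Params.n_pos (h : Params n d m q a z) : 2 ≤ n := h.two_le.trans h.le_n

/-- The reason is (1 + 1/(d+1))^(d+1) ≤ e < 4. A power of two instead of e keeps the later
arithmetic with a = 2^h integral. -/
theorem add_pow_le_four_mul_pow (hq : 0 < q) (h : (d + 1) * a ≤ q) :
    (q + a) ^ (d + 1) ≤ 4 * q ^ (d + 1) := by
  have hq' : (0 : ℝ) < q := by exact_mod_cast hq
  have h1 : ((q : ℝ) + a) ≤ q * (1 + 1 / ((d + 1 : ℕ) : ℝ)) := by
    have : ((d : ℝ) + 1) * a ≤ q := by exact_mod_cast h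
    have hd : (0 : ℝ) < d + 1 := by positivity
    rw [mul_add, mul_one, mul_one_div]
    push_cast
    gcongr
    rw [le_div_iff₀ hd]
    linarith
  have h2 : (1 + 1 / ((d + 1 : ℕ) : ℝ)) ^ (d + 1) ≤ 4 := by
    have h3 : 1 + 1 / ((d + 1 : ℕ) : ℝ) ≤ Real.exp (1 / ((d + 1 : ℕ) : ℝ)) := by
      rw [add_comm]; exact Real.add_one_le_exp _
    calc (1 + 1 / ((d + 1 : ℕ) : ℝ)) ^ (d + 1)
        ≤ Real.exp (1 / ((d + 1 : ℕ) : ℝ)) ^ (d + 1) := by gcongr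
      _ = Real.exp 1 := by
          rw [← Real.exp_nat_mul]
          congr 1
          field_simp
      _ ≤ 4 := by linarith [Real.exp_one_lt_d9]
  have h4 : ((q : ℝ) + a) ^ (d + 1) ≤ 4 * q ^ (d + 1) := by
    calc ((q : ℝ) + a) ^ (d + 1) ≤ (q * (1 + 1 / ((d + 1 : ℕ) : ℝ))) ^ (d + 1) := by gcongr
      _ = q ^ (d + 1) * (1 + 1 / ((d + 1 : ℕ) : ℝ)) ^ (d + 1) := mul_pow ..
      _ ≤ q ^ (d + 1) * 4 := by gcongr
      _ = 4 * q ^ (d + 1) := mul_comm ..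
  exact_mod_cast h4

theorem add_pred_pow_le (hq : 0 < q) (h : (d + 1) * a ≤ q) :
    (q + (a - 1)) ^ ((d + 1) * z) ≤ 4 ^ z * q ^ ((d + 1) * z) := by
  calc (q + (a - 1)) ^ ((d + 1) * z) ≤ ((q + a) ^ (d + 1)) ^ z := by
        rw [← pow_mul]
        gcongr
        omega
    _ ≤ (4 * q ^ (d + 1)) ^ z := by gcongr; exact add_pow_le_four_mul_pow hq h
    _ = 4 ^ z * q ^ ((d + 1) * z) := by rw [mul_pow, ← pow_mul]

theorem weights_one (hq : 2 ≤ q) (i : ℕ) : weights q a 1 (code q a 0) i 0 = 1 := by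
  induction i with
  | zero => rfl
  | succ i ih =>
    rw [weights_succ, newRow, argMin_eq_one _ hq, ih]
    · simp [code]
    · rw [bucket, Finset.sum_range_one, if_pos (by rfl), ih]
      exact one_pos
    · intro v hv
      simp [bucket, code, hv.ne]

/-- Since (q + a - 1)/q ≥ 1, the bound for the total weight after m entries also majorizes the
totals before. Thus the inequality that makes the code good also bounds the machine words. -/
theorem Params.sum_weights_lt (h : Params n d m q a z) {l i : ℕ} (hl : q ^ l < n) (hi : i ≤ m) :
    ∑ j ∈ Finset.range (q ^ l), weights q a (q ^ l) (code q a l) i j ≤ a ^ (z + 1) := by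
  have hq0 : 0 < q := by have := h.two_le; omega
  rcases h.cases with rfl | ⟨-, hm, hda, hz⟩
  -- With q = n a single generator suffices, and all weights that occur are those of the zero word.
  · obtain rfl : l = 0 := by
      by_contra hl0
      have := Nat.le_self_pow hl0 q
      omega
    simpa [weights_one h.two_le] using Nat.one_le_pow _ _ h.a_pos
  · have h1 := pow_mul_sum_weights_le (q := q) (k := q ^ l) (c := code q a l) (m := m) h.a_pos
      (fun j _ i _ => code_lt hq0 l j i) hi
    have h2 := add_pred_pow_le (z := z) hq0 hda
    rw [← hm] at h2
    set S := ∑ j ∈ Finset.range (q ^ l), weights q a (q ^ l) (code q a l) i j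
    refine le_trans ?_ hz.le
    refine le_of_mul_le_mul_left ?_ (pow_pos hq0 m)
    calc q ^ m * S = q ^ (m - i) * (q ^ i * S) := by
          rw [← mul_assoc, ← pow_add, Nat.sub_add_cancel hi]
      _ ≤ q ^ (m - i) * (q ^ l * (q + (a - 1)) ^ i) := by gcongr
      _ ≤ (q + (a - 1)) ^ (m - i) * (n * (q + (a - 1)) ^ i) := by
          gcongr
          omega
      _ = n * (q + (a - 1)) ^ m := by
          rw [mul_left_comm, ← pow_add, Nat.sub_add_cancel hi]
      _ ≤ n * (4 ^ z * q ^ m) := by gcongr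
      _ = q ^ m * (n * 4 ^ z) := by ring

/-! ## The code is linear -/

/-- The codewords as vectors over `ZMod q`. -/
def codeVec (q a m l j : ℕ) (i : Fin m) : ZMod q := (code q a l j i : ZMod q)

theorem natCast_inj_of_lt {x y : ℕ} (hx : x < q) (hy : y < q) :
    (x : ZMod q) = y ↔ x = y := by
  rw [ZMod.natCast_eq_natCast_iff', Nat.mod_eq_of_lt hx, Nat.mod_eq_of_lt hy]

theorem card_fin_filter (p : ℕ → Prop) [DecidablePred p] :
    ((Finset.univ : Finset (Fin m)).filter fun i : Fin m => p i).card =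
      ((Finset.range m).filter p).card := by
  refine Finset.card_nbij (fun i => (i : ℕ)) (fun i hi => ?_) (fun i _ j _ h => Fin.ext (by simpa using h))
    fun i hi => ?_
  · simpa using hi
  · simp only [Finset.coe_filter, Finset.mem_range, Set.mem_ofPred_eq] at hi
    exact ⟨⟨i, hi.1⟩, by simpa using hi.2, rfl⟩

/-- The new generator as a vector. -/
def rowVec (q a m l : ℕ) (i : Fin m) : ZMod q := (newRow q a (q ^ l) (code q a l) i : ZMod q)

theorem codeVec_succ (l j : ℕ) : codeVec q a m (l + 1) j =
    codeVec q a m l (j % q ^ l) + ((j / q ^ l : ℕ) : ZMod q) • rowVec q a m l := by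
  funext i
  simp [codeVec, rowVec, code]

/-- For b ≠ 0 the word y + b r vanishes exactly where -b⁻¹ y agrees with r, and -b⁻¹ y lies in C
again. Hence the greedy choice, which compares r with the words of C only, controls all new words.
-/
theorem exists_submodule [Fact q.Prime] (hm0 : 0 < m) (hd : 0 < d) (ha : 0 < a)
    (hm : m = (d + 1) * z) (hda : (d + 1) * a ≤ q) (hz : n * 4 ^ z < a ^ (z + 1)) (l : ℕ)
    (hl : ∀ k < l, q ^ k < n) :
    ∃ C : Submodule (ZMod q) (Fin m → ZMod q),
      (∀ x, x ∈ C ↔ ∃ j < q ^ l, codeVec q a m l j = x) ∧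
      (∀ j < q ^ l, ∀ k < q ^ l, codeVec q a m l j = codeVec q a m l k → j = k) ∧
      ∀ x ∈ C, x ≠ 0 → (Finset.univ.filter fun i => x i = 0).card ≤ z := by
  have hq0 : 0 < q := (Fact.out : q.Prime).pos
  have hz0 : 0 < z := by
    rcases Nat.eq_zero_or_pos z with rfl | h
    · omega
    · exact h
  have hzm : z < m := by nlinarith
  induction l with
  | zero =>
    refine ⟨⊥, fun x => ?_, by simp, by simp⟩
    have : codeVec q a m 0 0 = 0 := by funext i; simp [codeVec, code]
    simp [this, eq_comm]
  | succ l ih =>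
    obtain ⟨C, hC, hinj, hdist⟩ := ih fun k hk => hl k (by omega)
    set r := rowVec q a m l with hr
    have hQ : 0 < q ^ l := by positivity
    have hagree : ∀ x ∈ C, (Finset.univ.filter fun i => x i = r i).card ≤ z := by
      intro x hx
      obtain ⟨j, hj, rfl⟩ := (hC x).1 hx
      have h1 := card_agree_newRow_le (q := q) (a := a) (k := q ^ l) (m := m) (z := z)
        (c := code q a l) ha (fun j _ i _ => code_lt hq0 l j i) ?_ hj
      · rw [← card_fin_filter] at h1
        refine le_of_eq_of_le ?_ h1
        congr 1
        exact Finset.filter_congr fun (i : Fin m) _ =>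
          natCast_inj_of_lt (code_lt hq0 l j i) (newRow_lt hq0 (q ^ l) (code q a l) i)
      · have h2 := add_pred_pow_le (z := z) hq0 hda
        rw [← hm] at h2
        calc q ^ l * (q + (a - 1)) ^ m ≤ n * (4 ^ z * q ^ m) :=
              Nat.mul_le_mul (hl l (Nat.lt_succ_self l)).le h2
          _ = q ^ m * (n * 4 ^ z) := by ring
          _ < q ^ m * a ^ (z + 1) := by gcongr
    -- If r were in C, it would agree with itself in all m > z positions.
    have hrC : r ∉ C := by
      intro h
      have := hagree r h
      simp at this
      omega
    have hdigit : ∀ j < q ^ (l + 1), j / q ^ l < q := by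
      intro j hj
      rw [Nat.div_lt_iff_lt_mul hQ, mul_comm, ← pow_succ]
      exact hj
    refine ⟨C ⊔ Submodule.span (ZMod q) {r}, fun x => ?_, ?_, ?_⟩
    · rw [Submodule.mem_sup]
      constructor
      · rintro ⟨y, hy, w, hw, rfl⟩
        obtain ⟨b, rfl⟩ := Submodule.mem_span_singleton.1 hw
        obtain ⟨j, hj, rfl⟩ := (hC y).1 hy
        have hb := ZMod.val_lt b
        refine ⟨j + q ^ l * b.val, ?_, ?_⟩
        · calc j + q ^ l * b.val < q ^ l * (b.val + 1) := by rw [mul_add, mul_one]; omega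
            _ ≤ q ^ l * q := Nat.mul_le_mul_left _ hb
        · rw [codeVec_succ, Nat.add_mul_mod_self_left, Nat.mod_eq_of_lt hj,
            Nat.add_mul_div_left _ _ hQ, Nat.div_eq_of_lt hj, zero_add, ZMod.natCast_zmod_val]
      · rintro ⟨j, hj, rfl⟩
        exact ⟨_, (hC _).2 ⟨j % q ^ l, Nat.mod_lt _ hQ, rfl⟩, _,
          Submodule.mem_span_singleton.2 ⟨((j / q ^ l : ℕ) : ZMod q), rfl⟩, (codeVec_succ l j).symm⟩
    · intro j hj k hk he
      rw [codeVec_succ, codeVec_succ] at he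
      have hj' : codeVec q a m l (j % q ^ l) ∈ C := (hC _).2 ⟨_, Nat.mod_lt _ hQ, rfl⟩
      have hk' : codeVec q a m l (k % q ^ l) ∈ C := (hC _).2 ⟨_, Nat.mod_lt _ hQ, rfl⟩
      -- If the leading digits differed, r would be a multiple of a difference of two words of C.
      have hd' : ((j / q ^ l : ℕ) : ZMod q) = ((k / q ^ l : ℕ) : ZMod q) := by
        by_contra hne
        have hsub : ((j / q ^ l : ℕ) - (k / q ^ l : ℕ) : ZMod q) • r =
            codeVec q a m l (k % q ^ l) - codeVec q a m l (j % q ^ l) := by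
          rw [sub_smul, sub_eq_sub_iff_add_eq_add, add_comm, he, add_comm]
        apply hrC
        rw [← Submodule.smul_mem_iff C (sub_ne_zero.2 hne), hsub]
        exact C.sub_mem hk' hj'
      rw [hd', add_left_inj] at he
      have h1 := hinj _ (Nat.mod_lt _ hQ) _ (Nat.mod_lt _ hQ) he
      have h2 := (natCast_inj_of_lt (hdigit j hj) (hdigit k hk)).1 hd'
      rw [← Nat.div_add_mod j (q ^ l), ← Nat.div_add_mod k (q ^ l), h1, h2]
    · intro x hx hx0
      obtain ⟨y, hy, w, hw, rfl⟩ := Submodule.mem_sup.1 hx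
      obtain ⟨b, rfl⟩ := Submodule.mem_span_singleton.1 hw
      rcases eq_or_ne b 0 with rfl | hb
      · rw [zero_smul, add_zero] at hx0 ⊢
        exact hdist y hy hx0
      · refine le_trans (le_of_eq ?_) (hagree _ (C.smul_mem (-b⁻¹) hy))
        congr 1
        ext i
        simp only [Finset.mem_filter, Finset.mem_univ, true_and, Pi.add_apply, Pi.smul_apply,
          smul_eq_mul]
        constructor
        · intro h
          field_simp
          linear_combination -h
        · intro h
          field_simp at h
          linear_combination -h

theorem hammingDist_add_card_eq {K : Type*} [Field K] [DecidableEq K] (x y : Fin m → K) :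
    hammingDist x y + (Finset.univ.filter fun i : Fin m => (x - y) i = 0).card = m := by
  have h := Finset.card_filter_add_card_filter_not (s := (Finset.univ : Finset (Fin m)))
    (fun i => x i ≠ y i)
  simpa [hammingDist, sub_eq_zero] using h

theorem Params.pow_clog (h : Params n d m q a z) : n ≤ q ^ Nat.clog q n :=
  Nat.le_pow_clog (by have := h.two_le; omega) n

theorem Params.exists_submodule (h : Params n d m q a z) [Fact q.Prime] (hm : m = (d + 1) * z)
    (hda : (d + 1) * a ≤ q) (hz : n * 4 ^ z < a ^ (z + 1)) :
    ∃ C : Submodule (ZMod q) (Fin m → ZMod q),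
      (∀ j < n, codeVec q a m (Nat.clog q n) j ∈ C) ∧
      (∀ j < n, ∀ k < n,
        codeVec q a m (Nat.clog q n) j = codeVec q a m (Nat.clog q n) k → j = k) ∧
      ∀ x ∈ C, x ≠ 0 → (Finset.univ.filter fun i => x i = 0).card ≤ z := by
  obtain ⟨C, h1, h2, h3⟩ := GroupTesting.exists_submodule h.m_pos h.d_pos h.a_pos hm hda hz
    (Nat.clog q n) fun k hk => (Nat.lt_clog_iff_pow_lt (by have := h.two_le; omega)).1 hk
  have hn := h.pow_clog
  exact ⟨C, fun j hj => (h1 _).2 ⟨j, by omega, rfl⟩,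
    fun j hj k hk he => h2 j (by omega) k (by omega) he, h3⟩

theorem Params.code_self (h : Params n d m n a z) {j : ℕ} (hj : j < n) (i : ℕ) :
    code n a (Nat.clog n n) j i = j := by
  have h2 := h.two_le
  have : Nat.clog n n = 1 := by
    refine le_antisymm (Nat.clog_le_of_le_pow (by simp)) ?_
    exact (Nat.lt_clog_iff_pow_lt (by omega)).2 (by simpa using by omega)
  rw [this, code_one h2 h.a_pos hj]

/-- Agreements of two words are the zeros of their difference, at most z = m/(d+1) in number.
Distinct words of the repetition code agree nowhere. -/
theorem Params.separated (h : Params n d m q a z) :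
    Separated n d m (code q a (Nat.clog q n)) := by
  intro j hj k hk hjk
  rcases h.cases with rfl | ⟨hp, hm, hda, hz⟩
  · rw [Finset.filter_false_of_mem]
    · simp
    · intro i _
      rwa [h.code_self hj, h.code_self hk]
  · have := Fact.mk hp
    have hq0 := hp.pos
    obtain ⟨C, h1, h2, h3⟩ := h.exists_submodule hm hda hz
    have h4 := h3 _ (C.sub_mem (h1 j hj) (h1 k hk))
      (sub_ne_zero.2 fun he => hjk (h2 j hj k hk he))
    rw [hm] at h4 ⊢
    refine Nat.mul_le_mul_left _ ?_
    rw [← card_fin_filter]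
    refine le_of_eq_of_le ?_ h4
    congr 1
    refine Finset.filter_congr fun i _ => ?_
    rw [Pi.sub_apply, sub_eq_zero]
    exact (natCast_inj_of_lt (code_lt hq0 ..) (code_lt hq0 ..)).symm

theorem div_mul_le_hammingDist {K : Type*} [Field K] [DecidableEq K] {x y : Fin m → K}
    (hm : m = (d + 1) * z) (h : (Finset.univ.filter fun i : Fin m => (x - y) i = 0).card ≤ z) :
    (d : ℝ) / (d + 1) * m ≤ hammingDist x y := by
  have h1 := hammingDist_add_card_eq x y
  have h2 : d * z ≤ hammingDist x y := by
    rw [Nat.add_mul, one_mul] at hm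
    omega
  have h3 : (d : ℝ) / (d + 1) * m = (d * z : ℕ) := by
    rw [hm]
    push_cast
    field_simp
  rw [h3]
  exact_mod_cast h2

/-- The repetition code over a field with at least `n` elements. -/
theorem builtFromLinearCode_repetition {t : ℕ} (hn : n ≠ 0) (hm0 : 0 < m) (hmn : m * (2 * n) ≤ t)
    {F : Fin n → Finset (Fin t)}
    (hF : ∀ j x, x ∈ F j ↔ ∃ i < m, (j : ℕ) + i * n = (x : ℕ)) :
    BuiltFromLinearCode F ((d : ℝ) / (d + 1)) := by
  obtain ⟨p, hp, hnp, hp2⟩ := Nat.exists_prime_lt_and_le_two_mul n hn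
  have := Fact.mk hp
  have hmp : m * p ≤ t := (Nat.mul_le_mul_left _ hp2).trans hmn
  have hmn' : m * n + m * (p - n) = m * p := by rw [← Nat.mul_add, Nat.add_sub_cancel' hnp.le]
  -- As n need not be a prime power, the words are regarded over a field with p > n elements. The
  -- symbols below n keep the tests that the strategy gives them, and the p - n surplus symbols are
  -- sent to tests from m n on. Together this takes m p ≤ 2 m n tests.
  let g : Fin m × ZMod p → ℕ := fun x =>
    if x.2.val < n then x.2.val + x.1 * n else m * n + ((x.2.val - n) + x.1 * (p - n))
  have hval : ∀ v : ZMod p, v.val < p := fun v => ZMod.val_lt v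
  have hg : ∀ x, g x < t := by
    rintro ⟨i, v⟩
    have := hval v
    simp only [g]
    split_ifs with h
    · have := entry_lt i.2 h
      omega
    · have := entry_lt i.2 (show v.val - n < p - n by omega)
      omega
  have hginj : Function.Injective g := by
    rintro ⟨i, v⟩ ⟨i', v'⟩ he
    have hv := hval v
    have hv' := hval v'
    have hfin : (i : ℕ) = i' ∧ v.val = v'.val → (i, v) = (i', v') := fun h =>
      Prod.ext (Fin.ext h.1) (ZMod.val_injective p h.2)
    apply hfin
    simp only [g] at he
    split_ifs at he with h h' h'
    · exact digits_inj h h' he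
    · have := entry_lt i.2 h
      omega
    · have := entry_lt i'.2 h'
      omega
    · have := digits_inj (show v.val - n < p - n by omega) (show v'.val - n < p - n by omega)
        (Nat.add_left_cancel he)
      omega
  let C : Submodule (ZMod p) (Fin m → ZMod p) :=
    LinearMap.range (LinearMap.pi fun _ : Fin m => (LinearMap.id : ZMod p →ₗ[ZMod p] ZMod p))
  have hC : ∀ v : ZMod p, (fun _ : Fin m => v) ∈ C := fun v => ⟨v, rfl⟩
  refine ⟨m, Module.finrank (ZMod p) C, ZMod p, inferInstance, inferInstance, inferInstance, C,
    ⟨fun x => ⟨g x, hg x⟩, fun x y h => hginj (Fin.ext_iff.1 h)⟩,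
    ⟨fun j => ⟨fun _ => ((j : ℕ) : ZMod p), hC _⟩, fun j k h => ?_⟩, ⟨rfl, ?_⟩, fun j => ?_⟩
  · have := congrFun (congrArg Subtype.val h) ⟨0, hm0⟩
    exact Fin.ext ((natCast_inj_of_lt (by omega) (by omega)).1 this)
  · rintro x ⟨v, rfl⟩ y ⟨w, rfl⟩ hxy
    have hvw : v ≠ w := by rintro rfl; exact hxy rfl
    have hdist : hammingDist (fun _ : Fin m => v) (fun _ : Fin m => w) = m := by
      simp [hammingDist, hvw]
    change _ ≤ ((hammingDist (fun _ : Fin m => v) (fun _ : Fin m => w) : ℕ) : ℝ)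
    rw [hdist]
    refine mul_le_of_le_one_left (Nat.cast_nonneg _) ?_
    rw [div_le_one (by positivity)]
    linarith
  · ext x
    rw [hF]
    have hj : ((j : ℕ) : ZMod p).val = j := ZMod.val_natCast_of_lt (by omega)
    have hgj : ∀ i : Fin m, g (i, ((j : ℕ) : ZMod p)) = j + i * n := fun i => by
      simp only [g]
      rw [hj, if_pos j.2]
    rw [Finset.mem_image]
    constructor
    · rintro ⟨i, hi, he⟩
      exact ⟨⟨i, hi⟩, Finset.mem_univ _, Fin.ext ((hgj ⟨i, hi⟩).trans he)⟩
    · rintro ⟨i, -, rfl⟩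
      exact ⟨i, i.2, (hgj i).symm⟩

theorem Params.builtFromLinearCode (h : Params n d m q a z) {t : ℕ} (hmq : m * q ≤ t)
    (ht : q = n → m * (2 * n) ≤ t) :
    BuiltFromLinearCode
      (family (tableStrategy n t (code q a (Nat.clog q n)) d m q (m * q)))
      ((d : ℝ) / (d + 1)) := by
  rcases h.cases with rfl | ⟨hp, hm, hda, hz⟩
  · refine builtFromLinearCode_repetition (by have := h.two_le; omega) h.m_pos (ht rfl)
      fun j x => ?_
    simp only [mem_family_code h.d_pos, h.code_self j.2]
  · have := Fact.mk hp
    have hq0 := hp.pos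
    obtain ⟨C, h1, h2, h3⟩ := h.exists_submodule hm hda hz
    have hlt : ∀ x : Fin m × ZMod q, x.2.val + x.1 * q < t := fun x =>
      (entry_lt x.1.2 (ZMod.val_lt x.2)).trans_le hmq
    refine ⟨m, Module.finrank (ZMod q) C, ZMod q, inferInstance, inferInstance, inferInstance, C,
      ⟨fun x => ⟨x.2.val + x.1 * q, hlt x⟩, fun x y he => ?_⟩,
      ⟨fun j => ⟨codeVec q a m (Nat.clog q n) j, h1 j j.2⟩, fun j k he => ?_⟩, ⟨rfl, ?_⟩,
      fun j => ?_⟩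
    · obtain ⟨e1, e2⟩ := digits_inj (ZMod.val_lt x.2) (ZMod.val_lt y.2) (Fin.ext_iff.1 he)
      exact Prod.ext (Fin.ext e1) (ZMod.val_injective q e2)
    · exact Fin.ext (h2 j j.2 k k.2 (congrArg Subtype.val he))
    · intro x hx y hy hxy
      exact div_mul_le_hammingDist hm (h3 _ (C.sub_mem hx hy) (sub_ne_zero.2 hxy))
    · ext x
      rw [mem_family_code h.d_pos]
      have hj : ∀ i : Fin m, (codeVec q a m (Nat.clog q n) j i).val + i * q =
          code q a (Nat.clog q n) j i + i * q := fun i => by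
        rw [codeVec, ZMod.val_natCast_of_lt (code_lt hq0 ..)]
      rw [Finset.mem_image]
      constructor
      · rintro ⟨i, hi, he⟩
        exact ⟨⟨i, hi⟩, Finset.mem_univ _, Fin.ext ((hj ⟨i, hi⟩).trans he)⟩
      · rintro ⟨i, -, rfl⟩
        exact ⟨i, i.2, (hj i).symm⟩

end

/-! ## The two programs -/

/-- The listing of the family of `tableStrategy`. -/
def listing (n d m q a u : ℕ) : List ℕ :=
  (List.range n).flatMap fun j =>
    (testList (code q a (Nat.clog q n)) d m q u j).length ::
      testList (code q a (Nat.clog q n)) d m q u j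

theorem le_length_listing (n d m q a u : ℕ) : n * m ≤ (listing n d m q a u).length := by
  unfold listing
  generalize code q a (Nat.clog q n) = c
  induction n with
  | zero => simp
  | succ n ih =>
    rw [List.range_succ, List.flatMap_append, List.length_append, Nat.succ_mul]
    have := length_testList c d m q u n
    simp only [List.flatMap_singleton, List.length_cons]
    omega

section

variable {W n d t m q a u z g h : ℕ} {s : State}

/-- Compute the code and write the listing. -/
def listProg : Prog := .op .add 8 0 4 ;; buildTable ;; printAll

theorem listProg_wp (hs : Ready n d t s) (h3 : s.reg 3 = m) (h4 : s.reg 4 = q) (h5 : s.reg 5 = a)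
    (h6 : s.reg 6 = u) (hP : Params n d m q a z) (hW : n + q + n * m < W) (hnq : n * q < W)
    (hmq : n + m * q + m < W) (huW : u + d + m < W) (ha : a ^ (z + 1) < W) :
    Wp W listProg (500 * (n * m) + 6 * (n * ((u - m * q) / d))) s fun s' =>
      s'.out = listing n d m q a u := by
  have hn := hP.n_pos
  have hq := hP.two_le
  have hnm : n ≤ n * m := Nat.le_mul_of_pos_right _ hP.m_pos
  refine Wp.le (T := (400 * n * m + (n * (10 * m + 6 * ((u - m * q) / d) + 25) + 3)) + 1) ?_ ?_
  · refine Wp.op_seq (by simp [Op.eval, hs.r0, h4]; omega) ?_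
    simp only [Op.eval, hs.r0, h4]
    have hR : Regs n d m q a u (s.set 8 (n + q)) :=
      ⟨by simpa using hs.r0, by simpa using hs.r1, by simpa using h3, by simpa using h4,
        by simpa using h5, by simpa using h6, by simpa using hs.r7, by simp,
        by simpa using hs.r9⟩
    refine (buildTable_wp hR hn hq hP.le_n hP.m_pos hW hnq
      (fun l hl i hi => (hP.sum_weights_lt hl hi).trans_lt ha) hs.mem).seq ?_
    rintro s₁ ⟨m1, o1, A1⟩
    refine (printAll_wp (hR.agree A1 le_rfl) hW hmq huW hP.d_pos
      (code_lt (by omega) _) m1).mono le_rfl fun s₂ o2 => ?_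
    rw [o2, o1, hs.out, List.nil_append, listing]
  · have : n * (10 * m + 6 * ((u - m * q) / d) + 25) =
      10 * (n * m) + 6 * (n * ((u - m * q) / d)) + 25 * n := by ring
    have h2 : 400 * n * m = 400 * (n * m) := by ring
    omega

/-- The outcomes of the choice of the alphabet. -/
def Alphabet (n d a q : ℕ) : Prop :=
  n ≤ (d + 1) * a * a ∧ q = n ∨
    (d + 1) * a * a < n ∧ q.Prime ∧ (d + 1) * a < q ∧ q ≤ 2 * ((d + 1) * a)

/-- The parameters as they depend on `h`, where `a = 2 ^ h`. -/
structure Choice (n d t g h a z : ℕ) : Prop where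
  two_le : 2 ≤ n
  d_pos : 0 < d
  d_le : d ≤ n
  g_eq : g = Nat.log 2 n
  h_ge : 3 ≤ h
  a_eq : a = 2 ^ h
  z_eq : z = (g + 1) / (h - 2) + 1
  le_t : 24 * (d * d * g) * (a * a) ≤ t

/-! ### Arithmetic of the parameters -/

theorem Choice.g_pos (hC : Choice n d t g h a z) : 0 < g := by
  rw [hC.g_eq]
  exact Nat.log_pos Nat.one_lt_two hC.two_le

theorem Choice.eight_le (hC : Choice n d t g h a z) : 8 ≤ a := by
  rw [hC.a_eq]
  calc 8 = 2 ^ 3 := by norm_num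
    _ ≤ 2 ^ h := Nat.pow_le_pow_right (by norm_num) hC.h_ge

theorem Choice.lt_pow (hC : Choice n d t g h a z) : n < 2 ^ (g + 1) := by
  rw [hC.g_eq]
  exact Nat.lt_pow_succ_log_self (by norm_num) n

theorem Choice.pow_le (hC : Choice n d t g h a z) : 2 ^ g ≤ n := by
  rw [hC.g_eq]
  exact Nat.pow_log_le_self 2 (by have := hC.two_le; omega)

theorem Choice.g_lt (hC : Choice n d t g h a z) : g < n :=
  Nat.lt_two_pow_self.trans_le hC.pow_le

theorem Choice.z_le (hC : Choice n d t g h a z) : z ≤ 3 * g := by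
  have := Nat.div_le_self (g + 1) (h - 2)
  have := hC.g_pos
  rw [hC.z_eq]
  omega

theorem Choice.le_mul_z (hC : Choice n d t g h a z) : g + 1 ≤ (h - 2) * z := by
  rw [hC.z_eq]
  exact (Nat.lt_mul_div_succ (g + 1) (by have := hC.h_ge; omega)).le

/-- Each factor a = 2^h loses two of its h bits to a factor 4, so that (h - 2)z ≥ g + 1 bits remain
to exceed n. This explains the denominator h - 2 in z and the requirement h ≥ 3. -/
theorem Choice.lt_pow_z (hC : Choice n d t g h a z) : n * 4 ^ z < a ^ (z + 1) := by
  have ha : 0 < a := by have := hC.eight_le; omega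
  calc n * 4 ^ z < 2 ^ (g + 1) * 4 ^ z := by have := hC.lt_pow; gcongr
    _ ≤ 2 ^ ((h - 2) * z) * 4 ^ z := by
        have := hC.le_mul_z
        gcongr
        norm_num
    _ = a ^ z := by
        rw [pow_mul, ← mul_pow, hC.a_eq]
        congr 1
        rw [show (4 : ℕ) = 2 ^ 2 by norm_num, ← pow_add, Nat.sub_add_cancel]
        have := hC.h_ge
        omega
    _ ≤ a ^ (z + 1) := Nat.pow_le_pow_right ha (Nat.le_succ z)

theorem Choice.alphabet_le (hC : Choice n d t g h a z) (hq : Alphabet n d a q) :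
    q ≤ n ∧ q ≤ (d + 1) * (a * a) := by
  have ha := hC.eight_le
  rw [← mul_assoc]
  rcases hq with ⟨h1, rfl⟩ | ⟨h1, h2, h3, h4⟩
  · exact ⟨le_rfl, h1⟩
  · have : (d + 1) * a * 2 ≤ (d + 1) * a * a := Nat.mul_le_mul_left _ (by omega)
    omega

theorem Choice.params (hC : Choice n d t g h a z) (hq : Alphabet n d a q) :
    Params n d ((d + 1) * z) q a z where
  d_pos := hC.d_pos
  m_pos := Nat.mul_pos d.succ_pos (by rw [hC.z_eq]; exact Nat.succ_pos _)
  two_le := by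
    rcases hq with ⟨h1, rfl⟩ | ⟨h1, h2, h3, h4⟩
    · exact hC.two_le
    · exact h2.two_le
  le_n := (hC.alphabet_le hq).1
  a_pos := by have := hC.eight_le; omega
  cases := by
    rcases hq with ⟨h1, rfl⟩ | ⟨h1, h2, h3, h4⟩
    · exact Or.inl rfl
    · exact Or.inr ⟨h2, rfl, h3.le, hC.lt_pow_z⟩

theorem Choice.sq_mul_z_le (hC : Choice n d t g h a z) :
    (d + 1) * (d + 1) * z ≤ 12 * (d * d * g) := by
  have hd := hC.d_pos
  have hz := hC.z_le
  calc (d + 1) * (d + 1) * z ≤ (2 * d) * (2 * d) * (3 * g) := by gcongr <;> omega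
    _ = 12 * (d * d * g) := by ring

/-- The factor 24 comes from (d+1)² ≤ 4d², z ≤ 3g and the 2 in front of q. That 2 reserves room for
the repetition code over a prime field with up to 2n elements. -/
theorem Choice.length_mul_le (hC : Choice n d t g h a z) (hq : Alphabet n d a q) :
    (d + 1) * z * (2 * q) ≤ 24 * (d * d * g) * (a * a) := by
  calc (d + 1) * z * (2 * q) ≤ (d + 1) * z * (2 * ((d + 1) * (a * a))) := by
        have := (hC.alphabet_le hq).2
        gcongr
    _ = 2 * ((d + 1) * (d + 1) * z) * (a * a) := by ring
    _ ≤ 2 * (12 * (d * d * g)) * (a * a) := by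
        have := hC.sq_mul_z_le
        gcongr
    _ = 24 * (d * d * g) * (a * a) := by ring

/-- Since h ≤ 3(h - 2), the exponent h(z + 1) is at most 3(g + 1) + 2h. The first summand
contributes at most 8n³, and 2^(2h) = a² ≤ t. So the weights stay polynomial in n + t. -/
theorem Choice.pow_z_le (hC : Choice n d t g h a z) : a ^ (z + 1) ≤ 8 * n ^ 3 * t := by
  have hh := hC.h_ge
  have h1 : h * (z + 1) ≤ 3 * (g + 1) + (h + h) := by
    have h2 : h * ((g + 1) / (h - 2)) ≤ 3 * (h - 2) * ((g + 1) / (h - 2)) :=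
      Nat.mul_le_mul_right _ (by omega)
    have h3 := Nat.mul_div_le (g + 1) (h - 2)
    have h4 : h * (z + 1) = h * ((g + 1) / (h - 2)) + (h + h) := by rw [hC.z_eq]; ring
    rw [mul_assoc] at h2
    omega
  calc a ^ (z + 1) = 2 ^ (h * (z + 1)) := by rw [hC.a_eq, ← pow_mul]
    _ ≤ 2 ^ (3 * (g + 1) + (h + h)) := Nat.pow_le_pow_right (by norm_num) h1
    _ = 8 * (2 ^ g) ^ 3 * (a * a) := by rw [hC.a_eq]; ring
    _ ≤ 8 * n ^ 3 * t := by
        have h5 := hC.pow_le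
        have h6 : 1 * (a * a) ≤ 24 * (d * d * g) * (a * a) := by
          have := hC.d_pos
          have := hC.g_pos
          gcongr
          have : 0 < d * d * g := by positivity
          omega
        have := hC.le_t
        gcongr
        omega

theorem Choice.large (hC : Choice n d t g h a z) : (d + 1) * a * a ≤ t ∧ d ≤ t ∧ h < a ∧
    a ≤ t ∧ (d + 1) * z ≤ t ∧ 1536 ≤ t := by
  have hd := hC.d_pos
  have hg := hC.g_pos
  have ha := hC.eight_le
  have hdg : d ≤ d * d * g := by
    calc d = d * 1 * 1 := by ring
      _ ≤ d * d * g := by gcongr <;> omega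
  have haa : 8 * 8 ≤ a * a := Nat.mul_le_mul ha ha
  have haa' : a ≤ a * a := Nat.le_mul_self a
  have h1 : (d + 1) * (a * a) ≤ 24 * (d * d * g) * (a * a) := Nat.mul_le_mul_right _ (by omega)
  have h2 := hC.le_t
  have h3 : 24 * 1 * (a * a) ≤ 24 * (d * d * g) * (a * a) := by gcongr; omega
  have h4 : 24 * (d * d * g) * 64 ≤ 24 * (d * d * g) * (a * a) := Nat.mul_le_mul_left _ haa
  have h5 := hC.sq_mul_z_le
  have h6 : (d + 1) * z ≤ (d + 1) * (d + 1) * z := by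
    gcongr
    exact Nat.le_mul_self _
  refine ⟨by rw [mul_assoc]; omega, by omega, ?_, by omega, by omega, by omega⟩
  rw [hC.a_eq]
  exact Nat.lt_two_pow_self

/-- The numbers that the programs produce are small multiples of N^4 at most, with N = n + t. The
tenth power absorbs the constants. -/
theorem word_bound {N : ℕ} (hN : 100 ≤ N) :
    100 * N ^ 4 ≤ N ^ 10 ∧ N ≤ N ^ 4 ∧ N * N ≤ N ^ 4 := by
  refine ⟨?_, ?_, ?_⟩
  · calc 100 * N ^ 4 ≤ N ^ 6 * N ^ 4 := by
          gcongr
          exact hN.trans (Nat.le_self_pow (by norm_num) N)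
      _ = N ^ 10 := by ring
  · exact Nat.le_self_pow (by norm_num) N
  · rw [← sq]
    exact Nat.pow_le_pow_right (by omega) (by norm_num)

theorem Choice.listProg_wp (hC : Choice n d t g h a z) (hq : Alphabet n d a q)
    (hs : Ready n d t s) (h3 : s.reg 3 = (d + 1) * z) (h4 : s.reg 4 = q) (h5 : s.reg 5 = a)
    (h6 : s.reg 6 = u) (hu : u ≤ t) :
    Wp ((n + t) ^ 10) listProg
      (500 * (n * ((d + 1) * z)) + 6 * (n * ((u - (d + 1) * z * q) / d))) s fun s' =>
      s'.out = listing n d ((d + 1) * z) q a u := by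
  obtain ⟨-, hdt, -, -, hmt, ht⟩ := hC.large
  obtain ⟨w1, w2, w3⟩ := word_bound (N := n + t) (by omega)
  have hqn := (hC.alphabet_le hq).1
  have hlm := hC.length_mul_le hq
  have hlt := hC.le_t
  have hapow := hC.pow_z_le
  have e1 : n * ((d + 1) * z) ≤ (n + t) * (n + t) := Nat.mul_le_mul (by omega) (by omega)
  have e2 : n * q ≤ (n + t) * (n + t) := Nat.mul_le_mul (by omega) (by omega)
  have e3 : (d + 1) * z * q ≤ (n + t) * (n + t) := Nat.mul_le_mul (by omega) (by omega)
  have e4 : 8 * n ^ 3 * t ≤ 8 * (n + t) ^ 4 := by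
    calc 8 * n ^ 3 * t ≤ 8 * (n + t) ^ 3 * (n + t) := by gcongr <;> omega
      _ = 8 * (n + t) ^ 4 := by ring
  exact GroupTesting.listProg_wp hs h3 h4 h5 h6 (hC.params hq) (by omega) (by omega) (by omega)
    (by omega) (by omega)

theorem Choice.paramProg_wp (hC : Choice n d t g h a z) (hs : Ready n d t s)
    (h17 : s.reg 17 = g) (h18 : s.reg 18 = h) (h5 : s.reg 5 = a) :
    Wp ((n + t) ^ 10) paramProg (16 * ((d + 1) * n) + 13) s fun s' =>
      s'.reg 3 = (d + 1) * z ∧ Alphabet n d a (s'.reg 4) ∧ s'.reg 5 = a ∧ Ready n d t s' := by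
  obtain ⟨hda, hdt, hha, hat, hmt, ht⟩ := hC.large
  obtain ⟨w1, w2, w3⟩ := word_bound (N := n + t) (by omega)
  have hg := hC.g_lt
  have ha := hC.eight_le
  have hn := hC.two_le
  exact GroupTesting.paramProg_wp hs h17 h18 h5 hC.z_eq.symm (by omega) (by omega) (by omega)

/-- The program for the regime with many positive answers. -/
def program₁ : Prog :=
  .const 7 1 ;; .const 16 2 ;; logProg 16 0 ;; .op .add 17 20 9 ;; .const 18 3 ;; .const 5 8 ;;
    paramProg ;; .op .add 6 2 9 ;; listProg

theorem ready_initial (n d t : ℕ) : Ready n d t ((initial n d t).set 7 1) := by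
  constructor <;> simp [initial]

theorem Choice.program₁_wp (hC : Choice n d t g 3 8 z) :
    Wp ((n + t) ^ 10) program₁ (600 * (n * ((d + 1) * z)) + 6 * (n * (t / d))) (initial n d t)
      fun s' => ∃ q, Alphabet n d 8 q ∧ s'.out = listing n d ((d + 1) * z) q 8 t := by
  obtain ⟨hda, hdt, hha, hat, hmt, ht⟩ := hC.large
  obtain ⟨w1, w2, w3⟩ := word_bound (N := n + t) (by omega)
  have hn := hC.two_le
  have hd := hC.d_pos
  have hz : 0 < z := by rw [hC.z_eq]; exact Nat.succ_pos _
  have hgn := hC.g_lt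
  refine Wp.le (T := ((7 * g + 7) + (((16 * ((d + 1) * n) + 13) +
    ((500 * (n * ((d + 1) * z)) + 6 * (n * (t / d))) + 1)) + 1 + 1 + 1)) + 1 + 1) ?_ ?_
  · refine Wp.const_seq (by omega) (Wp.const_seq (by omega) ?_)
    have hr := ready_initial n d t
    refine Wp.seq (hC.g_eq ▸ logProg_wp (B := 2) (X := n) (by norm_num) (by norm_num) (by simp)
      (by simp) (by simp [initial]) le_rfl (by omega) (by omega)) ?_
    rintro s₁ ⟨r20, -, m1, o1, A1⟩
    have hr1 : Ready n d t s₁ := hr.of_eq (fun x hx => by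
      rw [A1 x (by omega)]
      simp [show x ≠ 16 by omega]) m1 o1
    refine Wp.op_seq (by simp [Op.eval, r20, hr1.r9]; omega) ?_
    refine Wp.const_seq (by omega) (Wp.const_seq (by omega) ?_)
    refine (hC.paramProg_wp ?_ ?_ (by simp) (by simp)).seq ?_
    · refine hr1.of_eq (fun x hx => ?_) rfl rfl
      simp [show x ≠ 5 by omega, show x ≠ 17 by omega, show x ≠ 18 by omega]
    · simp [Op.eval, r20, hr1.r9]
    rintro s₂ ⟨k3, k4, k5, hr2⟩
    refine Wp.op_seq (by simp [Op.eval, hr2.r2, hr2.r9]; omega) ?_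
    refine (hC.listProg_wp (q := s₂.reg 4) (u := t) k4 ?_ (by simpa using k3) (by simp)
      (by simpa using k5) (by simp [Op.eval, hr2.r2, hr2.r9]) le_rfl).mono ?_
      fun s' hs' => ⟨_, k4, hs'⟩
    · refine hr2.of_eq (fun x hx => ?_) rfl rfl
      simp [show x ≠ 6 by omega]
    · have := Nat.div_le_div_right (c := d) (Nat.sub_le t ((d + 1) * z * s₂.reg 4))
      gcongr
  · have e1 : (d + 1) * n ≤ n * ((d + 1) * z) := by
      rw [mul_left_comm, ← mul_assoc]
      exact Nat.le_mul_of_pos_right _ hz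
    have e2 : 2 * n ≤ (d + 1) * n := Nat.mul_le_mul_right _ (by omega)
    omega

theorem Choice.exists_strategy₁ (hC : Choice n d t g 3 8 z) (ht : 6144 * (d * d * g) ≤ t) :
    ∃ (T : Strategy n t) (τ : ℕ), Finds d T ∧ Constructs ((n + t) ^ 10) program₁ d T τ ∧
      3 * t ≤ 4 * maxYes d T ∧ n * ((d + 1) * z) ≤ τ ∧
      τ ≤ 600 * (n * ((d + 1) * z)) + 6 * (n * (t / d)) := by
  obtain ⟨s, τ, he, hτ, q, hq, ho⟩ := hC.program₁_wp
  have hP := hC.params hq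
  have hq0 : 0 < q := by have := hP.two_le; omega
  have hlm := hC.length_mul_le hq
  -- The factor 6144 is 4 · 24 · 8². It leaves at least three quarters of the tests for private use.
  have h4 : 4 * ((d + 1) * z * q) ≤ t := by nlinarith
  have hmq : (d + 1) * z * q ≤ t := by omega
  refine ⟨tableStrategy n t (code q 8 (Nat.clog q n)) d ((d + 1) * z) q t, τ,
    finds_tableStrategy hP.m_pos (code_lt hq0 _) hmq hP.separated, ⟨s, he, ?_⟩, ?_, ?_, hτ⟩
  · rw [ho]
    exact lists_tableStrategy hC.d_pos (code_lt hq0 _) hmq le_rfl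
  · have := le_maxYes_private (t := t) (c := code q 8 (Nat.clog q n)) (m := (d + 1) * z) (q := q)
      hC.d_pos hC.d_le
    omega
  · have h1 := he.length_out_le
    rw [ho] at h1
    exact (le_length_listing ..).trans (by simpa [initial] using h1)

/-- The parameters of the repetition code, from `log_n t` in register `20`. -/
def repetitionProg : Prog :=
  .op .div 3 1 20 ;; .op .add 3 3 7 ;; .op .add 4 0 9 ;; .const 5 1

/-- The parameters for a number of tests that is polynomial in `n`. -/
def ratioProg : Prog :=
  .const 16 2 ;; logProg 16 0 ;; .op .add 17 20 9 ;; .op .mul 16 1 1 ;; .op .mul 16 16 17 ;;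
    .const 18 24 ;; .op .mul 16 16 18 ;; .op .div 16 2 16 ;; .const 18 4 ;; logProg 18 16 ;;
    .op .add 18 20 9 ;; .op .add 5 22 9 ;; paramProg

/-- The program for the regime with few positive answers. -/
def program₂ : Prog :=
  .const 7 1 ;; logProg 0 2 ;; .const 19 3 ;; .op .sub 19 20 19 ;;
    .branch 19 repetitionProg ratioProg ;; .op .mul 6 3 4 ;; listProg

/-- The truncated difference of log_n t and 3 is nonzero exactly if t ≥ n^4, so it selects the
branch. `R` describes the parameters handed over to the common listing. -/
theorem program₂_wp {T₁ T₂ : ℕ} {R : State → Prop} {Q : State → Prop} (hn : 2 ≤ n) (ht : 100 ≤ t)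
    (h₁ : ∀ s, Ready n d t s → s.reg 20 = Nat.log n t → 3 < Nat.log n t →
      Wp ((n + t) ^ 10) repetitionProg T₁ s R)
    (h₂ : ∀ s, Ready n d t s → Nat.log n t ≤ 3 → Wp ((n + t) ^ 10) ratioProg T₁ s R)
    (h₃ : ∀ s, R s → Wp ((n + t) ^ 10) (.op .mul 6 3 4 ;; listProg) T₂ s Q) :
    Wp ((n + t) ^ 10) program₂ (7 * Nat.log n t + 11 + T₁ + T₂) (initial n d t) Q := by
  obtain ⟨w1, w2, w3⟩ := word_bound (N := n + t) (by omega)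
  have hr := ready_initial n d t
  have htn : t * n ≤ (n + t) * (n + t) := Nat.mul_le_mul (by omega) (by omega)
  have hlog : Nat.log n t ≤ t := Nat.log_le_self n t
  refine Wp.le (T := ((7 * Nat.log n t + 7) + (((T₁ + 1) + T₂) + 1 + 1)) + 1) ?_ (by omega)
  refine Wp.const_seq (by omega) ?_
  refine (logProg_wp (B := n) (X := t) (by norm_num) (by norm_num) (by simp)
      (by simp [initial]) (by simp [initial]) hn (by omega) (by omega)).seq ?_
  rintro s₁ ⟨r20, -, m1, o1, A1⟩
  have hr1 : Ready n d t s₁ := hr.of_eq (fun x hx => A1 x (by omega)) m1 o1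
  refine Wp.const_seq (by omega) ?_
  refine Wp.op_seq (by simp [Op.eval, r20]; omega) ?_
  have hr2 : Ready n d t ((s₁.set 19 3).set 19 (Nat.log n t - 3)) :=
    hr1.of_eq (fun x hx => by simp [show x ≠ 19 by omega]) rfl rfl
  simp only [Op.eval, Function.update_self, ne_eq, show ¬ (20 = 19) by norm_num,
    not_false_eq_true, Function.update_of_ne, r20]
  refine (Wp.branch (fun h => h₁ _ hr2 ?_ ?_) (fun h => h₂ _ hr2 ?_)).seq h₃
  · simpa using r20
  · simp at h
    omega
  · simp at h
    omega

/-! ### The second program with at least n^4 tests -/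

theorem repetition_params (hn : 2 ≤ n) (hd : 0 < d) :
    Params n d (d / Nat.log n t + 1) n 1 0 :=
  -- The values a = 1 and z = 0 are dummies: for q = n the code does not depend on a good choice of
  -- them.
  ⟨hd, Nat.succ_pos _, hn, le_rfl, one_pos, Or.inl rfl⟩

theorem pow_four_le (hn : 2 ≤ n) (hs : 3 < Nat.log n t) : n ^ 4 ≤ t := by
  refine (Nat.le_log_iff_pow_le (by omega) ?_).1 hs
  rintro rfl
  simp at hs

theorem repetition_length_le (hd : 0 < d) (hs : 3 < Nat.log n t) :
    d / Nat.log n t + 1 ≤ d := by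
  have h1 : d / Nat.log n t ≤ d / 4 := Nat.div_le_div_left hs (by norm_num)
  omega

theorem two_mul_le_pow_four (hn : 2 ≤ n) (hdn : d ≤ n) :
    2 * (d + 1) * d ≤ n ^ 4 ∧ d * (2 * n) ≤ n ^ 4 := by
  have h1 : 4 * n ^ 2 ≤ n ^ 4 := by
    calc 4 * n ^ 2 = 2 ^ 2 * n ^ 2 := by ring
      _ ≤ n ^ 2 * n ^ 2 := by gcongr
      _ = n ^ 4 := by ring
  constructor <;> nlinarith

theorem program₂_repetition_wp (hn : 2 ≤ n) (hd : 0 < d) (hdn : d ≤ n)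
    (hs : 3 < Nat.log n t) (ht : 100 ≤ t) :
    Wp ((n + t) ^ 10) program₂ (600 * (n * (d / Nat.log n t + 1)) + 7 * Nat.log n t)
      (initial n d t) fun s' =>
        s'.out = listing n d (d / Nat.log n t + 1) n 1 ((d / Nat.log n t + 1) * n) := by
  obtain ⟨w1, w2, w3⟩ := word_bound (N := n + t) (by omega)
  have h4 := pow_four_le hn hs
  have hm := repetition_length_le hd hs
  have hdn' := two_mul_le_pow_four hn hdn
  have hP := repetition_params (t := t) hn hd
  have hdiv := Nat.div_le_self d (Nat.log n t)
  have hnm : n ≤ n * (d / Nat.log n t + 1) := Nat.le_mul_of_pos_right _ (Nat.succ_pos _)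
  have h5 : (d / Nat.log n t + 1) * n ≤ d * n := Nat.mul_le_mul_right _ hm
  have h6 : d * n ≤ (n + t) * (n + t) := Nat.mul_le_mul (by omega) (by omega)
  have h7 : n * n ≤ (n + t) * (n + t) := Nat.mul_le_mul (by omega) (by omega)
  have h8 : d * (2 * n) = 2 * (d * n) := by ring
  have h9 : n * (d / Nat.log n t + 1) = (d / Nat.log n t + 1) * n := mul_comm _ _
  refine Wp.le (program₂_wp (T₁ := 4) (R := fun s => s.reg 3 = d / Nat.log n t + 1 ∧
    s.reg 4 = n ∧ s.reg 5 = 1 ∧ Ready n d t s)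
    (T₂ := 500 * (n * (d / Nat.log n t + 1)) + 1) hn ht ?_ ?_ ?_) (by omega)
  · intro s hr h20 _
    refine Wp.op_seq (T := 3) (by simp [Op.eval, hr.r1, h20]; omega) ?_
    refine Wp.op_seq (by simp [Op.eval, hr.r1, h20, hr.r7]; omega) ?_
    refine Wp.op_seq (by simp [Op.eval, hr.r0, hr.r9]; omega) ?_
    refine Wp.const (by omega) ⟨?_, ?_, by simp, ?_⟩
    · simp [Op.eval, hr.r1, h20, hr.r7]
    · simp [Op.eval, hr.r0, hr.r9]
    · refine hr.of_eq (fun x hx => ?_) rfl rfl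
      simp [show x ≠ 3 by omega, show x ≠ 4 by omega, show x ≠ 5 by omega]
  · intro s _ h
    omega
  · rintro s ⟨k3, k4, k5, hr⟩
    refine Wp.op_seq (by simp [Op.eval, k3, k4]; omega) ?_
    refine (listProg_wp (t := t) (q := n) ?_ (by simpa using k3) (by simpa using k4) (by simpa using k5)
      (by simp [Op.eval, k3, k4]) hP (by omega) (by omega) (by omega) (by omega)
      (by simp; omega)).le (by simp)
    exact hr.of_eq (fun x hx => by simp [show x ≠ 6 by omega]) rfl rfl

/-! ### The second program with fewer than n^4 tests -/

theorem program₂_ratio_wp (hC : Choice n d t g h a z)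
    (hh : h = Nat.log 4 (t / (24 * (d * d * g)))) (hs : Nat.log n t ≤ 3) (hg : h ≤ 2 * g + 1) :
    Wp ((n + t) ^ 10) program₂ (600 * (n * ((d + 1) * z))) (initial n d t) fun s' =>
      ∃ q, Alphabet n d a q ∧
        s'.out = listing n d ((d + 1) * z) q a ((d + 1) * z * q) := by
  obtain ⟨hda, hdt, hha, hat, hmt, ht⟩ := hC.large
  obtain ⟨w1, w2, w3⟩ := word_bound (N := n + t) (by omega)
  have hn := hC.two_le
  have hd := hC.d_pos
  have hz : 0 < z := by rw [hC.z_eq]; exact Nat.succ_pos _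
  have hgn := hC.g_lt
  have hg0 := hC.g_pos
  have ha8 := hC.eight_le
  have hbt : 24 * (d * d * g) ≤ t :=
    (Nat.le_mul_of_pos_right _ (by positivity)).trans hC.le_t
  have hX : t / (24 * (d * d * g)) ≤ t := Nat.div_le_self _ _
  have hX0 : t / (24 * (d * d * g)) ≠ 0 := (Nat.div_pos hbt (by positivity)).ne'
  have hdd : d * d ≤ d * d * g := Nat.le_mul_of_pos_right _ hg0
  have e1 : (d + 1) * n ≤ n * ((d + 1) * z) := by
    rw [mul_left_comm, ← mul_assoc]
    exact Nat.le_mul_of_pos_right _ hz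
  have e2 : 2 * n ≤ (d + 1) * n := Nat.mul_le_mul_right _ (by omega)
  refine Wp.le (program₂_wp (T₁ := 16 * ((d + 1) * n) + 7 * g + 7 * h + 40)
    (R := fun s => s.reg 3 = (d + 1) * z ∧ Alphabet n d a (s.reg 4) ∧ s.reg 5 = a ∧
      Ready n d t s)
    (T₂ := 500 * (n * ((d + 1) * z)) + 1) hn (by omega) ?_ ?_ ?_) (by omega)
  · intro s _ _ h
    omega
  · intro s hr _
    refine Wp.le (T := ((7 * g + 7) + (((7 * h + 7) + ((16 * ((d + 1) * n) + 13) + 1 + 1)) +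
      1 + 1 + 1 + 1 + 1 + 1 + 1)) + 1) ?_ (by omega)
    refine Wp.const_seq (by omega) ?_
    refine Wp.seq (hC.g_eq ▸ logProg_wp (B := 2) (X := n) (by norm_num) (by norm_num)
      (by simpa using hr.r7) (by simp) (by simpa using hr.r0) le_rfl (by omega) (by omega)) ?_
    rintro s₁ ⟨r20, -, m1, o1, A1⟩
    have hr1 : Ready n d t s₁ := hr.of_eq (fun x hx => by
      rw [A1 x (by omega)]
      simp [show x ≠ 16 by omega]) m1 o1
    refine Wp.op_seq (by simp [Op.eval, r20, hr1.r9]; omega) ?_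
    refine Wp.op_seq (by simp [Op.eval, hr1.r1]; omega) ?_
    refine Wp.op_seq (by simp [Op.eval, hr1.r1, hr1.r9, r20]; omega) ?_
    refine Wp.const_seq (by omega) ?_
    refine Wp.op_seq (by simp [Op.eval, hr1.r1, hr1.r9, r20]; omega) ?_
    refine Wp.op_seq (by
      simp [Op.eval, hr1.r1, hr1.r2, hr1.r9, r20, mul_comm _ 24]; omega) ?_
    refine Wp.const_seq (by omega) ?_
    -- The base 4 makes a = 2^h, delivered in register `22`, the square root of the largest power of
    -- 4 that is at most t/(24d²g).
    refine Wp.seq (logProg_wp (B := 4) (X := t / (24 * (d * d * g))) (by norm_num)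
      (by norm_num) (by simpa using hr1.r7) (by simp)
      (by simp [Op.eval, hr1.r1, hr1.r2, hr1.r9, r20, mul_comm _ 24])
      (by norm_num) hX0 (by omega)) ?_ |>.le (by rw [hh])
    rintro s₂ ⟨l20, l22, m2, o2, A2⟩
    rw [← hh] at l20 l22
    rw [← hC.a_eq] at l22
    have hr2 : Ready n d t s₂ := hr1.of_eq (fun x hx => by
      rw [A2 x (by omega)]
      simp [show x ≠ 16 by omega, show x ≠ 17 by omega, show x ≠ 18 by omega]) m2 o2
    have l17 : s₂.reg 17 = g := by
      rw [A2 17 (by norm_num)]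
      simp [Op.eval, r20, hr1.r9]
    refine Wp.op_seq (by simp [Op.eval, l20, hr2.r9]; omega) ?_
    refine Wp.op_seq (by simp [Op.eval, l22, hr2.r9]; omega) ?_
    refine hC.paramProg_wp ?_ (by simpa using l17) (by simp [Op.eval, l20, hr2.r9])
      (by simp [Op.eval, l22, hr2.r9])
    refine hr2.of_eq (fun x hx => ?_) rfl rfl
    simp [show x ≠ 5 by omega, show x ≠ 18 by omega]
  · rintro s ⟨k3, k4, k5, hr⟩
    have hlm := hC.length_mul_le k4
    have hlt := hC.le_t
    have hmq : (d + 1) * z * (2 * s.reg 4) = 2 * ((d + 1) * z * s.reg 4) := by ring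
    refine Wp.op_seq (by simp [Op.eval, k3]; omega) ?_
    refine (hC.listProg_wp (q := s.reg 4) (u := (d + 1) * z * s.reg 4) k4 ?_ (by simpa using k3)
      (by simp) (by simpa using k5) (by simp [Op.eval, k3]) (by omega)).mono (by simp)
      fun s' hs' => ⟨_, k4, hs'⟩
    exact hr.of_eq (fun x hx => by simp [show x ≠ 6 by omega]) rfl rfl

/-! ### The strategies listed by the second program -/

theorem Params.exists_strategy (hP : Params n d m q a z) (hdn : d ≤ n) (hmq : m * q ≤ t)
    (ht : q = n → m * (2 * n) ≤ t) {p : Prog} {s : State} {τ : ℕ}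
    (he : Exec W p (initial n d t) s τ) (ho : s.out = listing n d m q a (m * q)) :
    ∃ T : Strategy n t, Finds d T ∧ Constructs W p d T τ ∧
      BuiltFromLinearCode (family T) ((d : ℝ) / (d + 1)) ∧ d * m ≤ 2 * maxYes d T ∧
      maxYes d T ≤ d * m ∧ n * m ≤ τ := by
  have hq0 : 0 < q := by have := hP.two_le; omega
  have hc := code_lt (a := a) hq0 (Nat.clog q n)
  refine ⟨tableStrategy n t (code q a (Nat.clog q n)) d m q (m * q),
    finds_tableStrategy hP.m_pos hc hmq hP.separated, ⟨s, he, ?_⟩,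
    hP.builtFromLinearCode hmq ht, le_maxYes_code hP.d_pos hdn hc hmq hP.separated,
    maxYes_code_le hP.d_pos hc hmq, ?_⟩
  · rw [ho]
    exact lists_tableStrategy hP.d_pos hc hmq hmq
  · have h1 := he.length_out_le
    rw [ho] at h1
    exact (le_length_listing ..).trans (by simpa [initial] using h1)

/-- The strategy for a number of tests that is at least `n ^ 4`. -/
theorem exists_strategy_repetition (hn : 2 ≤ n) (hd : 0 < d) (hdn : d ≤ n)
    (hs : 3 < Nat.log n t) (ht : 100 ≤ t) :
    ∃ (T : Strategy n t) (τ : ℕ), Finds d T ∧ Constructs ((n + t) ^ 10) program₂ d T τ ∧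
      BuiltFromLinearCode (family T) ((d : ℝ) / (d + 1)) ∧
      d * (d / Nat.log n t + 1) ≤ 2 * maxYes d T ∧ maxYes d T ≤ d * (d / Nat.log n t + 1) ∧
      n * (d / Nat.log n t + 1) ≤ τ ∧
      τ ≤ 600 * (n * (d / Nat.log n t + 1)) + 7 * Nat.log n t := by
  obtain ⟨s, τ, he, hτ, ho⟩ := program₂_repetition_wp hn hd hdn hs ht
  have h1 := pow_four_le hn hs
  have h2 := (two_mul_le_pow_four hn hdn).2
  have h3 := repetition_length_le hd hs
  have h4 : (d / Nat.log n t + 1) * (2 * n) ≤ d * (2 * n) := Nat.mul_le_mul_right _ h3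
  have h5 : (d / Nat.log n t + 1) * (2 * n) = 2 * ((d / Nat.log n t + 1) * n) := by ring
  obtain ⟨T, g1, g2, g3, g4, g5, g6⟩ := (repetition_params hn hd).exists_strategy hdn
    (by omega) (fun _ => by omega) he ho
  exact ⟨T, τ, g1, g2, g3, g4, g5, g6, hτ⟩

/-- The strategy for a number of tests that is below `n ^ 4`. -/
theorem exists_strategy_ratio (hn : 2 ≤ n) (hd : 0 < d) (hdn : d ≤ n) (hs : Nat.log n t ≤ 3)
    (ht : 6144 * (d * d * Nat.log 2 n) ≤ t) :
    ∃ (h a z : ℕ) (T : Strategy n t) (τ : ℕ), Choice n d t (Nat.log 2 n) h a z ∧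
      h ≤ 2 * Nat.log 2 n + 1 ∧ t < 96 * (d * d * Nat.log 2 n) * (a * a) ∧
      Finds d T ∧ Constructs ((n + t) ^ 10) program₂ d T τ ∧
      BuiltFromLinearCode (family T) ((d : ℝ) / (d + 1)) ∧
      d * ((d + 1) * z) ≤ 2 * maxYes d T ∧ maxYes d T ≤ d * ((d + 1) * z) ∧
      n * ((d + 1) * z) ≤ τ ∧ τ ≤ 600 * (n * ((d + 1) * z)) := by
  have hg0 : 0 < Nat.log 2 n := Nat.log_pos Nat.one_lt_two hn
  have hb : 0 < 24 * (d * d * Nat.log 2 n) := by positivity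
  set h := Nat.log 4 (t / (24 * (d * d * Nat.log 2 n))) with hh
  have h64 : 4 ^ 3 ≤ t / (24 * (d * d * Nat.log 2 n)) := by
    rw [Nat.le_div_iff_mul_le hb]
    omega
  have hX0 : t / (24 * (d * d * Nat.log 2 n)) ≠ 0 := by omega
  have hh3 : 3 ≤ h := (Nat.le_log_iff_pow_le (by norm_num) hX0).2 h64
  have haa : 2 ^ h * 2 ^ h = 4 ^ h := by rw [← mul_pow]; norm_num
  have hle : 24 * (d * d * Nat.log 2 n) * (2 ^ h * 2 ^ h) ≤ t := by
    rw [haa, mul_comm]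
    exact (Nat.le_div_iff_mul_le hb).1 (Nat.pow_log_le_self 4 hX0)
  have hlt : t < 96 * (d * d * Nat.log 2 n) * (2 ^ h * 2 ^ h) := by
    have := (Nat.div_lt_iff_lt_mul hb).1
      (Nat.lt_pow_succ_log_self (b := 4) (by norm_num) (t / (24 * (d * d * Nat.log 2 n))))
    rw [← hh, Nat.succ_eq_add_one, pow_succ, ← haa] at this
    calc t < _ := this
      _ = _ := by ring
  have hC : Choice n d t (Nat.log 2 n) h (2 ^ h) ((Nat.log 2 n + 1) / (h - 2) + 1) :=
    ⟨hn, hd, hdn, rfl, hh3, rfl, rfl, hle⟩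
  have hhg : h ≤ 2 * Nat.log 2 n + 1 := by
    have h1 : t < n ^ 4 := by
      by_contra! hcon
      have := (Nat.le_log_iff_pow_le (b := n) (by omega) (by omega)).2 hcon
      omega
    -- From a² ≤ t < n^4 the exponent h is O(log n). This bounds the time for computing h and later
    -- the rounding error in h z.
    have h2 : (2 : ℕ) ^ (h + h) < 2 ^ (4 * (Nat.log 2 n + 1)) := by
      calc (2 : ℕ) ^ (h + h) = 2 ^ h * 2 ^ h := pow_add ..
        _ ≤ 24 * (d * d * Nat.log 2 n) * (2 ^ h * 2 ^ h) := Nat.le_mul_of_pos_left _ hb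
        _ < n ^ 4 := hle.trans_lt h1
        _ ≤ (2 ^ (Nat.log 2 n + 1)) ^ 4 := by
            have := hC.lt_pow
            gcongr
        _ = 2 ^ (4 * (Nat.log 2 n + 1)) := by rw [← pow_mul, mul_comm]
    have := (Nat.pow_lt_pow_iff_right (by norm_num)).1 h2
    omega
  obtain ⟨s, τ, he, hτ, q, hq, ho⟩ := program₂_ratio_wp hC hh hs hhg
  have hlm := hC.length_mul_le hq
  have h5 : ∀ m q : ℕ, m * (2 * q) = 2 * (m * q) := fun m q => by ring
  obtain ⟨T, g1, g2, g3, g4, g5, g6⟩ := (hC.params hq).exists_strategy (t := t) hdn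
    (by rw [h5] at hlm; omega) (fun hqn => by rw [hqn] at hlm; omega) he ho
  exact ⟨h, 2 ^ h, _, T, τ, hC, hhg, hlt, g1, g2, g3, g4, g5, g6, hτ⟩

end

/-! ## The asymptotic bounds -/

section

variable {n d t h a z : ℕ}

theorem log_le_mul_natLog (hn : 2 ≤ n) : Real.log n ≤ Nat.log 2 n + 1 := by
  have h1 : (n : ℝ) ≤ 2 ^ (Nat.log 2 n + 1) := by
    exact_mod_cast (Nat.lt_pow_succ_log_self (b := 2) (by norm_num) n).le
  have h2 := Real.log_le_log (by positivity) h1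
  rw [Real.log_pow] at h2
  push_cast at h2
  nlinarith [Real.log_two_lt_d9, Real.log_two_gt_d9]

theorem natLog_le_two_mul_log (hn : 2 ≤ n) : (Nat.log 2 n : ℝ) ≤ 2 * Real.log n := by
  have h1 : (2 : ℝ) ^ Nat.log 2 n ≤ n := by
    exact_mod_cast Nat.pow_log_le_self 2 (by omega)
  have h2 := Real.log_le_log (by positivity) h1
  rw [Real.log_pow] at h2
  nlinarith [Real.log_two_lt_d9, Real.log_two_gt_d9]

theorem one_le_natLog (hn : 2 ≤ n) : (1 : ℝ) ≤ Nat.log 2 n := by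
  exact_mod_cast Nat.log_pos Nat.one_lt_two hn

theorem half_lt_log (hn : 2 ≤ n) : (1 : ℝ) / 2 < Real.log n := by
  have : Real.log 2 ≤ Real.log n := Real.log_le_log (by norm_num) (by exact_mod_cast hn)
  linarith [Real.log_two_gt_d9]

/-- The asymptotic bounds of the regime with few positive answers, from bounds for the length `m`
of the code. -/
theorem asymptotic_bounds {n d t m Y τ L B : ℝ} (hB : 1 ≤ B) (hn : 0 < n) (hd : 1 ≤ d)
    (hL : 0 < L) (hm : 0 < m) (ht : 2 * (d + 1) * m ≤ t)
    (hupper : m * Real.log (t / (d * m)) ≤ B * (d * L))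
    (hlower : d * L ≤ B * (m * Real.log (t / (d * m))))
    (hratio : m * Real.log (t / (d ^ 2 * L)) ≤ B * (d * L))
    (hpos : 0 < Real.log (t / (d ^ 2 * L)))
    (hY : d * m ≤ 2 * Y) (hY' : Y ≤ d * m) (hτ : n * m ≤ τ) (hτ' : τ ≤ B * (n * m)) :
    Y < (t + 1) * d / (2 * (d + 1)) ∧
      1 / (2 * B) * (d ^ 2 * L / Real.log (t / Y)) ≤ Y ∧
      Y ≤ 2 * B ^ 2 * (d ^ 2 * L / Real.log (t / Y)) ∧
      Y ≤ 2 * B ^ 2 * (d ^ 2 * L / Real.log (t / (d ^ 2 * L))) ∧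
      1 / (2 * B) * (d * n * L / Real.log (t / Y)) ≤ τ ∧
      τ ≤ 2 * B ^ 2 * (d * n * L / Real.log (t / Y)) ∧
      τ ≤ 2 * B ^ 2 * (d * n * L / Real.log (t / (d ^ 2 * L))) := by
  have hd0 : 0 < d := by linarith
  have hdm : 0 < d * m := by positivity
  have hYpos : 0 < Y := by linarith
  have ht0 : 0 < t := lt_of_lt_of_le (by positivity) ht
  have hB0 : 0 < B := by linarith
  have h2 : 2 ≤ t / (d * m) := by
    rw [le_div_iff₀ hdm]
    nlinarith
  set l := Real.log (t / (d * m)) with hl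
  set lY := Real.log (t / Y) with hlY
  have hl2 : Real.log 2 ≤ l := Real.log_le_log (by norm_num) h2
  have hl0 : 0 < l := lt_of_lt_of_le (Real.log_pos (by norm_num)) hl2
  have h3 : l ≤ lY := by
    refine Real.log_le_log (by positivity) ?_
    gcongr
  -- Replacing d m by Y ≥ dm/2 adds at most log 2 to the logarithm. This at most doubles it, because
  -- t/(dm) ≥ 2.
  have h4 : lY ≤ 2 * l := by
    have h5 : t / Y ≤ 2 * (t / (d * m)) := by
      rw [← mul_div_assoc, div_le_div_iff₀ hYpos hdm]
      nlinarith
    have h6 : lY ≤ Real.log 2 + l := by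
      rw [hl, ← Real.log_mul (by norm_num) (by positivity)]
      exact Real.log_le_log (by positivity) h5
    linarith
  have hlY0 : 0 < lY := hl0.trans_le h3
  have hmlY : m * lY ≤ 2 * B * (d * L) := by
    calc m * lY ≤ m * (2 * l) := by gcongr
      _ = 2 * (m * l) := by ring
      _ ≤ 2 * B * (d * L) := by linarith
  have hdL : d * L ≤ B * (m * lY) := hlower.trans (by gcongr)
  have hBB : B ≤ B ^ 2 := by nlinarith
  refine ⟨?_, ?_, ?_, ?_, ?_, ?_, ?_⟩
  · rw [lt_div_iff₀ (by positivity)]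
    nlinarith
  · rw [← mul_div_assoc, div_le_iff₀ hlY0, one_div, inv_mul_le_iff₀ (by positivity)]
    calc d ^ 2 * L = d * (d * L) := by ring
      _ ≤ d * (B * (m * lY)) := by gcongr
      _ = B * lY * (d * m) := by ring
      _ ≤ B * lY * (2 * Y) := by gcongr
      _ = 2 * B * (Y * lY) := by ring
  · rw [← mul_div_assoc, le_div_iff₀ hlY0]
    calc Y * lY ≤ d * m * lY := by gcongr
      _ = d * (m * lY) := by ring
      _ ≤ d * (2 * B * (d * L)) := by gcongr
      _ = 2 * B * (d ^ 2 * L) := by ring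
      _ ≤ 2 * B ^ 2 * (d ^ 2 * L) := by gcongr
  · rw [← mul_div_assoc, le_div_iff₀ hpos]
    calc Y * Real.log (t / (d ^ 2 * L)) ≤ d * m * Real.log (t / (d ^ 2 * L)) := by gcongr
      _ = d * (m * Real.log (t / (d ^ 2 * L))) := by ring
      _ ≤ d * (B * (d * L)) := by gcongr
      _ = B * (d ^ 2 * L) := by ring
      _ ≤ B ^ 2 * (d ^ 2 * L) := by gcongr
      _ ≤ 2 * B ^ 2 * (d ^ 2 * L) := by gcongr; nlinarith
  · rw [← mul_div_assoc, div_le_iff₀ hlY0, one_div, inv_mul_le_iff₀ (by positivity)]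
    calc d * n * L = n * (d * L) := by ring
      _ ≤ n * (B * (m * lY)) := by gcongr
      _ = B * lY * (n * m) := by ring
      _ ≤ B * lY * (2 * τ) := by
          have : n * m ≤ 2 * τ := by nlinarith [mul_pos hn hm]
          gcongr
      _ = 2 * B * (τ * lY) := by ring
  · rw [← mul_div_assoc, le_div_iff₀ hlY0]
    calc τ * lY ≤ B * (n * m) * lY := by gcongr
      _ = B * n * (m * lY) := by ring
      _ ≤ B * n * (2 * B * (d * L)) := by gcongr
      _ = 2 * B ^ 2 * (d * n * L) := by ring
  · rw [← mul_div_assoc, le_div_iff₀ hpos]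
    calc τ * Real.log (t / (d ^ 2 * L)) ≤ B * (n * m) * Real.log (t / (d ^ 2 * L)) := by gcongr
      _ = B * n * (m * Real.log (t / (d ^ 2 * L))) := by ring
      _ ≤ B * n * (B * (d * L)) := by gcongr
      _ = B ^ 2 * (d * n * L) := by ring
      _ ≤ 2 * B ^ 2 * (d * n * L) := by gcongr; nlinarith

/-- The bounds for the length of the repetition code. -/
theorem repetition_length_bounds {A : ℕ} (hn : 2 ≤ n) (hd : 0 < d) (hdn : d ≤ n)
    (hs : 3 < Nat.log n t) (htA : t ≤ n ^ (A * d)) {m : ℝ} (hm : m = (d / Nat.log n t + 1 : ℕ)) :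
    2 * ((d : ℝ) + 1) * m ≤ t ∧
      m * Real.log (t / (d * m)) ≤ (4 * A + 4) * (d * Real.log n) ∧
      d * Real.log n ≤ 2 * (m * Real.log (t / (d * m))) ∧
      m * Real.log (t / (d ^ 2 * Real.log n)) ≤ (4 * A + 4) * (d * Real.log n) ∧
      (Nat.log n t : ℝ) ≤ A * (n * m) := by
  have h4 := pow_four_le hn hs
  have ht0 : t ≠ 0 := by have : 0 < n ^ 4 := by positivity
                         omega
  have hmd := repetition_length_le hd hs
  have h2 := (two_mul_le_pow_four hn hdn).1
  have hst : n ^ Nat.log n t ≤ t := Nat.pow_log_le_self n ht0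
  have hst' : t < n ^ (Nat.log n t + 1) := Nat.lt_pow_succ_log_self (by omega) t
  -- Here the polynomial bound on t enters. With s = ⌊log_n t⌋ ≤ A d, the product of s and the
  -- length, which lies between d and d + s, has order d.
  have hsA : Nat.log n t ≤ A * d := by
    calc Nat.log n t ≤ Nat.log n (n ^ (A * d)) := Nat.log_mono_right htA
      _ = A * d := Nat.log_pow (by omega) _
  have hms : d ≤ Nat.log n t * (d / Nat.log n t + 1) :=
    (Nat.lt_mul_div_succ d (by omega)).le
  have hms' : Nat.log n t * (d / Nat.log n t + 1) ≤ d + Nat.log n t := by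
    have := Nat.mul_div_le d (Nat.log n t)
    rw [Nat.mul_add, mul_one]
    omega
  have hm1 : (1 : ℝ) ≤ m := by rw [hm]; exact_mod_cast Nat.succ_pos _
  generalize d / Nat.log n t + 1 = k at *
  generalize Nat.log n t = s at *
  have hd1 : (1 : ℝ) ≤ d := by exact_mod_cast hd
  have hL := half_lt_log hn
  have ht1 : (0 : ℝ) < t := by exact_mod_cast Nat.pos_of_ne_zero ht0
  have hn1 : (2 : ℝ) ≤ n := by exact_mod_cast hn
  have hs3 : (4 : ℝ) ≤ s := by exact_mod_cast hs
  have hsA' : (s : ℝ) ≤ A * d := by exact_mod_cast hsA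
  have hms1 : (d : ℝ) ≤ s * m := by rw [hm]; exact_mod_cast hms
  have hms2 : (s : ℝ) * m ≤ (1 + A) * d := by
    have : (s : ℝ) * m ≤ d + s := by rw [hm]; exact_mod_cast hms'
    linarith
  have hmd' : m ≤ d := by rw [hm]; exact_mod_cast hmd
  have hdn' : (d : ℝ) ≤ n := by exact_mod_cast hdn
  have hlt : s * Real.log n ≤ Real.log t := by
    rw [← Real.log_pow]
    exact Real.log_le_log (by positivity) (by exact_mod_cast hst)
  have hlt' : Real.log t ≤ 2 * s * Real.log n := by
    have : Real.log t ≤ ((s + 1 : ℕ) : ℝ) * Real.log n := by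
      rw [← Real.log_pow]
      exact Real.log_le_log ht1 (by exact_mod_cast hst'.le)
    push_cast at this
    nlinarith
  have hdm : 1 ≤ (d : ℝ) * m := by nlinarith
  refine ⟨?_, ?_, ?_, ?_, ?_⟩
  · have h5 : 2 * (d + 1) * k ≤ t :=
      ((Nat.mul_le_mul_left (2 * (d + 1)) hmd).trans h2).trans h4
    rw [hm]
    exact_mod_cast h5
  · have h5 : Real.log (t / (d * m)) ≤ Real.log t :=
      Real.log_le_log (by positivity) (div_le_self ht1.le hdm)
    calc m * Real.log (t / (d * m)) ≤ m * (2 * s * Real.log n) := by gcongr; linarith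
      _ = 2 * (s * m) * Real.log n := by ring
      _ ≤ 2 * ((1 + A) * d) * Real.log n := by gcongr
      _ = (2 * A + 2) * (d * Real.log n) := by ring
      _ ≤ (4 * A + 4) * (d * Real.log n) := by
          gcongr ?_ * (d * Real.log n)
          have : (0 : ℝ) ≤ A := Nat.cast_nonneg A
          linarith
  -- Dividing t by d m costs at most 2 log n. This is at most half of s log n ≤ log t, because s ≥
  -- 4.
  · have h5 : (d : ℝ) * m ≤ n ^ 2 := by nlinarith
    have h6 : Real.log t - 2 * Real.log n ≤ Real.log (t / (d * m)) := by
      rw [Real.log_div ht1.ne' (by positivity)]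
      have : Real.log (d * m) ≤ Real.log ((n : ℝ) ^ 2) := Real.log_le_log (by positivity) h5
      rw [Real.log_pow] at this
      push_cast at this
      linarith
    have h7 : s * Real.log n ≤ 2 * Real.log (t / (d * m)) := by nlinarith
    calc d * Real.log n ≤ s * m * Real.log n := by gcongr
      _ = m * (s * Real.log n) := by ring
      _ ≤ m * (2 * Real.log (t / (d * m))) := by gcongr
      _ = 2 * (m * Real.log (t / (d * m))) := by ring
  · have h5 : (t : ℝ) / (d ^ 2 * Real.log n) ≤ 2 * t := by
      rw [div_le_iff₀ (by positivity)]
      have : 1 / 2 ≤ (d : ℝ) ^ 2 * Real.log n := by nlinarith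
      nlinarith
    have h6 : Real.log (t / (d ^ 2 * Real.log n)) ≤ Real.log 2 + Real.log t := by
      rw [← Real.log_mul (by norm_num) ht1.ne']
      exact Real.log_le_log (by positivity) h5
    have h7 : Real.log 2 ≤ Real.log n := Real.log_le_log (by norm_num) hn1
    have h8 : Real.log (t / (d ^ 2 * Real.log n)) ≤ 4 * s * Real.log n := by nlinarith
    calc m * Real.log (t / (d ^ 2 * Real.log n)) ≤ m * (4 * s * Real.log n) := by gcongr
      _ = 4 * (s * m) * Real.log n := by ring
      _ ≤ 4 * ((1 + A) * d) * Real.log n := by gcongr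
      _ = (4 * A + 4) * (d * Real.log n) := by ring
  · calc (s : ℝ) ≤ A * d := hsA'
      _ ≤ A * (n * m) := by
          gcongr
          nlinarith

/-- Logarithms of numbers up to `192 * a ^ 3`, where `log a = h * log 2`. -/
theorem mul_log_le {a h m L x : ℝ} (ha : 8 ≤ a) (hh : 0 ≤ h) (hla : Real.log a = h * Real.log 2)
    (hm : 0 ≤ m) (hmh : m * h ≤ 36 * L) (hL : 0 ≤ L) (hx : 0 < x) (hxa : x ≤ 192 * a ^ 3) :
    m * Real.log x ≤ 300 * L := by
  have ha0 : 0 < a := by linarith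
  have ha3 : (192 : ℝ) ≤ a ^ 3 := by
    have : (8 : ℝ) ^ 3 ≤ a ^ 3 := pow_le_pow_left₀ (by norm_num) ha 3
    linarith
  have h1 : x ≤ a ^ 6 := by
    calc x ≤ 192 * a ^ 3 := hxa
      _ ≤ a ^ 3 * a ^ 3 := mul_le_mul_of_nonneg_right ha3 (by positivity)
      _ = a ^ 6 := by ring
  have h2 := Real.log_le_log hx h1
  rw [Real.log_pow, hla] at h2
  push_cast at h2
  have h4 : h * Real.log 2 ≤ h * 1 :=
    mul_le_mul_of_nonneg_left (by linarith [Real.log_two_lt_d9]) hh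
  have h3 : Real.log x ≤ 6 * h := by linarith
  calc m * Real.log x ≤ m * (6 * h) := mul_le_mul_of_nonneg_left h3 hm
    _ = 6 * (m * h) := by ring
    _ ≤ 300 * L := by linarith

/-- The logarithmic bounds for the length `(d + 1) * z` of a code, over the reals. -/
theorem log_length_bounds {d z h a g t l : ℝ} (hd : 1 ≤ d) (hz : 1 ≤ z) (ha : 8 ≤ a) (hh : 3 ≤ h)
    (hha : h ≤ a) (hl : 0 < l) (hg : 1 ≤ g) (hgl : g ≤ 2 * l) (hlg : l ≤ g + 1)
    (hla : Real.log a = h * Real.log 2) (hz3 : z ≤ 3 * g) (hzh : h * z ≤ 9 * g)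
    (hmz : g + 1 ≤ h * z) (hlt : 24 * (d * d * g) * (a * a) ≤ t)
    (hta : t ≤ 96 * (d * d * g) * (a * a)) :
    (d + 1) * z * Real.log (t / (d * ((d + 1) * z))) ≤ 300 * (d * l) ∧
      d * l ≤ (d + 1) * z * Real.log (t / (d * ((d + 1) * z))) ∧
      (d + 1) * z * Real.log (t / (d ^ 2 * l)) ≤ 300 * (d * l) := by
  have hmd : d * z ≤ (d + 1) * z := mul_le_mul_of_nonneg_right (by linarith) (by linarith)
  have hmd' : (d + 1) * z ≤ 2 * d * z := mul_le_mul_of_nonneg_right (by linarith) (by linarith)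
  have hm0 : 0 < (d + 1) * z := by positivity
  generalize (d + 1) * z = m at *
  have hd0 : 0 < d := by linarith
  have ha0 : 0 < a := by linarith
  have ht0 : 0 < t := lt_of_lt_of_le (by positivity) hlt
  have hmh : m * h ≤ 36 * (d * l) := by
    have h1 : m * h ≤ 2 * d * z * h := mul_le_mul_of_nonneg_right hmd' (by linarith)
    have h2 : d * (h * z) ≤ d * (18 * l) := mul_le_mul_of_nonneg_left (by linarith) hd0.le
    linarith
  have hdl : 0 ≤ d * l := by positivity
  have hbound : ∀ x : ℝ, 0 < x → x ≤ 192 * a ^ 3 → m * Real.log x ≤ 300 * (d * l) :=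
    fun x hx hxa => mul_log_le ha (by linarith) hla hm0.le hmh hdl hx hxa
  refine ⟨hbound _ (by positivity) ?_, ?_, hbound _ (by positivity) ?_⟩
  · rw [div_le_iff₀ (by positivity)]
    -- Since g < h z ≤ a z, the factor g in the upper bound for t is exchanged for a z, and d z is
    -- at most the length m. This is where the third power of a comes from.
    have h1 : h * z ≤ a * z := mul_le_mul_of_nonneg_right hha (by linarith)
    have h2 : g ≤ a * z := by linarith
    have h3 : d * d * g * (a * a) ≤ d * d * (a * z) * (a * a) :=
      mul_le_mul_of_nonneg_right (mul_le_mul_of_nonneg_left h2 (by positivity)) (by positivity)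
    have h4 : a ^ 3 * d * (d * z) ≤ a ^ 3 * d * m :=
      mul_le_mul_of_nonneg_left hmd (by positivity)
    have h5 : 0 ≤ a ^ 3 * d * m := by positivity
    linarith
  -- The length is at most 6 d g, well within the factor 24 in the lower bound for t. Then the
  -- logarithm is at least 2h log 2 ≥ h.
  · have h1 : a ^ 2 ≤ t / (d * m) := by
      rw [le_div_iff₀ (by positivity)]
      have h5 : d * z ≤ d * (3 * g) := mul_le_mul_of_nonneg_left hz3 hd0.le
      have h6 : a ^ 2 * d * m ≤ a ^ 2 * d * (6 * d * g) :=
        mul_le_mul_of_nonneg_left (by linarith) (by positivity)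
      have h7 : 0 ≤ d * d * g * (a * a) := by positivity
      linarith
    have h2 := Real.log_le_log (by positivity) h1
    rw [Real.log_pow, hla] at h2
    push_cast at h2
    have h4 : h * (1 / 2) ≤ h * Real.log 2 :=
      mul_le_mul_of_nonneg_left (by linarith [Real.log_two_gt_d9]) (by linarith)
    have h3 : h ≤ Real.log (t / (d * m)) := by linarith
    calc d * l ≤ d * (h * z) := mul_le_mul_of_nonneg_left (by linarith) hd0.le
      _ = d * z * h := by ring
      _ ≤ m * Real.log (t / (d * m)) := mul_le_mul hmd h3 (by linarith) hm0.le
  · rw [div_le_iff₀ (by positivity)]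
    have h1 : d * d * (a * a) * g ≤ d * d * (a * a) * (2 * l) :=
      mul_le_mul_of_nonneg_left hgl (by positivity)
    have h2 : a ^ 2 * (d ^ 2 * l) * 1 ≤ a ^ 2 * (d ^ 2 * l) * a :=
      mul_le_mul_of_nonneg_left (by linarith) (by positivity)
    linarith

/-- The bounds for the length of the greedy code. -/
theorem Choice.length_bounds (hC : Choice n d t (Nat.log 2 n) h a z)
    (hhg : h ≤ 2 * Nat.log 2 n + 1) (hta : t < 96 * (d * d * Nat.log 2 n) * (a * a)) {m : ℝ}
    (hm : m = ((d + 1) * z : ℕ)) :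
    2 * ((d : ℝ) + 1) * m ≤ t ∧
      m * Real.log (t / (d * m)) ≤ 300 * (d * Real.log n) ∧
      d * Real.log n ≤ m * Real.log (t / (d * m)) ∧
      m * Real.log (t / (d ^ 2 * Real.log n)) ≤ 300 * (d * Real.log n) := by
  have hn := hC.two_le
  have hh3 := hC.h_ge
  have hz0 : 0 < z := by rw [hC.z_eq]; exact Nat.succ_pos _
  -- The quotient contributes at most 3(g + 1) because h ≤ 3(h - 2), and the final + 1 in z
  -- contributes h ≤ 2g + 1.
  have hzh : h * z ≤ 9 * Nat.log 2 n := by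
    have h2 : h * ((Nat.log 2 n + 1) / (h - 2)) ≤
        3 * (h - 2) * ((Nat.log 2 n + 1) / (h - 2)) := Nat.mul_le_mul_right _ (by omega)
    have h3 := Nat.mul_div_le (Nat.log 2 n + 1) (h - 2)
    have h4 : h * z = h * ((Nat.log 2 n + 1) / (h - 2)) + h := by rw [hC.z_eq]; ring
    have h5 := hC.g_pos
    rw [mul_assoc] at h2
    omega
  have hmz : Nat.log 2 n + 1 ≤ h * z := hC.le_mul_z.trans (Nat.mul_le_mul_right _ (by omega))
  have hla : Real.log a = h * Real.log 2 := by
    rw [hC.a_eq]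
    push_cast
    rw [Real.log_pow]
  have hl := half_lt_log hn
  subst hm
  constructor
  · have h1 : 2 * (d + 1) * ((d + 1) * z) ≤ t := by
      have h2 := hC.sq_mul_z_le
      have h3 : 24 * (d * d * Nat.log 2 n) ≤ 24 * (d * d * Nat.log 2 n) * (a * a) :=
        Nat.le_mul_of_pos_right _ (by have := hC.eight_le; positivity)
      have h4 := hC.le_t
      have h5 : 2 * (d + 1) * ((d + 1) * z) = 2 * ((d + 1) * (d + 1) * z) := by ring
      omega
    exact_mod_cast h1
  · push_cast
    exact log_length_bounds (by exact_mod_cast hC.d_pos) (by exact_mod_cast hz0)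
      (by exact_mod_cast hC.eight_le) (by exact_mod_cast hh3)
      (by exact_mod_cast hC.large.2.2.1.le) (by linarith) (one_le_natLog hn)
      (natLog_le_two_mul_log hn) (by linarith [log_le_mul_natLog hn]) hla
      (by exact_mod_cast hC.z_le) (by exact_mod_cast hzh) (by exact_mod_cast hmz)
      (by exact_mod_cast hC.le_t) (by exact_mod_cast hta.le)

/-- The lower bound for the number of tests in terms of the binary logarithm. -/
theorem tests_ge (hn : 2 ≤ n)
    (ht : 12288 * ((d : ℝ) ^ 2 * Real.log n) ≤ t) : 6144 * (d * d * Nat.log 2 n) ≤ t := by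
  have h1 := natLog_le_two_mul_log hn
  have h2 : (6144 : ℝ) * (d * d * Nat.log 2 n) ≤ t := by
    calc (6144 : ℝ) * (d * d * Nat.log 2 n) ≤ 6144 * (d * d * (2 * Real.log n)) := by gcongr
      _ = 12288 * ((d : ℝ) ^ 2 * Real.log n) := by ring
      _ ≤ t := ht
  exact_mod_cast h2

/-! ### The two regimes -/

theorem large_regime (K : ℝ) : ∃ c C : ℝ, 0 < c ∧ 0 < C ∧
    ∀ n d t : ℕ, 2 ≤ n → 1 ≤ d → d ≤ n →
      12288 * ((d : ℝ) ^ 2 * Real.log n) ≤ (t : ℝ) →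
      (t : ℝ) ≤ K * ((d : ℝ) ^ 2 * Real.log n) →
      ∃ (T : Strategy n t) (τ : ℕ),
        Finds d T ∧
        Constructs ((n + t) ^ 10) program₁ d T τ ∧
        ((t : ℝ) + 1) * d / (2 * ((d : ℝ) + 1)) ≤ (maxYes d T : ℝ) ∧
        c * ((d : ℝ) ^ 2 * Real.log n) ≤ (maxYes d T : ℝ) ∧
        (maxYes d T : ℝ) ≤ C * ((d : ℝ) ^ 2 * Real.log n) ∧
        c * ((d : ℝ) * n * Real.log n) ≤ (τ : ℝ) ∧
        (τ : ℝ) ≤ C * ((d : ℝ) * n * Real.log n) := by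
  refine ⟨1 / 2, 7200 + 6 * |K|, by norm_num, by positivity, ?_⟩
  intro n d t hn hd hdn ht htK
  have ht' := tests_ge hn ht
  have hg0 : 0 < Nat.log 2 n := Nat.log_pos Nat.one_lt_two hn
  have hC : Choice n d t (Nat.log 2 n) 3 8 (Nat.log 2 n + 2) :=
    ⟨hn, hd, hdn, rfl, le_rfl, by norm_num, by simp, by omega⟩
  obtain ⟨T, τ, h1, h2, h3, h4, h5⟩ := hC.exists_strategy₁ ht'
  have hL := half_lt_log hn
  have hLg := log_le_mul_natLog hn
  have hgL := natLog_le_two_mul_log hn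
  have hg1 := one_le_natLog hn
  have hd1 : (1 : ℝ) ≤ d := by exact_mod_cast hd
  have hn1 : (2 : ℝ) ≤ n := by exact_mod_cast hn
  have hY : 3 * (t : ℝ) ≤ 4 * maxYes d T := by exact_mod_cast h3
  have hY' : (maxYes d T : ℝ) ≤ t := by exact_mod_cast maxYes_le_tests T
  have hτ : (n : ℝ) * ((d + 1) * (Nat.log 2 n + 2)) ≤ τ := by exact_mod_cast h4
  have hτ' : (τ : ℝ) ≤ 600 * (n * ((d + 1) * (Nat.log 2 n + 2))) + 6 * (n * ((t / d : ℕ) : ℝ)) := by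
    exact_mod_cast h5
  have hdiv : ((t / d : ℕ) : ℝ) ≤ t / d := Nat.cast_div_le
  have hD : 0 < (d : ℝ) ^ 2 * Real.log n := by positivity
  have ht2 : (2 : ℝ) ≤ t := by nlinarith
  have hK : K ≤ |K| := le_abs_self K
  refine ⟨T, τ, h1, h2, ?_, ?_, ?_, ?_, ?_⟩
  -- The right-hand side is at least 3t/4, and this exceeds (t+1)/2 as soon as t ≥ 2.
  · rw [div_le_iff₀ (by positivity)]
    nlinarith
  · linarith
  · calc (maxYes d T : ℝ) ≤ K * ((d : ℝ) ^ 2 * Real.log n) := hY'.trans htK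
      _ ≤ (7200 + 6 * |K|) * ((d : ℝ) ^ 2 * Real.log n) := by
          gcongr
          linarith [abs_nonneg K]
  · refine le_trans ?_ hτ
    calc 1 / 2 * ((d : ℝ) * n * Real.log n) = n * (d * (1 / 2 * Real.log n)) := by ring
      _ ≤ n * ((d + 1) * (Nat.log 2 n + 2)) := by gcongr <;> linarith
  -- The time bound charges every item for t/d private tests; the upper bound on t makes this O(d
  -- log n) per item.
  · have h6 : (t : ℝ) / d ≤ |K| * (d * Real.log n) := by
      rw [div_le_iff₀ (by linarith)]
      calc (t : ℝ) ≤ K * ((d : ℝ) ^ 2 * Real.log n) := htK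
        _ ≤ |K| * ((d : ℝ) ^ 2 * Real.log n) := by gcongr
        _ = |K| * (d * Real.log n) * d := by ring
    calc (τ : ℝ) ≤ 600 * (n * ((d + 1) * (Nat.log 2 n + 2))) + 6 * (n * ((t / d : ℕ) : ℝ)) := hτ'
      _ ≤ 600 * (n * ((2 * d) * (3 * (2 * Real.log n)))) + 6 * (n * (|K| * (d * Real.log n))) := by
          gcongr
          · linarith
          · linarith
          · exact hdiv.trans h6
      _ = (7200 + 6 * |K|) * ((d : ℝ) * n * Real.log n) := by ring

theorem small_regime (A : ℕ) : ∃ c C : ℝ, 0 < c ∧ 0 < C ∧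
    ∀ n d t : ℕ, 2 ≤ n → 1 ≤ d → d ≤ n →
      12288 * ((d : ℝ) ^ 2 * Real.log n) ≤ (t : ℝ) →
      t ≤ n ^ (A * d) →
      ∃ (T : Strategy n t) (τ : ℕ),
        Finds d T ∧
        Constructs ((n + t) ^ 10) program₂ d T τ ∧
        BuiltFromLinearCode (family T) ((d : ℝ) / ((d : ℝ) + 1)) ∧
        (maxYes d T : ℝ) < ((t : ℝ) + 1) * d / (2 * ((d : ℝ) + 1)) ∧
        c * ((d : ℝ) ^ 2 * Real.log n / Real.log ((t : ℝ) / (maxYes d T : ℝ))) ≤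
          (maxYes d T : ℝ) ∧
        (maxYes d T : ℝ) ≤
          C * ((d : ℝ) ^ 2 * Real.log n / Real.log ((t : ℝ) / (maxYes d T : ℝ))) ∧
        (maxYes d T : ℝ) ≤
          C * ((d : ℝ) ^ 2 * Real.log n / Real.log ((t : ℝ) / ((d : ℝ) ^ 2 * Real.log n))) ∧
        c * ((d : ℝ) * n * Real.log n / Real.log ((t : ℝ) / (maxYes d T : ℝ))) ≤ (τ : ℝ) ∧
        (τ : ℝ) ≤
          C * ((d : ℝ) * n * Real.log n / Real.log ((t : ℝ) / (maxYes d T : ℝ))) ∧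
        (τ : ℝ) ≤
          C * ((d : ℝ) * n * Real.log n /
            Real.log ((t : ℝ) / ((d : ℝ) ^ 2 * Real.log n))) := by
  have hA : (0 : ℝ) ≤ A := Nat.cast_nonneg A
  -- The summand 600 comes from the running time, and `7 * A` pays for the computation of log_n t.
  -- Together they also majorize the constants 300 and 4A + 4 of the length bounds.
  set B : ℝ := 600 + 7 * A with hB
  have hB0 : 0 < B := by positivity
  refine ⟨1 / (2 * B), 2 * B ^ 2, by positivity, by positivity, ?_⟩
  intro n d t hn hd hdn ht htA
  have ht' := tests_ge hn ht
  have hg0 : 0 < Nat.log 2 n := Nat.log_pos Nat.one_lt_two hn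
  have hdg : 0 < d * d * Nat.log 2 n := by positivity
  have hL := half_lt_log hn
  have hL0 : 0 < Real.log n := by linarith
  have hd1 : (1 : ℝ) ≤ d := by exact_mod_cast hd
  have hn1 : (2 : ℝ) ≤ n := by exact_mod_cast hn
  have hdL : 0 < (d : ℝ) * Real.log n := by positivity
  have hpos : 0 < Real.log ((t : ℝ) / ((d : ℝ) ^ 2 * Real.log n)) := by
    apply Real.log_pos
    have hD : 0 < (d : ℝ) ^ 2 * Real.log n := by positivity
    rw [lt_div_iff₀ hD]
    linarith
  rcases lt_or_ge 3 (Nat.log n t) with hs | hs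
  · obtain ⟨T, τ, h1, h2, h3, h4, h5, h6, h7⟩ :=
      exists_strategy_repetition hn hd hdn hs (by omega)
    obtain ⟨g1, g2, g3, g4, g5⟩ := repetition_length_bounds hn hd hdn hs htA rfl
    have hm0 : 0 < d / Nat.log n t + 1 := Nat.succ_pos _
    generalize d / Nat.log n t + 1 = m at *
    have hm0' : (0 : ℝ) < m := by exact_mod_cast hm0
    refine ⟨T, τ, h1, h2, h3, asymptotic_bounds (m := m) (by linarith) (by linarith) hd1 hL0
      hm0' g1 (g2.trans ?_) (g3.trans ?_) (g4.trans ?_) hpos (by exact_mod_cast h4)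
      (by exact_mod_cast h5) (by exact_mod_cast h6) ?_⟩
    · gcongr
      linarith
    · have h8 : 0 ≤ m * Real.log ((t : ℝ) / (d * m)) := by linarith
      gcongr
      linarith
    · gcongr
      linarith
    · have h8 : (τ : ℝ) ≤ 600 * (n * m) + 7 * Nat.log n t := by exact_mod_cast h7
      rw [hB]
      linarith
  · obtain ⟨h, a, z, T, τ, hC, hhg, hta, h1, h2, h3, h4, h5, h6, h7⟩ :=
      exists_strategy_ratio hn hd hdn hs ht'
    obtain ⟨g1, g2, g3, g4⟩ := hC.length_bounds hhg hta rfl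
    have hm0 : 0 < (d + 1) * z := by
      rw [hC.z_eq]
      exact Nat.mul_pos d.succ_pos (Nat.succ_pos _)
    generalize (d + 1) * z = m at *
    have hm0' : (0 : ℝ) < m := by exact_mod_cast hm0
    refine ⟨T, τ, h1, h2, h3, asymptotic_bounds (m := m) (by linarith) (by linarith) hd1 hL0
      hm0' g1 (g2.trans ?_) (g3.trans ?_) (g4.trans ?_) hpos (by exact_mod_cast h4)
      (by exact_mod_cast h5) (by exact_mod_cast h6) ?_⟩
    · gcongr
      linarith
    · exact le_mul_of_one_le_left (by linarith) (by linarith)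
    · gcongr
      linarith
    · have h8 : (τ : ℝ) ≤ 600 * (n * m) := by exact_mod_cast h7
      have h9 : 0 ≤ (A : ℝ) * (n * m) := by positivity
      rw [hB]
      linarith

end

end GroupTesting

theorem theorem14 :
    ∃ (P₁ P₂ : GroupTesting.Prog) (e : ℕ) (C₀ : ℝ), 0 < C₀ ∧
      -- the regime in which the number of positive responses is large
      (∀ K : ℝ, ∃ c C : ℝ, 0 < c ∧ 0 < C ∧
        ∀ n d t : ℕ, 2 ≤ n → 1 ≤ d → d ≤ n →
          C₀ * ((d : ℝ) ^ 2 * Real.log n) ≤ (t : ℝ) →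
          (t : ℝ) ≤ K * ((d : ℝ) ^ 2 * Real.log n) →
          ∃ (T : GroupTesting.Strategy n t) (τ : ℕ),
            GroupTesting.Finds d T ∧
            GroupTesting.Constructs ((n + t) ^ e) P₁ d T τ ∧
            ((t : ℝ) + 1) * d / (2 * ((d : ℝ) + 1)) ≤ (GroupTesting.maxYes d T : ℝ) ∧
            c * ((d : ℝ) ^ 2 * Real.log n) ≤ (GroupTesting.maxYes d T : ℝ) ∧
            (GroupTesting.maxYes d T : ℝ) ≤ C * ((d : ℝ) ^ 2 * Real.log n) ∧
            c * ((d : ℝ) * n * Real.log n) ≤ (τ : ℝ) ∧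
            (τ : ℝ) ≤ C * ((d : ℝ) * n * Real.log n)) ∧
      -- the regime in which the number of positive responses is small
      (∀ A : ℕ, ∃ c C : ℝ, 0 < c ∧ 0 < C ∧
        ∀ n d t : ℕ, 2 ≤ n → 1 ≤ d → d ≤ n →
          C₀ * ((d : ℝ) ^ 2 * Real.log n) ≤ (t : ℝ) →
          t ≤ n ^ (A * d) →
          ∃ (T : GroupTesting.Strategy n t) (τ : ℕ),
            GroupTesting.Finds d T ∧
            GroupTesting.Constructs ((n + t) ^ e) P₂ d T τ ∧
            GroupTesting.BuiltFromLinearCode (GroupTesting.family T)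
              ((d : ℝ) / ((d : ℝ) + 1)) ∧
            (GroupTesting.maxYes d T : ℝ) < ((t : ℝ) + 1) * d / (2 * ((d : ℝ) + 1)) ∧
            c * ((d : ℝ) ^ 2 * Real.log n /
                Real.log ((t : ℝ) / (GroupTesting.maxYes d T : ℝ))) ≤
              (GroupTesting.maxYes d T : ℝ) ∧
            (GroupTesting.maxYes d T : ℝ) ≤
              C * ((d : ℝ) ^ 2 * Real.log n /
                Real.log ((t : ℝ) / (GroupTesting.maxYes d T : ℝ))) ∧
            (GroupTesting.maxYes d T : ℝ) ≤
              C * ((d : ℝ) ^ 2 * Real.log n /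
                Real.log ((t : ℝ) / ((d : ℝ) ^ 2 * Real.log n))) ∧
            c * ((d : ℝ) * n * Real.log n /
                Real.log ((t : ℝ) / (GroupTesting.maxYes d T : ℝ))) ≤ (τ : ℝ) ∧
            (τ : ℝ) ≤
              C * ((d : ℝ) * n * Real.log n /
                Real.log ((t : ℝ) / (GroupTesting.maxYes d T : ℝ))) ∧
            (τ : ℝ) ≤
              C * ((d : ℝ) * n * Real.log n /
                Real.log ((t : ℝ) / ((d : ℝ) ^ 2 * Real.log n)))) :=
  ⟨GroupTesting.program₁, GroupTesting.program₂, 10, 12288, by norm_num, GroupTesting.large_regime,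
    GroupTesting.small_regime⟩
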